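/- Let $(M,g)$ be a general-relativistic spacetime: a 4-dimensional smooth (Hausdorff) manifold with a smooth metric of Lorentzian signature $(-,+,+,+)$ and a time orientation. An *observer field* is a smooth vector field $V$ on $M$ that is everywhere timelike and future-pointing; it is *standard* if $g(V,V)=-1$. A *clock in $V$* is an integral curve $\gamma:I\to M$ of $V$, defined on an open interval $I$, that is an embedding; $V$ fixes its parameter up to an additive constant (the zero point of the clock). A *light ray* is a lightlike geodesic. For a clock $\gamma$, an open set $W\subset M$ and an event $q$ off the worldline of $\gamma$, the *radar method can be carried through at $q$ within $W$* if exactly one future-pointing and exactly one past-pointing light ray that stays in $W$ connects $q$ to $\gamma$; if these rays meet $\gamma$ at $\gamma(t_2)$ and $\gamma(t_1)$, respectively, the *radar time* of $q$ with respect to $\gamma$ is $T=\tfrac12(t_1+t_2)$. A clock $\tilde\gamma$ is *(Einstein, radar) synchronous to* $\gamma$ (within $W$) if the radar time of $\tilde\gamma(\tilde t)$ with respect to $\gamma$ is $\tilde t$ for all $\tilde t$ in the domain of $\tilde\gamma$. $V$ has *Property A* if sufficiently close clocks in $V$ are synchronous to each other once all their zero points have been chosen suitably; precisely, if every clock in $V$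 has an open neighborhood $W$ such that - for every clock $\gamma$ in $V$ that runs in $W$, every point of $\gamma$ has an open neighborhood $U\subset W$ such that the radar method with respect to $\gamma$ can be carried through within $W$ at all events of $U$ off the worldline of $\gamma$; and - the zero points of all clocks in $V$ that run in $W$ can be chosen consistently (i.e. there is a function $\tau:W\to\mathbb R$ that along each such clock equals the clock's parameter up to an additive constant, and each clock is set to show $\tau$) in such a way that, for each such clock $\gamma$, any other such clock with worldline disjoint from that of $\gamma$, at all of whose events the radar method with respect to $\gamma$ can be carried through within $W$, is synchronous to $\gamma$. Let $\nabla$ be the Levi-Civita connection of $g$. $V$ is a *Killing vector field* if $g(\nabla_uV,w)+g(\nabla_wV,u)=0$ for all tangent vectors $u,w$ at the same point, a *conformal Killing vector field* if there is a function $f:M\to\mathbb R$ with $g(\nabla_uV,w)+g(\nabla_wV,u)=f\,g(u,w)$ for all such $u,w$, and *irrotational* if $g(\nabla_uV,w)=g(\nabla_wV,u)$ for all $u,w$ orthogonal to $V$. **Proposition.** Let $V$ be an observer field on $(M,g)$. (i) If $V$ is standard, then $V$ has Property A if and only if $V$ is an irrotational Killing vector field. (ii) In general (whether or not $V$ is standard),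 $V$ has Property A if and only if $V$ is an irrotational conformal Killing vector field. -/

import Mathlib

open scoped Manifold ContDiff
open Set

noncomputable section

/-- A general-relativistic spacetime structure on a `4`-dimensional smooth manifold `M`: a smooth
metric tensor field `g` of Lorentzian signature `(-,+,+,+)` and a time orientation, the latter
given by a smooth timelike vector field that is declared to be future-pointing. -/
structure Spacetime (M : Type*) [TopologicalSpace M] [ChartedSpace (EuclideanSpace ℝ (Fin 4)) M]
    [IsManifold (𝓡 4) ∞ M] where
  /-- The metric tensor. -/
  g (x : M) : TangentSpace (𝓡 4) x →L[ℝ] TangentSpace (𝓡 4) x →L[ℝ] ℝ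
  symm (x : M) (v w : TangentSpace (𝓡 4) x) : g x v w = g x w v
  /-- Signature `(-,+,+,+)`: some vector is timelike and `g` is positive definite on its
  orthogonal complement. -/
  lorentzian (x : M) : ∃ v : TangentSpace (𝓡 4) x, g x v v < 0 ∧
    ∀ w : TangentSpace (𝓡 4) x, w ≠ 0 → g x v w = 0 → 0 < g x w w
  smooth_g : ContMDiff (𝓡 4)
    ((𝓡 4).prod 𝓘(ℝ, EuclideanSpace ℝ (Fin 4) →L[ℝ] EuclideanSpace ℝ (Fin 4) →L[ℝ] ℝ)) ∞
    (fun x ↦ Bundle.TotalSpace.mk'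
      (EuclideanSpace ℝ (Fin 4) →L[ℝ] EuclideanSpace ℝ (Fin 4) →L[ℝ] ℝ)
      (E := fun x : M ↦ TangentSpace (𝓡 4) x →L[ℝ] TangentSpace (𝓡 4) x →L[ℝ] ℝ) x (g x))
  /-- A timelike vector field giving the time orientation. -/
  timeField (x : M) : TangentSpace (𝓡 4) x
  timeField_timelike (x : M) : g x (timeField x) (timeField x) < 0
  smooth_timeField : ContMDiff (𝓡 4) (𝓡 4).tangent ∞
    (fun x ↦ (⟨x, timeField x⟩ : TangentBundle (𝓡 4) M))

namespace Spacetime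

variable {M : Type*} [TopologicalSpace M] [ChartedSpace (EuclideanSpace ℝ (Fin 4)) M]
  [IsManifold (𝓡 4) ∞ M]

/-- A causal vector `v` at `x` is future-pointing if it lies in the same half of the causal cone
as the time orientation field. (The condition forces `v ≠ 0`; it is only used for timelike and
lightlike vectors.) -/
def FuturePointing (S : Spacetime M) (x : M) (v : TangentSpace (𝓡 4) x) : Prop :=
  S.g x (S.timeField x) v < 0

/-! ### Coordinate expressions -/

/-- The metric in the chart `φ`: the pullback of `g` under the inverse of `φ`. -/
def metricInChart (S : Spacetime M) (φ : OpenPartialHomeomorph M (EuclideanSpace ℝ (Fin 4)))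
    (y u w : EuclideanSpace ℝ (Fin 4)) : ℝ :=
  S.g (φ.symm y) (mfderiv (𝓡 4) (𝓡 4) φ.symm y ((NormedSpace.fromTangentSpace y).symm u))
    (mfderiv (𝓡 4) (𝓡 4) φ.symm y ((NormedSpace.fromTangentSpace y).symm w))

/-- A vector field in the chart `φ`: its push-forward under `φ`. -/
def fieldInChart (V : (x : M) → TangentSpace (𝓡 4) x)
    (φ : OpenPartialHomeomorph M (EuclideanSpace ℝ (Fin 4)))
    (y : EuclideanSpace ℝ (Fin 4)) : EuclideanSpace ℝ (Fin 4) :=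
  NormedSpace.fromTangentSpace (φ (φ.symm y)) (mfderiv (𝓡 4) (𝓡 4) φ (φ.symm y) (V (φ.symm y)))

/-- The Christoffel symbols of the first kind of the Levi-Civita connection in the chart `φ`,
`Γ(u, v; w) = g(Γ(u, v), w) = (∂ᵤ g(v, w) + ∂ᵥ g(u, w) - ∂_w g(u, v)) / 2`. -/
def christoffel (S : Spacetime M) (φ : OpenPartialHomeomorph M (EuclideanSpace ℝ (Fin 4)))
    (y u v w : EuclideanSpace ℝ (Fin 4)) : ℝ :=
  (fderiv ℝ (fun z ↦ S.metricInChart φ z v w) y u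
    + fderiv ℝ (fun z ↦ S.metricInChart φ z u w) y v
    - fderiv ℝ (fun z ↦ S.metricInChart φ z u v) y w) / 2

/-- The covariant derivative of the vector field `V`, with its index lowered, in the chart `φ`:
`g(∇ᵤ V, w) = g(∂ᵤ V, w) + Γ(u, V; w)`. -/
def covDeriv (S : Spacetime M) (V : (x : M) → TangentSpace (𝓡 4) x)
    (φ : OpenPartialHomeomorph M (EuclideanSpace ℝ (Fin 4)))
    (y u w : EuclideanSpace ℝ (Fin 4)) : ℝ :=
  S.metricInChart φ y (fderiv ℝ (fieldInChart V φ) y u) w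
    + S.christoffel φ y u (fieldInChart V φ y) w

/-! ### Observer fields -/

/-- An observer field: a smooth vector field, everywhere timelike and future-pointing. -/
structure IsObserverField (S : Spacetime M) (V : (x : M) → TangentSpace (𝓡 4) x) : Prop where
  smooth : ContMDiff (𝓡 4) (𝓡 4).tangent ∞ (fun x ↦ (⟨x, V x⟩ : TangentBundle (𝓡 4) M))
  timelike (x : M) : S.g x (V x) (V x) < 0
  future (x : M) : S.FuturePointing x (V x)

/-- A standard observer field is normalized to `g(V, V) = -1`. -/
def IsStandard (S : Spacetime M) (V : (x : M) → TangentSpace (𝓡 4) x) : Prop :=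
  ∀ x, S.g x (V x) (V x) = -1

/-- Killing's equation `g(∇ᵤ V, w) + g(∇_w V, u) = 0` in every smooth chart. -/
def IsKilling (S : Spacetime M) (V : (x : M) → TangentSpace (𝓡 4) x) : Prop :=
  ∀ φ ∈ IsManifold.maximalAtlas (𝓡 4) ∞ M, ∀ y ∈ φ.target, ∀ u w : EuclideanSpace ℝ (Fin 4),
    S.covDeriv V φ y u w + S.covDeriv V φ y w u = 0

/-- The conformal Killing equation `g(∇ᵤ V, w) + g(∇_w V, u) = f g(u, w)` with some scalar
function `f` on `M` (which is smooth as soon as `V` is). -/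
def IsConformalKilling (S : Spacetime M) (V : (x : M) → TangentSpace (𝓡 4) x) : Prop :=
  ∃ f : M → ℝ, ∀ φ ∈ IsManifold.maximalAtlas (𝓡 4) ∞ M, ∀ y ∈ φ.target,
    ∀ u w : EuclideanSpace ℝ (Fin 4),
      S.covDeriv V φ y u w + S.covDeriv V φ y w u = f (φ.symm y) * S.metricInChart φ y u w

/-- `V` is irrotational: the antisymmetric part of the covariant derivative of `V`, projected onto
the orthogonal complement of `V`, vanishes. -/
def IsIrrotational (S : Spacetime M) (V : (x : M) → TangentSpace (𝓡 4) x) : Prop :=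
  ∀ φ ∈ IsManifold.maximalAtlas (𝓡 4) ∞ M, ∀ y ∈ φ.target, ∀ u w : EuclideanSpace ℝ (Fin 4),
    S.metricInChart φ y (fieldInChart V φ y) u = 0 →
    S.metricInChart φ y (fieldInChart V φ y) w = 0 →
      S.covDeriv V φ y u w = S.covDeriv V φ y w u

/-! ### Light rays -/

/-- `c` is an (affinely parametrized) geodesic on the open set `J` of parameters:
`g(x'', w) + Γ(x', x'; w) = 0` for all `w`, where `x` is the expression of `c` in any chart. -/
def IsGeodesicOn (S : Spacetime M) (c : ℝ → M) (J : Set ℝ) : Prop :=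
  ContMDiffOn 𝓘(ℝ, ℝ) (𝓡 4) ∞ c J ∧
  ∀ φ ∈ IsManifold.maximalAtlas (𝓡 4) ∞ M, ∀ s ∈ J, c s ∈ φ.source →
    ∀ w : EuclideanSpace ℝ (Fin 4),
      S.metricInChart φ (φ (c s)) (deriv (deriv (fun r ↦ φ (c r))) s) w
        + S.christoffel φ (φ (c s)) (deriv (fun r ↦ φ (c r)) s) (deriv (fun r ↦ φ (c r)) s) w = 0

/-- The tangent vector of the curve `c` at the parameter value `s`. -/
def velocity (c : ℝ → M) (s : ℝ) : TangentSpace (𝓡 4) (c s) :=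
  mfderiv 𝓘(ℝ, ℝ) (𝓡 4) c s ((NormedSpace.fromTangentSpace s).symm 1)

/-- `c`, restricted to the parameter interval `[0,1]`, is a light ray from `p` to `q` that stays
within `W`: a lightlike geodesic, affinely parametrized by `[0,1]` towards the future. -/
def IsLightRay (S : Spacetime M) (W : Set M) (p q : M) (c : ℝ → M) : Prop :=
  c 0 = p ∧ c 1 = q ∧ MapsTo c (Icc 0 1) W ∧
  ∃ J : Set ℝ, IsOpen J ∧ Icc 0 1 ⊆ J ∧ S.IsGeodesicOn c J ∧
    ∀ s ∈ J, S.g (c s) (velocity c s) (velocity c s) = 0 ∧ S.FuturePointing (c s) (velocity c s)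

/-! ### Clocks and the radar method -/

/-- A clock in the observer field `V`: an integral curve of `V`, defined on an open interval `I`,
that is an embedding. -/
structure IsClockIn (V : (x : M) → TangentSpace (𝓡 4) x) (γ : ℝ → M) (I : Set ℝ) : Prop where
  isOpen : IsOpen I
  ordConnected : I.OrdConnected
  integralCurve : IsMIntegralCurveOn (I := 𝓡 4) γ V I
  embedding : Topology.IsEmbedding (I.domRestrict γ)

/-- The radar method with respect to the clock `γ : I → M`, with light rays that stay within `W`,
can be carried through at the event `q`: precisely one future-pointing and precisely one
past-pointing light ray within `W` connects `q` to the worldline of `γ`. (A past-pointing light ray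
from `q` to `γ` is a light ray from `γ` to `q` run backwards.) -/
def RadarAt (S : Spacetime M) (W : Set M) (γ : ℝ → M) (I : Set ℝ) (q : M) : Prop :=
  (∃ c, (∃ t ∈ I, S.IsLightRay W q (γ t) c) ∧
    ∀ c', (∃ t ∈ I, S.IsLightRay W q (γ t) c') → EqOn c' c (Icc 0 1)) ∧
  (∃ c, (∃ t ∈ I, S.IsLightRay W (γ t) q c) ∧
    ∀ c', (∃ t ∈ I, S.IsLightRay W (γ t) q c') → EqOn c' c (Icc 0 1))

/-- `T` is the radar time `(t₁ + t₂) / 2` of the event `q`, where a light ray is emitted from `γ` at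
`t₁`, reflected at `q` and received by `γ` at `t₂`. -/
def IsRadarTime (S : Spacetime M) (W : Set M) (γ : ℝ → M) (I : Set ℝ) (q : M) (T : ℝ) : Prop :=
  ∃ t₁ ∈ I, ∃ t₂ ∈ I, (∃ c, S.IsLightRay W (γ t₁) q c) ∧ (∃ c, S.IsLightRay W q (γ t₂) c) ∧
    T = (t₁ + t₂) / 2

/-- `U` is a radar neighborhood with respect to `γ`, with light rays that stay within `W`. -/
def IsRadarNeighborhood (S : Spacetime M) (U W : Set M) (γ : ℝ → M) (I : Set ℝ) : Prop :=
  IsOpen U ∧ U ⊆ W ∧ ∀ q ∈ U \ γ '' I, S.RadarAt W γ I q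

/-- The clock `γ' : I' → M` is (Einstein, radar) synchronous to the clock `γ : I → M`: the radar
time of the event `γ' t` with respect to `γ` is `t`. -/
def Synchronous (S : Spacetime M) (W : Set M) (γ : ℝ → M) (I : Set ℝ) (γ' : ℝ → M) (I' : Set ℝ) :
    Prop :=
  ∀ t ∈ I', S.IsRadarTime W γ I (γ' t) t

/-- A choice of the zero points on the dials of all clocks of `V` in `W`, encoded as the function
`τ` that assigns to each event the reading of the clock passing through it: along each clock, `τ`
differs from the given parameter by an additive constant. -/
def IsZeroPointChoice (V : (x : M) → TangentSpace (𝓡 4) x) (W : Set M) (τ : M → ℝ) : Prop :=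
  ∀ γ I, IsClockIn V γ I → MapsTo γ I W → ∃ a : ℝ, ∀ t ∈ I, τ (γ t) = t + a

/-- A clock of `V` in `W` whose zero point is the one prescribed by `τ`. -/
def IsSetClock (V : (x : M) → TangentSpace (𝓡 4) x) (W : Set M) (τ : M → ℝ) (γ : ℝ → M)
    (I : Set ℝ) : Prop :=
  IsClockIn V γ I ∧ MapsTo γ I W ∧ ∀ t ∈ I, τ (γ t) = t

/-- Property A: every clock `γ₀` in `V` has an open neighborhood `W`, within which the radar method
works near every clock, such that the zero points of all clocks in `W` can be chosen in such a
way that, for each clock `γ` in `W`, any other clock in `W` for which the radar method with respect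
to `γ` can be carried through is synchronous to `γ`. -/
def PropertyA (S : Spacetime M) (V : (x : M) → TangentSpace (𝓡 4) x) : Prop :=
  ∀ γ₀ I₀, IsClockIn V γ₀ I₀ →
    ∃ W : Set M, IsOpen W ∧ γ₀ '' I₀ ⊆ W ∧
    (∀ γ I, IsClockIn V γ I → MapsTo γ I W →
      ∀ t ∈ I, ∃ U, γ t ∈ U ∧ S.IsRadarNeighborhood U W γ I) ∧
    ∃ τ : M → ℝ, IsZeroPointChoice V W τ ∧
      ∀ γ I, IsSetClock V W τ γ I → ∀ γ' I', IsSetClock V W τ γ' I' →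
        Disjoint (γ '' I) (γ' '' I') → (∀ t ∈ I', S.RadarAt W γ I (γ' t)) →
          S.Synchronous W γ I γ' I'

end Spacetime

end

open Filter Topology Metric

noncomputable section

set_option maxSynthPendingDepth 3

section

/-! ### The inverse function theorem, smooth case on a neighbourhood -/

section Inverse

variable {E F : Type*} [NormedAddCommGroup E] [NormedSpace ℝ E] [CompleteSpace E]
  [NormedAddCommGroup F] [NormedSpace ℝ F]

/-- A smooth map with invertible derivative at `a` restricts to a smooth diffeomorphism between
open sets. -/
theorem exists_smooth_openPartialHomeomorph {f : E → F} {s : Set E} {a : E} (hs : IsOpen s)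
    (ha : a ∈ s) (hf : ContDiffOn ℝ ∞ f s) (f' : E ≃L[ℝ] F) (hf' : HasFDerivAt f (f' : E →L[ℝ] F) a) :
    ∃ e : OpenPartialHomeomorph E F, (e : E → F) = f ∧ a ∈ e.source ∧ e.source ⊆ s ∧
      ContDiffOn ℝ ∞ e.symm e.target := by
  have hfa : ContDiffAt ℝ ∞ f a := hf.contDiffAt (hs.mem_nhds ha)
  have hcont : ContinuousOn (fderiv ℝ f) s :=
    (hf.continuousOn_fderiv_of_isOpen hs (by simp))
  have hev : ∀ᶠ x in 𝓝 a, fderiv ℝ f x ∈ range ((↑) : (E ≃L[ℝ] F) → E →L[ℝ] F) := by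
    have h1 : ContinuousAt (fderiv ℝ f) a := hcont.continuousAt (hs.mem_nhds ha)
    have h2 := ContinuousLinearEquiv.nhds f'
    rw [← hf'.fderiv] at h2
    exact h1 h2
  obtain ⟨u, hu, huo, hau⟩ := _root_.eventually_nhds_iff.1 hev
  let e₀ := hfa.toOpenPartialHomeomorph f hf' (by simp)
  let e := e₀.restrOpen (s ∩ u) (hs.inter huo)
  refine ⟨e, rfl, ⟨hfa.mem_toOpenPartialHomeomorph_source hf' (by simp), ha, hau⟩,
    fun x hx => hx.2.1, ?_⟩
  intro y hy
  have hx : e.symm y ∈ e.source := e.map_target hy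
  obtain ⟨g, hg⟩ := hu _ hx.2.2
  have hd : ContDiffAt ℝ ∞ f (e.symm y) := hf.contDiffAt (hs.mem_nhds hx.2.1)
  refine (e.contDiffAt_symm (f₀' := g) hy ?_ hd).contDiffWithinAt
  rw [hg]
  exact (hd.differentiableAt (by simp)).hasFDerivAt

end Inverse

/-! ### Superposition operators on spaces of continuous maps -/

section Superposition

variable {K : Type*} [TopologicalSpace K] [CompactSpace K]

/-- Pointwise application of a continuous family of linear maps to a continuous map. -/
def ContinuousMap.clmApply (E F : Type*) [NormedAddCommGroup E] [NormedSpace ℝ E]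
    [NormedAddCommGroup F] [NormedSpace ℝ F] : C(K, E →L[ℝ] F) →L[ℝ] C(K, E) →L[ℝ] C(K, F) :=
  LinearMap.mkContinuous₂
    (LinearMap.mk₂ ℝ (fun (A : C(K, E →L[ℝ] F)) (b : C(K, E)) =>
        (⟨fun t => A t (b t), by fun_prop⟩ : C(K, F)))
      (by intros; ext; simp) (by intros; ext; simp) (by intros; ext; simp)
      (by intros; ext; simp)) 1
    (by
      intro A b
      rw [ContinuousMap.norm_le _ (by positivity)]
      intro t
      simp only [LinearMap.mk₂_apply, ContinuousMap.coe_mk, one_mul]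
      exact (A t).le_of_opNorm_le_of_le (A.norm_coe_le_norm t) (b.norm_coe_le_norm t))

theorem hasFDerivAt_superposition {E F : Type*} [NormedAddCommGroup E] [NormedSpace ℝ E]
    [NormedAddCommGroup F] [NormedSpace ℝ F] (f : C(E, F)) (f' : C(E, E →L[ℝ] F))
    (hf : ∀ x, HasFDerivAt f (f' x) x) (a : C(K, E)) :
    HasFDerivAt (fun b : C(K, E) => f.comp b) (ContinuousMap.clmApply E F (f'.comp a)) a := by
  rw [hasFDerivAt_iff_isLittleO, Asymptotics.isLittleO_iff]
  intro c hc
  have hcomp : IsCompact (range a) := isCompact_range a.continuous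
  have hu := hcomp.uniformContinuousAt_of_continuousAt f' (fun x _ => f'.continuous.continuousAt)
    (Metric.dist_mem_uniformity hc)
  obtain ⟨δ, hδ, hδ'⟩ := Metric.mem_uniformity_dist.1 hu
  filter_upwards [Metric.ball_mem_nhds a hδ] with b hb
  rw [ContinuousMap.norm_le _ (by positivity)]
  intro t
  have hbt : b t ∈ ball (a t) δ := (ContinuousMap.dist_apply_le_dist t).trans_lt hb
  have key := (convex_ball (a t) δ).norm_image_sub_le_of_norm_hasFDerivWithin_le' (f := f)
    (f' := f') (φ := f' (a t)) (C := c) (fun x _ => (hf x).hasFDerivWithinAt)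
    (fun x hx => by
      have := hδ' (a := a t) (b := x) (by rw [dist_comm]; exact hx) (mem_range_self t)
      rw [← dist_eq_norm, dist_comm]
      exact this.le) (mem_ball_self hδ) hbt
  refine key.trans ?_
  gcongr
  exact (b - a).norm_coe_le_norm t

theorem contDiff_superposition_nat.{u} (n : ℕ) {E : Type u} [NormedAddCommGroup E]
    [NormedSpace ℝ E] : ∀ {F : Type u} [NormedAddCommGroup F] [NormedSpace ℝ F] (f : C(E, F)),
    ContDiff ℝ ∞ f → ContDiff ℝ n (fun b : C(K, E) => f.comp b) := by
  induction n with
  | zero =>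
    intro F _ _ f _
    exact contDiff_zero.2 (ContinuousMap.continuous_postcomp f)
  | succ n ih =>
    intro F _ _ f hf
    have h1 := contDiff_infty_iff_fderiv.1 hf
    let f' : C(E, E →L[ℝ] F) := ⟨fderiv ℝ f, h1.2.continuous⟩
    push_cast
    rw [contDiff_succ_iff_hasFDerivAt]
    refine ⟨fun a => ContinuousMap.clmApply E F (f'.comp a), ?_, fun a =>
      hasFDerivAt_superposition f f' (fun x => (h1.1 x).hasFDerivAt) a⟩
    exact (ContinuousMap.clmApply E F).contDiff.comp (ih f' h1.2)

/-- The superposition operator of a smooth map is smooth. -/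
theorem contDiff_superposition.{u} {E F : Type u} [NormedAddCommGroup E] [NormedSpace ℝ E]
    [NormedAddCommGroup F] [NormedSpace ℝ F] (f : C(E, F)) (hf : ContDiff ℝ ∞ f) :
    ContDiff ℝ ∞ (fun b : C(K, E) => f.comp b) :=
  contDiff_infty.2 fun n => contDiff_superposition_nat n f hf

end Superposition

/-! ### Smooth local flows -/

section Flow

variable {E : Type*} [NormedAddCommGroup E] [NormedSpace ℝ E] [CompleteSpace E]

/-- The primitive vanishing at `0`, as an operator on continuous curves on the unit interval. -/
def unitIntervalPrimitive (E : Type*) [NormedAddCommGroup E] [NormedSpace ℝ E] [CompleteSpace E] :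
    C(unitInterval, E) →L[ℝ] C(unitInterval, E) :=
  LinearMap.mkContinuous
    { toFun := fun a => ⟨fun s => ∫ r in (0 : ℝ)..s, a (projIcc 0 1 zero_le_one r), by
        have h : Continuous fun r : ℝ => a (projIcc 0 1 zero_le_one r) :=
          a.continuous.comp continuous_projIcc
        exact (intervalIntegral.continuous_primitive (fun _ _ => h.intervalIntegrable _ _) 0).comp
          continuous_subtype_val⟩
      map_add' := by
        intro a b
        ext s
        have h (c : C(unitInterval, E)) : Continuous fun r : ℝ => c (projIcc 0 1 zero_le_one r) :=
          c.continuous.comp continuous_projIcc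
        exact intervalIntegral.integral_add ((h a).intervalIntegrable _ _)
          ((h b).intervalIntegrable _ _)
      map_smul' := by
        intro c a
        ext s
        exact intervalIntegral.integral_smul _ _ } 1
    (by
      intro a
      rw [ContinuousMap.norm_le _ (by positivity)]
      intro s
      refine (intervalIntegral.norm_integral_le_of_norm_le_const (C := ‖a‖)
        (fun r _ => a.norm_coe_le_norm _)).trans ?_
      have h0 := s.2.1
      have h1 := s.2.2
      rw [sub_zero, abs_of_nonneg h0, one_mul]
      exact mul_le_of_le_one_right (norm_nonneg _) h1)

theorem unitIntervalPrimitive_apply (a : C(unitInterval, E)) (s : unitInterval) :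
    unitIntervalPrimitive E a s = ∫ r in (0 : ℝ)..s, a (projIcc 0 1 zero_le_one r) := rfl

/-- Constant curves, as a linear operator. -/
def constCurve (E : Type*) [NormedAddCommGroup E] [NormedSpace ℝ E] :
    E →L[ℝ] C(unitInterval, E) :=
  LinearMap.mkContinuous
    { toFun := fun x => ContinuousMap.const _ x
      map_add' := fun _ _ => rfl
      map_smul' := fun _ _ => rfl } 1
    (by
      intro x
      rw [ContinuousMap.norm_le _ (by positivity)]
      intro s
      rw [one_mul]
      exact le_rfl)

@[simp]
theorem constCurve_apply {E : Type*} [NormedAddCommGroup E] [NormedSpace ℝ E] (x : E) (s : unitInterval) : constCurve E x s = x := rfl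

/-- A bounded smooth vector field has a smooth local flow. -/
theorem exists_smooth_flow_of_bounded {f : E → E} (hf : ContDiff ℝ ∞ f) {C : ℝ}
    (hC : ∀ x, ‖f x‖ ≤ C) (x₀ : E) :
    ∃ ε > 0, ∃ Φ : ℝ × E → E, ContDiffOn ℝ ∞ Φ (Ioo (-ε) ε ×ˢ ball x₀ ε) ∧
      ∀ x ∈ ball x₀ ε, Φ (0, x) = x ∧
        ∀ t ∈ Ioo (-ε) ε, HasDerivAt (fun s => Φ (s, x)) (f (Φ (t, x))) t := by
  let fc : C(E, E) := ⟨f, hf.continuous⟩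
  let H : (ℝ × E) × C(unitInterval, E) → C(unitInterval, E) := fun u =>
    u.2 - constCurve E u.1.2 - u.1.1 • unitIntervalPrimitive E (fc.comp u.2)
  have hnem : ContDiff ℝ ∞ (fun b : C(unitInterval, E) => fc.comp b) := contDiff_superposition fc hf
  have hH : ContDiff ℝ ∞ H := by
    refine (contDiff_snd.sub ((constCurve E).contDiff.comp (contDiff_snd.comp contDiff_fst))).sub ?_
    exact (contDiff_fst.comp contDiff_fst).smul
      ((unitIntervalPrimitive E).contDiff.comp (hnem.comp contDiff_snd))
  let Θ : (ℝ × E) × C(unitInterval, E) → (ℝ × E) × C(unitInterval, E) := fun u => (u.1, H u)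
  have hΘ : ContDiff ℝ ∞ Θ := contDiff_fst.prodMk hH
  let u₀ : (ℝ × E) × C(unitInterval, E) := ((0, x₀), constCurve E x₀)
  let A : (ℝ × E) →L[ℝ] C(unitInterval, E) := -((constCurve E).comp (ContinuousLinearMap.snd ℝ ℝ E)) -
    (ContinuousLinearMap.fst ℝ ℝ E).smulRight (unitIntervalPrimitive E (fc.comp (constCurve E x₀)))
  let Θ' : ((ℝ × E) × C(unitInterval, E)) ≃L[ℝ] ((ℝ × E) × C(unitInterval, E)) :=
    (ContinuousLinearEquiv.refl ℝ (ℝ × E)).skewProd (ContinuousLinearEquiv.refl ℝ C(unitInterval, E)) A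
  have hΘ' : HasFDerivAt Θ (Θ' : ((ℝ × E) × C(unitInterval, E)) →L[ℝ] ((ℝ × E) × C(unitInterval, E))) u₀ := by
    have h2 : HasFDerivAt H ((ContinuousLinearMap.snd ℝ (ℝ × E) C(unitInterval, E)) +
        A.comp (ContinuousLinearMap.fst ℝ (ℝ × E) C(unitInterval, E))) u₀ := by
      have ha : HasFDerivAt (fun u : (ℝ × E) × C(unitInterval, E) => u.1.1)
          ((ContinuousLinearMap.fst ℝ ℝ E).comp (ContinuousLinearMap.fst ℝ (ℝ × E) C(unitInterval, E))) u₀ :=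
        ((ContinuousLinearMap.fst ℝ ℝ E).comp
          (ContinuousLinearMap.fst ℝ (ℝ × E) C(unitInterval, E))).hasFDerivAt
      have hb : HasFDerivAt (fun u : (ℝ × E) × C(unitInterval, E) => constCurve E u.1.2)
          ((constCurve E).comp ((ContinuousLinearMap.snd ℝ ℝ E).comp
            (ContinuousLinearMap.fst ℝ (ℝ × E) C(unitInterval, E)))) u₀ :=
        ((constCurve E).comp ((ContinuousLinearMap.snd ℝ ℝ E).comp
            (ContinuousLinearMap.fst ℝ (ℝ × E) C(unitInterval, E)))).hasFDerivAt
      have hc : DifferentiableAt ℝ (fun u : (ℝ × E) × C(unitInterval, E) => unitIntervalPrimitive E (fc.comp u.2))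
          u₀ := (((unitIntervalPrimitive E).contDiff.comp
            (hnem.comp contDiff_snd)).differentiable (by simp)) u₀
      refine (((hasFDerivAt_snd (p := u₀)).sub hb).sub (ha.smul hc.hasFDerivAt)).congr_fderiv ?_
      ext u <;> simp [A, u₀, sub_eq_add_neg]
    refine ((hasFDerivAt_fst (p := u₀)).prodMk h2).congr_fderiv ?_
    ext u <;> simp [Θ']
  obtain ⟨e, heΘ, hu₀, -, hesymm⟩ := exists_smooth_openPartialHomeomorph isOpen_univ (mem_univ u₀)
    hΘ.contDiffOn Θ' hΘ'
  have hΘu₀ : Θ u₀ = ((0, x₀), 0) := by simp [Θ, H, u₀]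
  have htgt : ((0, x₀), (0 : C(unitInterval, E))) ∈ e.target := by
    rw [← hΘu₀, ← heΘ]
    exact e.map_source hu₀
  -- a neighbourhood on which everything is controlled
  have h1 : ∀ᶠ p : ℝ × E in 𝓝 (0, x₀), (p, (0 : C(unitInterval, E))) ∈ e.target :=
    (Continuous.prodMk_left (0 : C(unitInterval, E))).continuousAt.eventually (e.open_target.mem_nhds htgt)
  obtain ⟨ρ, hρ, hρs⟩ := Metric.mem_nhds_iff.1 (e.open_source.mem_nhds hu₀)
  obtain ⟨δ, hδ, hδt⟩ := Metric.eventually_nhds_iff.1 h1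
  obtain ⟨r, hr, ε, hε, hsol⟩ :=
    (hf.contDiffAt (x := x₀)).of_le (m := 1) (by simp)
      |>.exists_forall_mem_closedBall_exists_eq_forall_mem_Ioo_hasDerivAt 0
  have hC0 : 0 ≤ C := (norm_nonneg _).trans (hC x₀)
  choose! α hα0 hα using hsol
  obtain ⟨η, hη, hηr, hηε, hηδ, hηρ, hηρC⟩ : ∃ η > 0, η ≤ r ∧ η ≤ ε ∧ η ≤ δ ∧ η ≤ ρ ∧
      η + C * η < ρ := by
    have : ∀ᶠ η : ℝ in 𝓝[>] 0, η + C * η < ρ := by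
      have hcont : Continuous fun η : ℝ => η + C * η := by fun_prop
      have := hcont.tendsto 0
      simp only [mul_zero, add_zero] at this
      exact (this.mono_left nhdsWithin_le_nhds).eventually (gt_mem_nhds hρ)
    have h2 : ∀ᶠ η : ℝ in 𝓝[>] 0, η ≤ min (min r ε) (min δ ρ) :=
      (Ioc_mem_nhdsGT (by positivity)) |> fun h => mem_of_superset h fun x hx => hx.2
    obtain ⟨η, ⟨ha, hb⟩, hc⟩ := ((this.and h2).and self_mem_nhdsWithin).exists
    simp only [le_min_iff] at hb
    exact ⟨η, hc, hb.1.1, hb.1.2, hb.2.1, hb.2.2, ha⟩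
  have hmem : ∀ x ∈ ball x₀ η, x ∈ closedBall x₀ r := fun x hx =>
    ball_subset_closedBall (ball_subset_ball hηr hx)
  have hmain : ∀ t ∈ Ioo (-η) η, ∀ x ∈ ball x₀ η,
      α x t = (e.symm ((t, x), 0)).2 1 := by
    intro t ht x hx
    have hxr := hmem x hx
    have htη : |t| < η := abs_lt.2 ht
    have hin : ∀ s ∈ Icc (0 : ℝ) 1, t * s ∈ Ioo (0 - ε) (0 + ε) := by
      intro s hs
      have : |t * s| < ε := by
        rw [abs_mul, abs_of_nonneg hs.1]
        calc |t| * s ≤ |t| * 1 := by gcongr; exact hs.2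
          _ < ε := by linarith
      simpa using abs_lt.1 this
    have hderiv : ∀ s ∈ Icc (0 : ℝ) 1, HasDerivAt (fun s => α x (t * s)) (t • f (α x (t * s))) s := by
      intro s hs
      have := (hα x hxr (t * s) (hin s hs)).scomp s ((hasDerivAt_id s).const_mul t)
      simpa [Function.comp_def] using this
    have hcontα : ContinuousOn (fun s => α x (t * s)) (Icc 0 1) := fun s hs =>
      (hderiv s hs).continuousAt.continuousWithinAt
    let β : C(unitInterval, E) := ⟨fun s => α x (t * s), hcontα.domRestrict⟩
    have hβ : H ((t, x), β) = 0 := by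
      ext s
      have hsub : ∀ r ∈ uIcc (0 : ℝ) s, r ∈ Icc (0 : ℝ) 1 := by
        intro r hr
        rw [uIcc_of_le s.2.1] at hr
        exact ⟨hr.1, hr.2.trans s.2.2⟩
      have hint : ∫ r in (0 : ℝ)..s, t • f (α x (t * r)) = α x (t * s) - α x (t * 0) :=
        intervalIntegral.integral_eq_sub_of_hasDerivAt (fun r hr => hderiv r (hsub r hr))
          (ContinuousOn.intervalIntegrable (continuousOn_const.smul
            (hf.continuous.comp_continuousOn (hcontα.mono hsub))))
      have hprim : t • unitIntervalPrimitive E (fc.comp β) s =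
          ∫ r in (0 : ℝ)..s, t • f (α x (t * r)) := by
        rw [unitIntervalPrimitive_apply, ← intervalIntegral.integral_smul]
        refine intervalIntegral.integral_congr fun r hr => ?_
        simp only [ContinuousMap.comp_apply, fc, ContinuousMap.coe_mk]
        rw [projIcc_of_mem _ (hsub r hr)]
        rfl
      simp only [H, ContinuousMap.sub_apply, ContinuousMap.smul_apply, constCurve_apply]
      rw [hprim, hint, mul_zero, hα0 x hxr]
      change α x (t * s) - x - (α x (t * s) - x) = 0
      simp
    have hβs : ((t, x), β) ∈ e.source := by
      refine hρs ?_
      rw [mem_ball, Prod.dist_eq, max_lt_iff]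
      constructor
      · rw [Prod.dist_eq, max_lt_iff]
        refine ⟨?_, (mem_ball.1 hx).trans_le hηρ⟩
        simp only [u₀, Real.dist_eq, sub_zero]
        linarith
      · rw [dist_eq_norm]
        have hbd : ‖β - constCurve E x₀‖ ≤ C * |t| + ‖x - x₀‖ := by
          rw [ContinuousMap.norm_le _ (by positivity)]
          intro s
          have hmv : ‖α x (t * s) - α x (t * 0)‖ ≤ |t| * C * ‖(s : ℝ) - 0‖ := by
            refine (convex_Icc (0 : ℝ) 1).norm_image_sub_le_of_norm_hasDerivWithin_le
              (f := fun s => α x (t * s)) (fun r hr => (hderiv r hr).hasDerivWithinAt) ?_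
              (by simp) s.2
            intro r _
            rw [norm_smul, Real.norm_eq_abs]
            gcongr
            exact hC _
          rw [mul_zero, hα0 x hxr] at hmv
          have hs1 : ‖(s : ℝ) - 0‖ ≤ 1 := by
            rw [sub_zero, Real.norm_of_nonneg s.2.1]; exact s.2.2
          calc ‖(β - constCurve E x₀) s‖
              = ‖(α x (t * s) - x) + (x - x₀)‖ := by
                rw [sub_add_sub_cancel]
                rfl
            _ ≤ ‖α x (t * s) - x‖ + ‖x - x₀‖ := norm_add_le _ _
            _ ≤ |t| * C * 1 + ‖x - x₀‖ := by
              gcongr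
              exact hmv.trans (by gcongr)
            _ = _ := by ring
        rw [mem_ball, dist_eq_norm] at hx
        calc ‖β - constCurve E x₀‖ ≤ C * |t| + ‖x - x₀‖ := hbd
          _ ≤ C * η + η := by gcongr
          _ < ρ := by linarith
    have heβ : e ((t, x), β) = ((t, x), 0) := by
      rw [heΘ]; simp only [Θ, hβ]
    rw [← heβ, e.left_inv hβs]
    change α x t = α x (t * (1 : ℝ))
    rw [mul_one]
  refine ⟨η, hη, fun p => α p.2 p.1, ?_, ?_⟩
  · have hsm : ContDiffOn ℝ ∞ (fun p : ℝ × E => (e.symm (p, (0 : C(unitInterval, E)))).2 1)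
        (Ioo (-η) η ×ˢ ball x₀ η) := by
      have h2 : ContDiffOn ℝ ∞ (fun p : ℝ × E => e.symm (p, (0 : C(unitInterval, E)))) (Ioo (-η) η ×ˢ ball x₀ η) := by
        refine hesymm.comp (contDiff_id.prodMk contDiff_const).contDiffOn ?_
        rintro ⟨t, x⟩ ⟨ht, hx⟩
        refine hδt ?_
        rw [Prod.dist_eq, max_lt_iff]
        refine ⟨?_, (mem_ball.1 hx).trans_le hηδ⟩
        simp only [Real.dist_eq, sub_zero]
        exact (abs_lt.2 ht).trans_le hηδ
      exact (ContinuousMap.evalCLM ℝ (1 : unitInterval)).contDiff.comp_contDiffOn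
        (contDiff_snd.comp_contDiffOn h2)
    refine hsm.congr ?_
    rintro ⟨t, x⟩ ⟨ht, hx⟩
    exact hmain t ht x hx
  · intro x hx
    refine ⟨hα0 x (hmem x hx), fun t ht => hα x (hmem x hx) t ?_⟩
    rw [zero_sub, zero_add]
    exact ⟨by linarith [ht.1], by linarith [ht.2]⟩

/-- A vector field that is smooth near `x₀` has a smooth local flow near `x₀`. -/
theorem exists_smooth_flow [FiniteDimensional ℝ E] {f : E → E} {s : Set E} {x₀ : E}
    (hs : s ∈ 𝓝 x₀) (hf : ContDiffOn ℝ ∞ f s) :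
    ∃ ε > 0, ∃ Φ : ℝ × E → E, ContDiffOn ℝ ∞ Φ (Ioo (-ε) ε ×ˢ ball x₀ ε) ∧
      MapsTo Φ (Ioo (-ε) ε ×ˢ ball x₀ ε) s ∧
      ∀ x ∈ ball x₀ ε, Φ (0, x) = x ∧
        ∀ t ∈ Ioo (-ε) ε, HasDerivAt (fun s => Φ (s, x)) (f (Φ (t, x))) t := by
  obtain ⟨R, hR, hRs⟩ := Metric.mem_nhds_iff.1 hs
  let χ : ContDiffBump x₀ := ⟨R / 4, R / 2, by positivity, by linarith⟩
  have hsupp : tsupport (χ : E → ℝ) ⊆ ball x₀ R := by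
    rw [χ.tsupport_eq]
    exact closedBall_subset_ball (by show R / 2 < R; linarith)
  let g : E → E := fun x => χ x • f x
  have hg : ContDiff ℝ ∞ g := by
    rw [contDiff_iff_contDiffAt]
    intro x
    by_cases hx : x ∈ ball x₀ R
    · exact (χ.contDiff.contDiffAt).smul ((hf.mono hRs).contDiffAt (isOpen_ball.mem_nhds hx))
    · have hx' : x ∉ tsupport (χ : E → ℝ) := fun h => hx (hsupp h)
      have : g =ᶠ[𝓝 x] fun _ => 0 := by
        filter_upwards [(isClosed_tsupport (χ : E → ℝ)).isOpen_compl.mem_nhds hx'] with y hy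
        simp [g, image_eq_zero_of_notMem_tsupport hy]
      exact contDiffAt_const.congr_of_eventuallyEq this
  have hgs : HasCompactSupport g := χ.hasCompactSupport.smul_right
  obtain ⟨C, hC⟩ := hg.continuous.bounded_above_of_compact_support hgs
  obtain ⟨ε, hε, Φ, hΦ, hflow⟩ := exists_smooth_flow_of_bounded hg hC x₀
  have hnear : ∀ᶠ p : ℝ × E in 𝓝 (0, x₀), Φ p ∈ ball x₀ (R / 4) := by
    have hc : ContinuousAt Φ (0, x₀) := hΦ.continuousOn.continuousAt
      (prod_mem_nhds (Ioo_mem_nhds (by linarith) hε) (ball_mem_nhds x₀ hε))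
    refine hc.eventually (isOpen_ball.mem_nhds ?_)
    rw [(hflow x₀ (mem_ball_self hε)).1]
    exact mem_ball_self (by positivity)
  obtain ⟨δ, hδ, hδ'⟩ := Metric.eventually_nhds_iff.1 hnear
  have hin : ∀ p ∈ Ioo (-(min ε δ)) (min ε δ) ×ˢ ball x₀ (min ε δ), Φ p ∈ ball x₀ (R / 4) := by
    rintro ⟨t, x⟩ ⟨ht, hx⟩
    refine hδ' ?_
    rw [Prod.dist_eq, max_lt_iff]
    refine ⟨?_, (mem_ball.1 hx).trans_le (min_le_right _ _)⟩
    simp only [Real.dist_eq, sub_zero]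
    exact (abs_lt.2 ht).trans_le (min_le_right _ _)
  have hsubt : Ioo (-(min ε δ)) (min ε δ) ⊆ Ioo (-ε) ε :=
    Ioo_subset_Ioo (neg_le_neg (min_le_left _ _)) (min_le_left _ _)
  have hsubx : ball x₀ (min ε δ) ⊆ ball x₀ ε := ball_subset_ball (min_le_left _ _)
  refine ⟨min ε δ, by positivity, Φ, hΦ.mono (prod_mono hsubt hsubx),
    fun p hp => hRs (ball_subset_ball (by linarith) (hin p hp)), fun x hx =>
    ⟨(hflow x (hsubx hx)).1, fun t ht => ?_⟩⟩
  have h1 : χ (Φ (t, x)) = 1 :=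
    χ.one_of_mem_closedBall (ball_subset_closedBall (hin (t, x) ⟨ht, hx⟩))
  have := (hflow x (hsubx hx)).2 t (hsubt ht)
  simpa [g, h1] using this

end Flow

end

section

/-! ### Lorentzian bilinear forms -/

section Lorentz

variable {E : Type*} [NormedAddCommGroup E] [NormedSpace ℝ E]

/-- A symmetric bilinear form of Lorentzian signature `(-,+,…,+)`. -/
structure IsLorentzForm (b : E →L[ℝ] E →L[ℝ] ℝ) : Prop where
  symm : ∀ v w, b v w = b w v
  exists_timelike : ∃ v, b v v < 0 ∧ ∀ w, w ≠ 0 → b v w = 0 → 0 < b w w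

namespace IsLorentzForm

variable {b : E →L[ℝ] E →L[ℝ] ℝ}

theorem pos_of_orthogonal (hb : IsLorentzForm b) {w u : E} (hw : b w w < 0) (hwu : b w u = 0)
    (hu : u ≠ 0) : 0 < b u u := by
  obtain ⟨v, hv, hpos⟩ := hb.exists_timelike
  by_contra hneg
  rw [not_lt] at hneg
  have hvw : b v w ≠ 0 := by
    intro h
    have hw0 : w ≠ 0 := by
      rintro rfl
      simp at hw
    exact (hpos w hw0 h).not_gt hw
  have hne : b v u • w - b v w • u ≠ 0 := by
    intro h
    have h1 : b w (b v u • w - b v w • u) = 0 := by rw [h]; simp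
    simp only [map_sub, map_smul, hwu, smul_eq_mul, mul_zero, sub_zero, mul_eq_zero] at h1
    have h2 : b v u = 0 := h1.resolve_right hw.ne
    rw [h2, zero_smul, zero_sub, neg_eq_zero, smul_eq_zero] at h
    exact h.elim hvw hu
  have h := hpos _ hne (by simp; ring)
  have h3 : b (b v u • w - b v w • u) (b v u • w - b v w • u)
      = (b v u) ^ 2 * b w w + (b v w) ^ 2 * b u u := by
    have huw : b u w = 0 := by rw [hb.symm, hwu]
    simp [hwu, huw]
    ring
  rw [h3] at h
  nlinarith [sq_nonneg (b v u), sq_nonneg (b v w)]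

theorem ne_zero_of_null (hb : IsLorentzForm b) {v n : E} (hv : b v v < 0) (hn : n ≠ 0)
    (hnn : b n n = 0) : b v n ≠ 0 := fun h =>
  (hb.pos_of_orthogonal hv h hn).ne' hnn

/-- Two timelike vectors in the same half cone see the same half of the null cone. -/
theorem null_neg_of_neg (hb : IsLorentzForm b) {v w n : E} (hv : b v v < 0) (hw : b w w < 0)
    (hvw : b v w < 0) (hn : n ≠ 0) (hnn : b n n = 0) (hvn : b v n < 0) : b w n < 0 := by
  by_contra hneg
  rw [not_lt] at hneg
  set c := b w n / (-b v n) with hc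
  have hc0 : 0 ≤ c := div_nonneg hneg (by linarith)
  have h1 : b (w + c • v) (w + c • v) < 0 := by
    have h2 : b (w + c • v) (w + c • v) = b w w + 2 * c * b v w + c ^ 2 * b v v := by
      simp [hb.symm w v]
      ring
    rw [h2]
    nlinarith [mul_nonneg hc0 (neg_nonneg.2 hvw.le), mul_nonneg (sq_nonneg c) (neg_nonneg.2 hv.le)]
  refine hb.ne_zero_of_null h1 hn hnn ?_
  have : b v n ≠ 0 := hvn.ne
  simp only [map_add, map_smul, add_apply, smul_apply,
    smul_eq_mul, hc]
  field_simp
  ring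

theorem eq_zero_of_forall (hb : IsLorentzForm b) {u : E} (h : ∀ w, b u w = 0) : u = 0 := by
  obtain ⟨v, hv, hpos⟩ := hb.exists_timelike
  by_contra hu
  have h1 := hpos u hu (by rw [hb.symm, h])
  rw [h] at h1
  exact lt_irrefl _ h1

theorem isInvertible [FiniteDimensional ℝ E] (hb : IsLorentzForm b) : b.IsInvertible := by
  have hinj : Function.Injective b := by
    rw [injective_iff_map_eq_zero]
    intro u hu
    exact hb.eq_zero_of_forall fun w => by rw [hu]; simp
  have hfin : Module.finrank ℝ E = Module.finrank ℝ (E →L[ℝ] ℝ) := by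
    rw [← Subspace.dual_finrank_eq (K := ℝ) (V := E)]
    exact LinearEquiv.finrank_eq (LinearMap.toContinuousLinearMap (𝕜 := ℝ) (E := E) (F' := ℝ))
  let e : E ≃ₗ[ℝ] (E →L[ℝ] ℝ) :=
    LinearEquiv.ofInjectiveOfFinrankEq (b : E →ₗ[ℝ] (E →L[ℝ] ℝ)) hinj hfin
  exact ⟨e.toContinuousLinearEquiv, by ext u w; rfl⟩

/-- Reversing the sign along a timelike direction turns a Lorentzian form into a positive definite
one. -/
theorem flip_pos (hb : IsLorentzForm b) {v u : E} (hv : b v v < 0) (hu : u ≠ 0) :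
    0 < b u u + 2 / (-b v v) * (b v u) ^ 2 := by
  set a := b v u / b v v with ha
  have hvne := hv.ne
  have hdec : u = a • v + (u - a • v) := by abel
  have horth : b v (u - a • v) = 0 := by
    simp only [map_sub, map_smul, smul_eq_mul, ha]
    field_simp
    ring
  have horth' : b (u - a • v) v = 0 := by rw [hb.symm, horth]
  have h1 : b u u = a ^ 2 * b v v + b (u - a • v) (u - a • v) := by
    conv_lhs => rw [hdec]
    simp only [map_add, add_apply, map_smul, smul_apply, smul_eq_mul, horth, horth']
    ring
  have h2 : 2 / (-b v v) * (b v u) ^ 2 = -2 * a ^ 2 * b v v := by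
    rw [ha]; field_simp
  rw [h1, h2]
  by_cases hz : u - a • v = 0
  · have ha0 : a ≠ 0 := by
      rintro h0
      rw [h0, zero_smul, sub_zero] at hz
      exact hu hz
    rw [hz]
    simp only [map_zero]
    nlinarith [sq_pos_of_ne_zero ha0]
  · have := hb.pos_of_orthogonal hv horth hz
    nlinarith [sq_nonneg a]

end IsLorentzForm

/-- A positive definite form on a finite-dimensional space dominates the square of the norm. -/
theorem exists_pos_mul_sq_norm_le [FiniteDimensional ℝ E] {q : E → ℝ} (hq : Continuous q)
    (hsmul : ∀ (c : ℝ) u, q (c • u) = c ^ 2 * q u) (hpos : ∀ u, u ≠ 0 → 0 < q u) :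
    ∃ c > 0, ∀ u, c * ‖u‖ ^ 2 ≤ q u := by
  have h0 : q 0 = 0 := by simpa using hsmul 0 0
  by_cases hne : (sphere (0 : E) 1).Nonempty
  · have : ProperSpace E := FiniteDimensional.proper_real E
    obtain ⟨x, hx, hmin⟩ := (isCompact_sphere (0 : E) 1).exists_isMinOn hne hq.continuousOn
    have hx0 : x ≠ 0 := by
      rintro rfl
      simp at hx
    refine ⟨q x, hpos x hx0, fun u => ?_⟩
    by_cases hu : u = 0
    · simp [hu, h0]
    · have hn : ‖u‖ ≠ 0 := norm_ne_zero_iff.2 hu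
      have h1 : ‖u‖⁻¹ • u ∈ sphere (0 : E) 1 := by simp [norm_smul, hn]
      have h2 : q x ≤ q (‖u‖⁻¹ • u) := hmin h1
      have h3 : q u = ‖u‖ ^ 2 * q (‖u‖⁻¹ • u) := by
        rw [← hsmul, smul_smul, mul_inv_cancel₀ hn, one_smul]
      rw [h3, mul_comm]
      gcongr
  · refine ⟨1, one_pos, fun u => ?_⟩
    have hu : u = 0 := by
      by_contra hu
      exact hne ⟨‖u‖⁻¹ • u, by simp [norm_smul, norm_ne_zero_iff.2 hu]⟩
    simp [hu, h0]

end Lorentz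

/-! ### Christoffel symbols of a metric on an open subset of a vector space -/

section Christoffel

variable {E : Type*} [NormedAddCommGroup E] [NormedSpace ℝ E]

/-- The Christoffel symbols of the first kind of a metric `G`. -/
def chrForm (G : E → E →L[ℝ] E →L[ℝ] ℝ) (y : E) : E →L[ℝ] E →L[ℝ] E →L[ℝ] ℝ :=
  (1 / 2 : ℝ) • (fderiv ℝ G y + (fderiv ℝ G y).flip -
    ((ContinuousLinearMap.flipₗᵢ ℝ E E ℝ).toContinuousLinearEquiv :
      (E →L[ℝ] E →L[ℝ] ℝ) →L[ℝ] (E →L[ℝ] E →L[ℝ] ℝ)).comp (fderiv ℝ G y).flip)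

theorem chrForm_apply (G : E → E →L[ℝ] E →L[ℝ] ℝ) (y u v w : E) :
    chrForm G y u v w =
      (fderiv ℝ G y u v w + fderiv ℝ G y v u w - fderiv ℝ G y w u v) / 2 := by
  simp [chrForm]
  ring

/-- The Christoffel symbols of the second kind of a metric `G`. -/
def connection (G : E → E →L[ℝ] E →L[ℝ] ℝ) (y : E) : E →L[ℝ] E →L[ℝ] E :=
  (ContinuousLinearMap.compL ℝ E (E →L[ℝ] ℝ) E (G y).inverse).comp (chrForm G y)

theorem connection_apply (G : E → E →L[ℝ] E →L[ℝ] ℝ) (y u v : E) :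
    connection G y u v = (G y).inverse (chrForm G y u v) := rfl

theorem metric_connection {G : E → E →L[ℝ] E →L[ℝ] ℝ} {y : E} (h : (G y).IsInvertible)
    (u v w : E) : G y (connection G y u v) w = chrForm G y u v w := by
  rw [connection_apply]
  obtain ⟨e, he⟩ := h
  rw [← he, ContinuousLinearMap.inverse_equiv]
  simp

theorem eq_neg_connection_iff {G : E → E →L[ℝ] E →L[ℝ] ℝ} {y : E} (h : (G y).IsInvertible)
    (a u v : E) :
    a = -connection G y u v ↔ ∀ w, G y a w + chrForm G y u v w = 0 := by
  constructor
  · rintro rfl w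
    simp [metric_connection h]
  · intro hw
    have h1 : ∀ w, G y (a + connection G y u v) w = 0 := by
      intro w
      rw [map_add, add_apply, metric_connection h, hw]
    obtain ⟨e, he⟩ := h
    have h2 : e (a + connection G y u v) = 0 := by
      ext w
      have h3 := h1 w
      rw [← he] at h3
      exact h3
    exact eq_neg_of_add_eq_zero_left ((map_eq_zero_iff e e.injective).1 h2)

theorem contDiffOn_fderiv_of_isOpen_infty {F : Type*} [NormedAddCommGroup F] [NormedSpace ℝ F]
    {f : E → F} {s : Set E} (hs : IsOpen s) (hf : ContDiffOn ℝ ∞ f s) :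
    ContDiffOn ℝ ∞ (fderiv ℝ f) s :=
  hf.fderiv_of_isOpen hs (by simp)

theorem contDiffOn_chrForm {G : E → E →L[ℝ] E →L[ℝ] ℝ} {s : Set E} (hs : IsOpen s)
    (hG : ContDiffOn ℝ ∞ G s) : ContDiffOn ℝ ∞ (chrForm G) s := by
  have h1 := contDiffOn_fderiv_of_isOpen_infty hs hG
  have h2 : ContDiffOn ℝ ∞ (fun y => (fderiv ℝ G y).flip) s :=
    (ContinuousLinearMap.flipₗᵢ ℝ E E (E →L[ℝ] ℝ)).contDiff.comp_contDiffOn h1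
  exact ((h1.add h2).sub (contDiffOn_const.clm_comp h2)).const_smul _

theorem contDiffOn_connection [FiniteDimensional ℝ E] {G : E → E →L[ℝ] E →L[ℝ] ℝ} {s : Set E}
    (hs : IsOpen s) (hG : ContDiffOn ℝ ∞ G s) (hinv : ∀ y ∈ s, (G y).IsInvertible) :
    ContDiffOn ℝ ∞ (connection G) s := by
  have : CompleteSpace E := FiniteDimensional.complete ℝ E
  have h1 : ContDiffOn ℝ ∞ (fun y => (G y).inverse) s := by
    intro y hy
    obtain ⟨e, he⟩ := hinv y hy
    have h2 : ContDiffAt ℝ ∞ ContinuousLinearMap.inverse (G y) := by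
      rw [← he]
      exact contDiffAt_map_inverse e
    exact h2.comp_contDiffWithinAt y (hG y hy)
  have h3 : ContDiffOn ℝ ∞ (fun y => ContinuousLinearMap.compL ℝ E (E →L[ℝ] ℝ) E (G y).inverse) s :=
    (ContinuousLinearMap.compL ℝ E (E →L[ℝ] ℝ) E).contDiff.comp_contDiffOn h1
  exact h3.clm_comp (contDiffOn_chrForm hs hG)

/-- The pull-back of a metric under a change of coordinates: transformation of the Christoffel
symbols. -/
theorem chrForm_pullback {G G' : E → E →L[ℝ] E →L[ℝ] ℝ} {ψ : E → E} {y : E}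
    (hψ : ContDiffAt ℝ 2 ψ y) (hG : DifferentiableAt ℝ G (ψ y)) (hG' : DifferentiableAt ℝ G' y)
    (hsymm : ∀ u v, G (ψ y) u v = G (ψ y) v u)
    (heq : ∀ᶠ z in 𝓝 y, ∀ u v, G' z u v = G (ψ z) (fderiv ℝ ψ z u) (fderiv ℝ ψ z v))
    (u v w : E) :
    chrForm G' y u v w = chrForm G (ψ y) (fderiv ℝ ψ y u) (fderiv ℝ ψ y v) (fderiv ℝ ψ y w)
      + G (ψ y) (fderiv ℝ (fderiv ℝ ψ) y u v) (fderiv ℝ ψ y w) := by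
  have hψ1 : DifferentiableAt ℝ ψ y := hψ.differentiableAt (by simp)
  have hψ2 : DifferentiableAt ℝ (fderiv ℝ ψ) y :=
    (hψ.fderiv_right (m := 1) (by norm_num)).differentiableAt (by simp)
  have key : ∀ a b c, fderiv ℝ G' y a b c =
      fderiv ℝ G (ψ y) (fderiv ℝ ψ y a) (fderiv ℝ ψ y b) (fderiv ℝ ψ y c)
      + G (ψ y) (fderiv ℝ (fderiv ℝ ψ) y a b) (fderiv ℝ ψ y c)
      + G (ψ y) (fderiv ℝ ψ y b) (fderiv ℝ (fderiv ℝ ψ) y a c) := by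
    intro a b c
    have h1 : HasFDerivAt (fun z => G' z b c)
        (((ContinuousLinearMap.apply ℝ ℝ c).comp (ContinuousLinearMap.apply ℝ (E →L[ℝ] ℝ) b)).comp
          (fderiv ℝ G' y)) y :=
      ((ContinuousLinearMap.apply ℝ ℝ c).comp
        (ContinuousLinearMap.apply ℝ (E →L[ℝ] ℝ) b)).hasFDerivAt.comp y hG'.hasFDerivAt
    have hc1 : HasFDerivAt (fun z => G (ψ z)) ((fderiv ℝ G (ψ y)).comp (fderiv ℝ ψ y)) y :=
      hG.hasFDerivAt.comp y hψ1.hasFDerivAt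
    have hb : ∀ d, HasFDerivAt (fun z => fderiv ℝ ψ z d)
        ((ContinuousLinearMap.apply ℝ E d).comp (fderiv ℝ (fderiv ℝ ψ) y)) y := fun d =>
      (ContinuousLinearMap.apply ℝ E d).hasFDerivAt.comp y hψ2.hasFDerivAt
    have h2 := (hc1.clm_apply (hb b)).clm_apply (hb c)
    have h3 : HasFDerivAt (fun z => G' z b c) _ y :=
      h2.congr_of_eventuallyEq (heq.mono fun z hz => hz b c)
    have h4 := congrArg (fun L : E →L[ℝ] ℝ => L a) (h1.unique h3)
    simp only [ContinuousLinearMap.comp_apply, ContinuousLinearMap.apply_apply,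
      add_apply, ContinuousLinearMap.flip_apply] at h4
    rw [h4]
    ring
  have hsd : ∀ a b, fderiv ℝ (fderiv ℝ ψ) y a b = fderiv ℝ (fderiv ℝ ψ) y b a := by
    intro a b
    exact (hψ.isSymmSndFDerivAt (by simp)) a b
  rw [chrForm_apply, chrForm_apply, key, key, key, hsd v u, hsd w u, hsd w v,
    hsymm (fderiv ℝ ψ y v) (fderiv ℝ (fderiv ℝ ψ) y u w)]
  ring

end Christoffel

end

section

/-! ### Geodesics of a connection on an open subset of a vector space -/

section Geodesic

variable {E : Type*} [NormedAddCommGroup E] [NormedSpace ℝ E]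

/-- The curve `c` with velocity `v` is a geodesic of the connection `B` on the parameter set `J`. -/
structure IsGeodesicCurve (B : E → E →L[ℝ] E →L[ℝ] E) (J : Set ℝ) (c v : ℝ → E) : Prop where
  hasDerivAt : ∀ s ∈ J, HasDerivAt c (v s) s
  hasDerivAt_velocity : ∀ s ∈ J, HasDerivAt v (-B (c s) (v s) (v s)) s

theorem norm_le_exp_mul_of_norm_deriv_le {u u' : ℝ → E} {K a b : ℝ} (hK : 0 ≤ K)
    (hu : ∀ t ∈ Ioo a b, HasDerivAt u (u' t) t) (hb : ∀ t ∈ Ioo a b, ‖u' t‖ ≤ K * ‖u t‖)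
    {t₀ t : ℝ} (ht₀ : t₀ ∈ Ioo a b) (ht : t ∈ Ioo a b) :
    ‖u t‖ ≤ ‖u t₀‖ * Real.exp (K * (b - a)) := by
  have aux : ∀ (w w' : ℝ → E) (x y : ℝ), x ≤ y → (∀ t ∈ Icc x y, HasDerivAt w (w' t) t) →
      (∀ t ∈ Icc x y, ‖w' t‖ ≤ K * ‖w t‖) → y - x ≤ b - a →
      ‖w y‖ ≤ ‖w x‖ * Real.exp (K * (b - a)) := by
    intro w w' x y hxy hw hw' hlen
    have := norm_le_gronwallBound_of_norm_deriv_right_le (f := w) (f' := w') (δ := ‖w x‖) (K := K)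
      (ε := 0) (a := x) (b := y) (fun t ht => (hw t ht).continuousAt.continuousWithinAt)
      (fun t ht => (hw t ⟨ht.1, ht.2.le⟩).hasDerivWithinAt) le_rfl
      (fun t ht => by simpa using hw' t ⟨ht.1, ht.2.le⟩) y (right_mem_Icc.2 hxy)
    rw [gronwallBound_ε0] at this
    refine this.trans ?_
    gcongr
  rcases le_total t₀ t with h | h
  · exact aux u u' t₀ t h (fun r hr => hu r ⟨ht₀.1.trans_le hr.1, hr.2.trans_lt ht.2⟩)
      (fun r hr => hb r ⟨ht₀.1.trans_le hr.1, hr.2.trans_lt ht.2⟩) (by linarith [ht₀.1, ht.2])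
  · have hr : ∀ r ∈ Icc (-t₀) (-t), -r ∈ Ioo a b := fun r hr =>
      ⟨by linarith [hr.2, ht.1], by linarith [hr.1, ht₀.2]⟩
    have := aux (fun r => u (-r)) (fun r => -u' (-r)) (-t₀) (-t) (by linarith)
      (fun r h' => by
        have h2 := (hu (-r) (hr r h')).scomp r (hasDerivAt_neg r)
        simpa [Function.comp_def] using h2)
      (fun r h' => by simpa using hb (-r) (hr r h')) (by linarith [ht₀.2, ht.1])
    simpa using this

/-- Nearby points are joined by a geodesic whose velocity is close to the coordinate
difference; its initial velocity depends continuously on the end points. -/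
theorem exists_geodesic_between [FiniteDimensional ℝ E] {B : E → E →L[ℝ] E →L[ℝ] E} {s N : Set E}
    {p : E} (hs : s ∈ 𝓝 p) (hB : ContDiffOn ℝ ∞ B s) (hN : N ∈ 𝓝 p) {η : ℝ} (hη : 0 < η) :
    ∃ δ > 0, ∃ w : E × E → E, ContinuousOn w (ball p δ ×ˢ ball p δ) ∧
      ∀ q ∈ ball p δ, ∀ r ∈ ball p δ, ∃ c v : ℝ → E, c 0 = q ∧ c 1 = r ∧ v 0 = w (q, r) ∧
        ContDiffOn ℝ ∞ c (Ioo (-(1 / 2)) (3 / 2)) ∧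
        IsGeodesicCurve B (Ioo (-(1 / 2)) (3 / 2)) c v ∧
        ∀ t ∈ Ioo (-(1 / 2) : ℝ) (3 / 2), c t ∈ N ∧ ‖v t - (r - q)‖ ≤ η * ‖r - q‖ := by
  have : CompleteSpace E := FiniteDimensional.complete ℝ E
  -- bound on the connection
  have hBc : ContinuousAt B p := hB.continuousOn.continuousAt hs
  obtain ⟨K, hK0, hK⟩ : ∃ K > 0, ∀ᶠ y in 𝓝 p, ‖B y‖ ≤ K := by
    refine ⟨‖B p‖ + 1, by positivity, ?_⟩
    have := hBc.norm.eventually (gt_mem_nhds (lt_add_one ‖B p‖))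
    exact this.mono fun y hy => le_of_lt hy
  -- the geodesic spray and its flow
  let f : E × E → E × E := fun z => (z.2, -B z.1 z.2 z.2)
  let s' : Set E := {y | y ∈ s ∧ y ∈ N ∧ ‖B y‖ ≤ K}
  have hs' : s' ∈ 𝓝 p := by
    filter_upwards [hs, hN, hK] with y h1 h2 h3 using ⟨h1, h2, h3⟩
  have hf : ContDiffOn ℝ ∞ f (s' ×ˢ ball 0 1) := by
    have hBf : ContDiffOn ℝ ∞ (fun z : E × E => B z.1) (s' ×ˢ ball 0 1) :=
      hB.comp contDiff_fst.contDiffOn fun z hz => hz.1.1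
    exact contDiff_snd.contDiffOn.prodMk
      ((hBf.clm_apply contDiff_snd.contDiffOn).clm_apply contDiff_snd.contDiffOn).neg
  obtain ⟨ε, hε, Φ, hΦ, hΦS, hflow⟩ := exists_smooth_flow (x₀ := (p, (0 : E)))
    (prod_mem_nhds hs' (ball_mem_nhds _ one_pos)) hf
  set T := ε / 2 with hT
  have hTpos : 0 < T := by positivity
  -- rescaled geodesics
  let c : E → E → ℝ → E := fun q w t => (Φ (T * t, (q, T⁻¹ • w))).1
  let v : E → E → ℝ → E := fun q w t => T • (Φ (T * t, (q, T⁻¹ • w))).2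
  let J := Ioo (-(1 / 2) : ℝ) (3 / 2)
  let D : Set (E × E) := ball p ε ×ˢ ball 0 (T * ε)
  have hDo : IsOpen D := isOpen_ball.prod isOpen_ball
  have hTJ : ∀ t ∈ J, T * t ∈ Ioo (-ε) ε := by
    intro t ht
    constructor <;> nlinarith [ht.1, ht.2]
  have hball : ∀ q w, (q, w) ∈ D → (q, T⁻¹ • w) ∈ ball (p, (0 : E)) ε := by
    rintro q w ⟨hq, hw⟩
    rw [mem_ball, Prod.dist_eq, max_lt_iff]
    refine ⟨hq, ?_⟩
    rw [mem_ball_zero_iff] at hw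
    rw [dist_zero_right, norm_smul, norm_inv, Real.norm_of_nonneg hTpos.le, inv_mul_lt_iff₀ hTpos]
    exact hw
  have hΦd : ∀ q w, (q, w) ∈ D → ∀ t ∈ J, HasDerivAt (fun t => Φ (T * t, (q, T⁻¹ • w)))
      (T • f (Φ (T * t, (q, T⁻¹ • w)))) t := by
    intro q w hqw t ht
    have h1 := (hflow _ (hball q w hqw)).2 (T * t) (hTJ t ht)
    have h2 := h1.scomp t ((hasDerivAt_id t).const_mul T)
    simpa [Function.comp_def] using h2
  have hΦmem : ∀ q w, (q, w) ∈ D → ∀ t ∈ J, Φ (T * t, (q, T⁻¹ • w)) ∈ s' ×ˢ ball (0 : E) 1 :=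
    fun q w hqw t ht => hΦS ⟨hTJ t ht, hball q w hqw⟩
  have hgeo : ∀ q w, (q, w) ∈ D → IsGeodesicCurve B J (c q w) (v q w) := by
    intro q w hqw
    refine ⟨fun t ht => ?_, fun t ht => ?_⟩
    · exact (hasFDerivAt_fst.comp_hasDerivAt t (hΦd q w hqw t ht))
    · have := (hasFDerivAt_snd.comp_hasDerivAt t (hΦd q w hqw t ht)).const_smul T
      refine this.congr_deriv (Eq.symm ?_)
      change -B (c q w t) (T • (Φ (T * t, (q, T⁻¹ • w))).2) (T • (Φ (T * t, (q, T⁻¹ • w))).2) =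
        T • T • -B (c q w t) (Φ (T * t, (q, T⁻¹ • w))).2 (Φ (T * t, (q, T⁻¹ • w))).2
      simp
  have hc0 : ∀ q w, (q, w) ∈ D → c q w 0 = q ∧ v q w 0 = w := by
    intro q w hqw
    have h1 := (hflow _ (hball q w hqw)).1
    constructor
    · simp [c, h1]
    · simp [v, h1, smul_smul, hTpos.ne']
  have h0J : (0 : ℝ) ∈ J := by constructor <;> norm_num
  have h1J : (1 : ℝ) ∈ J := by constructor <;> norm_num
  -- velocity estimates
  set M := Real.exp (K * T * 2) with hM
  have hvb : ∀ q w, (q, w) ∈ D → ∀ t ∈ J, ‖v q w t‖ ≤ ‖w‖ * M := by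
    intro q w hqw t ht
    have := norm_le_exp_mul_of_norm_deriv_le (u := v q w) (K := K * T) (by positivity)
      (hgeo q w hqw).hasDerivAt_velocity (fun r hr => by
        have hm := hΦmem q w hqw r hr
        have hv1 : ‖v q w r‖ ≤ T := by
          have := mem_ball_zero_iff.1 hm.2
          simp only [v, norm_smul, Real.norm_of_nonneg hTpos.le]
          nlinarith
        rw [norm_neg]
        calc ‖B (c q w r) (v q w r) (v q w r)‖ ≤ K * ‖v q w r‖ * ‖v q w r‖ :=
              ContinuousLinearMap.le_of_opNorm₂_le_of_le _ hm.1.2.2 le_rfl le_rfl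
          _ ≤ K * T * ‖v q w r‖ := by gcongr) h0J ht
    rw [(hc0 q w hqw).2] at this
    convert this using 3
    norm_num
  set K₂ := K * M ^ 2 with hK₂
  have hMpos : 0 < M := Real.exp_pos _
  have hK₂pos : 0 < K₂ := by positivity
  have hJconv : Convex ℝ J := convex_Ioo _ _
  have hvd : ∀ q w, (q, w) ∈ D → ∀ t ∈ J, ∀ r ∈ J, ‖v q w t - v q w r‖ ≤ 2 * K₂ * ‖w‖ ^ 2 := by
    intro q w hqw t ht r hr
    have h1 := hJconv.norm_image_sub_le_of_norm_hasDerivWithin_le (f := v q w)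
      (C := K₂ * ‖w‖ ^ 2)
      (fun x hx => ((hgeo q w hqw).hasDerivAt_velocity x hx).hasDerivWithinAt) (fun x hx => by
        rw [norm_neg]
        calc ‖B (c q w x) (v q w x) (v q w x)‖ ≤ K * (‖w‖ * M) * (‖w‖ * M) :=
              ContinuousLinearMap.le_of_opNorm₂_le_of_le _ (hΦmem q w hqw x hx).1.2.2
                (hvb q w hqw x hx) (hvb q w hqw x hx)
          _ = K₂ * ‖w‖ ^ 2 := by rw [hK₂]; ring) hr ht
    have h2 : ‖t - r‖ ≤ 2 := by
      rw [Real.norm_eq_abs, abs_le]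
      constructor <;> linarith [ht.1, ht.2, hr.1, hr.2]
    calc ‖v q w t - v q w r‖ ≤ K₂ * ‖w‖ ^ 2 * ‖t - r‖ := h1
      _ ≤ K₂ * ‖w‖ ^ 2 * 2 := by gcongr
      _ = _ := by ring
  have hcd : ∀ q w, (q, w) ∈ D → ∀ t ∈ J, ‖c q w 1 - q - v q w t‖ ≤ 2 * K₂ * ‖w‖ ^ 2 := by
    intro q w hqw t ht
    have h1 := hJconv.norm_image_sub_le_of_norm_hasDerivWithin_le
      (f := fun x => c q w x - x • v q w t) (f' := fun x => v q w x - v q w t)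
      (C := 2 * K₂ * ‖w‖ ^ 2)
      (fun x hx => by
        have := ((hgeo q w hqw).hasDerivAt x hx).sub ((hasDerivAt_id x).smul_const (v q w t))
        rw [one_smul] at this
        exact this.hasDerivWithinAt)
      (fun x hx => hvd q w hqw x hx t ht) h0J h1J
    simp only [one_smul, zero_smul, sub_zero, norm_one, mul_one, (hc0 q w hqw).1] at h1
    rwa [sub_right_comm] at h1
  -- the exponential map and its inverse
  let Θ : E × E → E × E := fun z => (z.1, c z.1 z.2 1)
  have hcsm : ContDiffOn ℝ ∞ (fun z : E × E => c z.1 z.2 1) D := by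
    refine contDiff_fst.comp_contDiffOn (hΦ.comp (t := Ioo (-ε) ε ×ˢ ball (p, (0 : E)) ε)
      (f := fun z : E × E => (T * 1, (z.1, T⁻¹ • z.2)))
      (contDiff_const.prodMk (contDiff_fst.prodMk (contDiff_snd.const_smul _))).contDiffOn ?_)
    rintro ⟨q, w⟩ hz
    exact ⟨hTJ 1 h1J, hball q w hz⟩
  have hΘ : ContDiffOn ℝ ∞ Θ D := contDiff_fst.contDiffOn.prodMk hcsm
  have hp0 : ((p, 0) : E × E) ∈ D := ⟨mem_ball_self hε, mem_ball_self (by positivity)⟩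
  have hexp : ∀ q w, (q, w) ∈ D → ‖c q w 1 - q - w‖ ≤ 2 * K₂ * ‖w‖ ^ 2 := by
    intro q w hqw
    have := hcd q w hqw 0 h0J
    rwa [(hc0 q w hqw).2] at this
  let Θ' : (E × E) ≃L[ℝ] (E × E) := (ContinuousLinearEquiv.refl ℝ E).skewProd
    (ContinuousLinearEquiv.refl ℝ E) (ContinuousLinearMap.id ℝ E)
  have hcp : c p 0 1 = p := by
    have := hexp p 0 hp0
    simpa [sub_eq_zero] using this
  have hΘ' : HasFDerivAt Θ (Θ' : (E × E) →L[ℝ] (E × E)) (p, 0) := by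
    have h2 : HasFDerivAt (fun z : E × E => c z.1 z.2 1)
        (ContinuousLinearMap.snd ℝ E E + ContinuousLinearMap.fst ℝ E E) (p, 0) := by
      rw [hasFDerivAt_iff_isLittleO, Asymptotics.isLittleO_iff]
      intro κ hκ
      have hsm : ∀ᶠ z : E × E in 𝓝 (p, 0), 2 * K₂ * ‖z.2‖ < κ := by
        have hc : Continuous fun z : E × E => 2 * K₂ * ‖z.2‖ := by fun_prop
        refine hc.continuousAt.eventually (gt_mem_nhds ?_)
        simpa using hκ
      filter_upwards [hDo.mem_nhds hp0, hsm] with z hz hz2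
      have h3 := hexp z.1 z.2 hz
      have h4 : ‖z.2‖ ≤ ‖z - (p, 0)‖ := by
        have := norm_snd_le (z - (p, (0 : E)))
        simpa using this
      simp only [hcp, add_apply, ContinuousLinearMap.coe_snd', ContinuousLinearMap.coe_fst',
        Prod.fst_sub, Prod.snd_sub, sub_zero]
      have h5 : c z.1 z.2 1 - p - (z.2 + (z.1 - p)) = c z.1 z.2 1 - z.1 - z.2 := by abel
      rw [h5]
      calc _ ≤ 2 * K₂ * ‖z.2‖ * ‖z.2‖ := by rw [mul_assoc, ← sq]; exact h3
        _ ≤ κ * ‖z - (p, 0)‖ := by gcongr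
    refine (hasFDerivAt_fst.prodMk h2).congr_fderiv ?_
    ext u <;> simp [Θ']
  obtain ⟨e, heΘ, hpe, heD, hesymm⟩ := exists_smooth_openPartialHomeomorph hDo hp0 hΘ Θ' hΘ'
  have hΘp : e (p, 0) = (p, p) := by rw [heΘ]; simp [Θ, hcp]
  have hpt : (p, p) ∈ e.target := by rw [← hΘp]; exact e.map_source hpe
  have hsymmp : e.symm (p, p) = (p, 0) := by rw [← hΘp]; exact e.left_inv hpe
  let w : E × E → E := fun z => (e.symm z).2
  have hwc : ContinuousOn w e.target := continuous_snd.comp_continuousOn hesymm.continuousOn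
  set κ := min (1 / (4 * K₂)) (η / (4 * K₂)) with hκ
  have hκpos : 0 < κ := by positivity
  have hev : ∀ᶠ z in 𝓝 (p, p), z ∈ e.target ∧ ‖w z‖ < κ := by
    refine Filter.Eventually.and (e.open_target.mem_nhds hpt) ?_
    have h1 : ContinuousAt w (p, p) := hwc.continuousAt (e.open_target.mem_nhds hpt)
    refine h1.norm.eventually (gt_mem_nhds ?_)
    simpa [w, hsymmp] using hκpos
  obtain ⟨δ, hδ, hδ'⟩ := Metric.eventually_nhds_iff.1 hev
  have hin : ∀ z ∈ ball p δ ×ˢ ball p δ, z ∈ e.target ∧ ‖w z‖ < κ := by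
    rintro ⟨q, r⟩ ⟨hq, hr⟩
    refine hδ' ?_
    rw [Prod.dist_eq, max_lt_iff]
    exact ⟨hq, hr⟩
  refine ⟨δ, hδ, w, hwc.mono fun z hz => (hin z hz).1, fun q hq r hr => ?_⟩
  obtain ⟨htgt, hwκ⟩ := hin (q, r) ⟨hq, hr⟩
  have hsrc := e.map_target htgt
  have hee := e.right_inv htgt
  rw [heΘ] at hee
  have hq' : (e.symm (q, r)).1 = q := congrArg Prod.fst hee
  have hqw : (q, w (q, r)) ∈ D := by
    have := heD hsrc
    rwa [← Prod.mk.eta (p := e.symm (q, r)), hq'] at this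
  have hr' : c q (w (q, r)) 1 = r := by
    have := congrArg Prod.snd hee
    simp only [Θ] at this
    rwa [hq'] at this
  refine ⟨c q (w (q, r)), v q (w (q, r)), (hc0 q _ hqw).1, hr', (hc0 q _ hqw).2, ?_,
    hgeo q _ hqw, fun t ht => ⟨(hΦmem q _ hqw t ht).1.2.1, ?_⟩⟩
  · refine contDiff_fst.comp_contDiffOn (hΦ.comp (t := Ioo (-ε) ε ×ˢ ball (p, (0 : E)) ε)
      (f := fun t : ℝ => (T * t, (q, T⁻¹ • w (q, r))))
      ((contDiff_const.mul contDiff_id).prodMk contDiff_const).contDiffOn ?_)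
    intro t ht
    exact ⟨hTJ t ht, hball q _ hqw⟩
  · set W := w (q, r) with hW
    have h1 := hexp q W hqw
    have h2 := hcd q W hqw t ht
    rw [hr'] at h1 h2
    have hk1 : 2 * K₂ * ‖W‖ ^ 2 ≤ 1 / 2 * ‖W‖ := by
      have : ‖W‖ ≤ 1 / (4 * K₂) := hwκ.le.trans (min_le_left _ _)
      rw [le_div_iff₀ (by positivity)] at this
      nlinarith [norm_nonneg W]
    have hk2 : 2 * K₂ * ‖W‖ ^ 2 ≤ η / 2 * ‖W‖ := by
      have : ‖W‖ ≤ η / (4 * K₂) := hwκ.le.trans (min_le_right _ _)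
      rw [le_div_iff₀ (by positivity)] at this
      nlinarith [norm_nonneg W]
    have hk3 : ‖W‖ ≤ 2 * ‖r - q‖ := by
      have : ‖W‖ ≤ ‖r - q‖ + ‖r - q - W‖ := by
        calc ‖W‖ = ‖(r - q) - (r - q - W)‖ := by congr 1; abel
          _ ≤ _ := norm_sub_le _ _
      linarith
    rw [norm_sub_rev]
    calc ‖r - q - v q W t‖ ≤ η / 2 * ‖W‖ := h2.trans hk2
      _ ≤ η / 2 * (2 * ‖r - q‖) := by gcongr
      _ = η * ‖r - q‖ := by ring

end Geodesic

end

section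

/-! ### Null geodesics near a timelike line -/

section Null

variable {E : Type*} [NormedAddCommGroup E] [NormedSpace ℝ E]

theorem IsGeodesicCurve.hasDerivAt_metric {G : E → E →L[ℝ] E →L[ℝ] ℝ} {J : Set ℝ} {c v : ℝ → E}
    (h : IsGeodesicCurve (connection G) J c v) {s : ℝ} (hs : s ∈ J)
    (hG : DifferentiableAt ℝ G (c s)) (hL : (G (c s)).IsInvertible)
    (hsymm : ∀ u w, G (c s) u w = G (c s) w u) :
    HasDerivAt (fun t => G (c t) (v t) (v t)) 0 s := by
  have h1 : HasDerivAt (fun t => G (c t)) (fderiv ℝ G (c s) (v s)) s :=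
    hG.hasFDerivAt.comp_hasDerivAt s (h.hasDerivAt s hs)
  have h2 := (h1.clm_apply (h.hasDerivAt_velocity s hs)).clm_apply (h.hasDerivAt_velocity s hs)
  refine h2.congr_deriv ?_
  have h3 := metric_connection hL (v s) (v s) (v s)
  rw [chrForm_apply] at h3
  simp only [add_apply, map_neg, neg_apply, hsymm (v s) (connection G (c s) (v s) (v s)), h3]
  ring

theorem IsGeodesicCurve.metric_eq {G : E → E →L[ℝ] E →L[ℝ] ℝ} {O : Set E} (hO : IsOpen O)
    (hG : DifferentiableOn ℝ G O) (hL : ∀ y ∈ O, (G y).IsInvertible)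
    (hsymm : ∀ y ∈ O, ∀ u w, G y u w = G y w u) {a b : ℝ} {c v : ℝ → E}
    (h : IsGeodesicCurve (connection G) (Ioo a b) c v) (hc : MapsTo c (Ioo a b) O) {s t : ℝ}
    (hs : s ∈ Ioo a b) (ht : t ∈ Ioo a b) :
    G (c s) (v s) (v s) = G (c t) (v t) (v t) := by
  have hd : ∀ x ∈ Ioo a b, HasDerivAt (fun t => G (c t) (v t) (v t)) 0 x := fun x hx =>
    h.hasDerivAt_metric hx (hG.differentiableAt (hO.mem_nhds (hc hx))) (hL _ (hc hx))
      (hsymm _ (hc hx))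
  have := (convex_Ioo a b).norm_image_sub_le_of_norm_hasDerivWithin_le
    (f := fun t => G (c t) (v t) (v t)) (C := 0) (fun x hx => (hd x hx).hasDerivWithinAt)
    (fun x _ => by simp) ht hs
  simpa [sub_eq_zero] using this

theorem abs_form_sub_le {b b' : E →L[ℝ] E →L[ℝ] ℝ} {κ η : ℝ} (hκ : ‖b' - b‖ ≤ κ)
    (hη : η ≤ 1) {v d : E} (hv : ‖v - d‖ ≤ η * ‖d‖) :
    |b' v v - b d d| ≤ (4 * κ + 3 * ‖b‖ * η) * ‖d‖ ^ 2 := by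
  have hκ0 : 0 ≤ κ := (norm_nonneg _).trans hκ
  have hd0 := norm_nonneg d
  have h1 : ‖v‖ ≤ 2 * ‖d‖ := by
    calc ‖v‖ = ‖(v - d) + d‖ := by simp
      _ ≤ ‖v - d‖ + ‖d‖ := norm_add_le _ _
      _ ≤ η * ‖d‖ + ‖d‖ := by gcongr
      _ ≤ 1 * ‖d‖ + ‖d‖ := by gcongr
      _ = _ := by ring
  have h2 : b' v v - b d d = (b' - b) v v + b (v - d) v + b d (v - d) := by
    simp
  rw [h2, ← Real.norm_eq_abs]
  have h3 : ‖(b' - b) v v‖ ≤ κ * (2 * ‖d‖) * (2 * ‖d‖) :=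
    ContinuousLinearMap.le_of_opNorm₂_le_of_le _ hκ h1 h1
  have h4 : ‖b (v - d) v‖ ≤ ‖b‖ * (η * ‖d‖) * (2 * ‖d‖) :=
    ContinuousLinearMap.le_of_opNorm₂_le_of_le _ le_rfl hv h1
  have h5 : ‖b d (v - d)‖ ≤ ‖b‖ * ‖d‖ * (η * ‖d‖) :=
    ContinuousLinearMap.le_of_opNorm₂_le_of_le _ le_rfl le_rfl hv
  calc _ ≤ ‖(b' - b) v v‖ + ‖b (v - d) v‖ + ‖b d (v - d)‖ := norm_add₃_le
    _ ≤ κ * (2 * ‖d‖) * (2 * ‖d‖) + ‖b‖ * (η * ‖d‖) * (2 * ‖d‖) + ‖b‖ * ‖d‖ * (η * ‖d‖) := by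
      gcongr
    _ = _ := by ring

theorem exists_pos_forall_mul_lt {A a : ℝ} (ha : 0 < a) :
    ∃ κ > 0, ∀ x ≤ κ, 0 ≤ x → A * x < a := by
  refine ⟨a / (2 * (|A| + 1)), by positivity, fun x hx hx0 => ?_⟩
  rw [le_div_iff₀ (by positivity)] at hx
  nlinarith [le_abs_self A, abs_nonneg A]

set_option maxHeartbeats 1600000 in
/-- From every point near `p` off the timelike line `p + ℝ e`, a short null geodesic leads to that
line in the direction of `e`. -/
theorem exists_null_geodesic_to_line [FiniteDimensional ℝ E] {G : E → E →L[ℝ] E →L[ℝ] ℝ}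
    {O N : Set E} {p e : E} (hO : IsOpen O) (hp : p ∈ O) (hG : ContDiffOn ℝ ∞ G O)
    (hL : ∀ y ∈ O, IsLorentzForm (G y)) (he : G p e e < 0) (hN : N ∈ 𝓝 p) :
    ∃ C > 0, ∃ U ∈ 𝓝 p, ∀ q ∈ U, (∀ t : ℝ, q ≠ p + t • e) → ∃ t : ℝ, ∃ c v : ℝ → E,
      c 0 = q ∧ c 1 = p + t • e ∧ ContDiffOn ℝ ∞ c (Ioo (-(1 / 2)) (3 / 2)) ∧
      IsGeodesicCurve (connection G) (Ioo (-(1 / 2)) (3 / 2)) c v ∧ |t| ≤ C * ‖q - p‖ ∧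
      ∀ s ∈ Ioo (-(1 / 2) : ℝ) (3 / 2), c s ∈ N ∧ ‖v s‖ ≤ C * ‖q - p‖ ∧
        G (c s) (v s) (v s) = 0 ∧ G (c s) e (v s) < 0 := by
  set b := G p with hb
  set n := -b e e with hn
  have hn0 : 0 < n := by linarith
  have hLp := hL p hp
  obtain ⟨c₀, hc₀, hpos⟩ := exists_pos_mul_sq_norm_le
    (q := fun u => b u u + 2 / n * (b e u) ^ 2) (by fun_prop)
    (fun c u => by simp; ring) (fun u hu => hLp.flip_pos he hu)
  set β := ‖b‖ with hβ
  set K := Real.sqrt ((β + 1) / n) with hK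
  have hβ0 : 0 ≤ β := norm_nonneg _
  have hK0 : 0 ≤ K := Real.sqrt_nonneg _
  have hK2 : K ^ 2 * n = β + 1 := by
    rw [hK, Real.sq_sqrt (by positivity)]
    field_simp
  set m := 1 + K * ‖e‖ with hm
  have hm0 : 0 < m := by positivity
  set σ := Real.sqrt (c₀ * n / 4) with hσ
  have hσ0 : 0 < σ := Real.sqrt_pos.2 (by positivity)
  have hσ2 : σ ^ 2 = c₀ * n / 4 := Real.sq_sqrt (by positivity)
  -- smallness parameters
  obtain ⟨η₁, hη₁, hη₁'⟩ := exists_pos_forall_mul_lt (A := 3 * β * m ^ 2) (a := min c₀ 1 / 2)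
    (by positivity)
  obtain ⟨η₂, hη₂, hη₂'⟩ := exists_pos_forall_mul_lt (A := 2 * β * ‖e‖) (a := σ) hσ0
  obtain ⟨κ₁, hκ₁, hκ₁'⟩ := exists_pos_forall_mul_lt (A := 4 * m ^ 2) (a := min c₀ 1 / 2)
    (by positivity)
  obtain ⟨κ₂, hκ₂, hκ₂'⟩ := exists_pos_forall_mul_lt (A := ‖e‖) (a := σ) hσ0
  set η := min (min η₁ η₂) (1 / 2) with hη
  have hη0 : 0 < η := by positivity
  have hηh : η ≤ 1 / 2 := min_le_right _ _
  have hηA := hη₁' η ((min_le_left _ _).trans (min_le_left _ _)) hη0.le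
  have hηB := hη₂' η ((min_le_left _ _).trans (min_le_right _ _)) hη0.le
  set κ := min (min κ₁ κ₂) (c₀ / 2) with hκ
  have hκ0 : 0 < κ := by positivity
  have hκh : κ ≤ c₀ / 2 := min_le_right _ _
  have hκA := hκ₁' κ ((min_le_left _ _).trans (min_le_left _ _)) hκ0.le
  have hκB := hκ₂' κ ((min_le_left _ _).trans (min_le_right _ _)) hκ0.le
  have hsum : (4 * κ + 3 * β * η) * m ^ 2 < min c₀ 1 := by
    rw [show (4 * κ + 3 * β * η) * m ^ 2 = 4 * m ^ 2 * κ + 3 * β * m ^ 2 * η by ring]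
    linarith
  have hGc : ContinuousAt G p := hG.continuousOn.continuousAt (hO.mem_nhds hp)
  have hnear : {y | ‖G y - b‖ ≤ κ} ∈ 𝓝 p := by
    have h1 : Tendsto (fun y => ‖G y - b‖) (𝓝 p) (𝓝 0) := by
      have := (hGc.sub (continuousAt_const (y := b))).norm
      simpa [ContinuousAt, hb] using this
    exact (h1.eventually (gt_mem_nhds hκ0)).mono fun y hy => le_of_lt hy
  have hinv : ∀ y ∈ O, (G y).IsInvertible := fun y hy => (hL y hy).isInvertible
  obtain ⟨δ, hδ, w, hwc, hgeo⟩ := exists_geodesic_between (hO.mem_nhds hp)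
    (contDiffOn_connection hO hG hinv) (inter_mem (inter_mem hN (hO.mem_nhds hp)) hnear) hη0
  set C₁ := β * ‖e‖ ^ 2 / n + 1 with hC₁
  have hC₁0 : 0 < C₁ := by positivity
  set C₂ := β * ‖e‖ / n + K * C₁ with hC₂
  have hC₂0 : 0 ≤ C₂ := by positivity
  set C := C₂ + 2 * m * C₁ with hC
  refine ⟨C, by positivity, ball p (δ / (1 + C * ‖e‖ + 1)), ball_mem_nhds _ (by positivity), ?_⟩
  intro q hq hoff
  set z := q - p with hz
  have hzq : ‖z‖ < δ / (1 + C * ‖e‖ + 1) := by rwa [hz, ← dist_eq_norm]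
  have hC0 : 0 < C := by positivity
  have hz1 : ‖z‖ * (1 + C * ‖e‖ + 1) < δ := by rwa [lt_div_iff₀ (by positivity)] at hzq
  have hzn := norm_nonneg z
  have hqδ : q ∈ ball p δ := by
    rw [mem_ball, dist_eq_norm, ← hz]
    have : 0 ≤ ‖z‖ * (C * ‖e‖) := by positivity
    linarith
  -- the foot point
  set t₀ := b e z / b e e with ht₀
  set d₀ := t₀ • e - z with hd₀
  have hbee : b e e ≠ 0 := by linarith
  have horth : b e d₀ = 0 := by
    rw [hd₀, map_sub, map_smul, smul_eq_mul, ht₀]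
    field_simp
    ring
  have horth' : b d₀ e = 0 := by rw [hLp.symm, horth]
  have ht₀b : |t₀| ≤ β * ‖e‖ / n * ‖z‖ := by
    rw [ht₀, abs_div, show |b e e| = n by rw [abs_of_neg he], div_mul_eq_mul_div]
    gcongr
    exact b.le_opNorm₂ e z
  have hd₀b : ‖d₀‖ ≤ C₁ * ‖z‖ := by
    calc ‖d₀‖ ≤ ‖t₀ • e‖ + ‖z‖ := norm_sub_le _ _
      _ = |t₀| * ‖e‖ + ‖z‖ := by rw [norm_smul, Real.norm_eq_abs]
      _ ≤ β * ‖e‖ / n * ‖z‖ * ‖e‖ + ‖z‖ := by gcongr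
      _ = C₁ * ‖z‖ := by rw [hC₁]; ring
  let d : ℝ → E := fun τ => d₀ + (τ * ‖d₀‖) • e
  have hdt : ∀ τ, d τ = (p + (t₀ + τ * ‖d₀‖) • e) - q := by
    intro τ
    simp only [d, hd₀, hz]
    module
  have hd0 : ∀ τ, d τ ≠ 0 := by
    intro τ h
    rw [hdt, sub_eq_zero] at h
    exact hoff _ h.symm
  have hd₀pos : 0 < ‖d₀‖ := by
    have := hd0 0
    simp only [d, zero_mul, zero_smul, add_zero] at this
    exact norm_pos_iff.2 this
  have hdm : ∀ τ ∈ Icc 0 K, ‖d τ‖ ≤ m * ‖d₀‖ := by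
    intro τ hτ
    calc ‖d τ‖ ≤ ‖d₀‖ + ‖(τ * ‖d₀‖) • e‖ := norm_add_le _ _
      _ = ‖d₀‖ + τ * ‖d₀‖ * ‖e‖ := by
        rw [norm_smul, Real.norm_of_nonneg (mul_nonneg hτ.1 hd₀pos.le)]
      _ ≤ ‖d₀‖ + K * ‖d₀‖ * ‖e‖ := by gcongr; exact hτ.2
      _ = m * ‖d₀‖ := by rw [hm]; ring
  have hbd : ∀ τ, b (d τ) (d τ) = b d₀ d₀ - τ ^ 2 * ‖d₀‖ ^ 2 * n := by
    intro τ
    simp only [d, map_add, add_apply, map_smul, smul_apply, smul_eq_mul, horth, horth', hn]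
    ring
  have htb : ∀ τ ∈ Icc 0 K, |t₀ + τ * ‖d₀‖| ≤ C₂ * ‖z‖ := by
    intro τ hτ
    calc |t₀ + τ * ‖d₀‖| ≤ |t₀| + |τ * ‖d₀‖| := abs_add_le _ _
      _ = |t₀| + τ * ‖d₀‖ := by rw [abs_of_nonneg (mul_nonneg hτ.1 hd₀pos.le)]
      _ ≤ β * ‖e‖ / n * ‖z‖ + K * (C₁ * ‖z‖) := by
        gcongr
        exact hτ.2
      _ = C₂ * ‖z‖ := by rw [hC₂]; ring
  let r : ℝ → E := fun τ => p + (t₀ + τ * ‖d₀‖) • e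
  have hrδ : ∀ τ ∈ Icc 0 K, r τ ∈ ball p δ := by
    intro τ hτ
    rw [mem_ball, dist_eq_norm, add_sub_cancel_left, norm_smul, Real.norm_eq_abs]
    have h1 := htb τ hτ
    have h2 : C₂ ≤ C := by rw [hC]; linarith [mul_pos (mul_pos two_pos hm0) hC₁0]
    have h3 : |t₀ + τ * ‖d₀‖| * ‖e‖ ≤ C * ‖z‖ * ‖e‖ := by
      gcongr
      exact h1.trans (by gcongr)
    have h4 : ‖z‖ * (1 + C * ‖e‖ + 1) = C * ‖z‖ * ‖e‖ + 2 * ‖z‖ := by ring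
    linarith
  have hrc : ContinuousOn r (Icc 0 K) := by
    apply Continuous.continuousOn
    fun_prop
  have hest : ∀ τ ∈ Icc 0 K, |G q (w (q, r τ)) (w (q, r τ)) - b (d τ) (d τ)|
      < min c₀ 1 * ‖d₀‖ ^ 2 := by
    intro τ hτ
    obtain ⟨c, v, hc0, hc1, hv0, -, -, hcv⟩ := hgeo q hqδ (r τ) (hrδ τ hτ)
    have h0 := hcv 0 (by constructor <;> norm_num)
    rw [hc0, hv0, ← hdt τ] at h0
    have h1 := abs_form_sub_le h0.1.2 (by linarith) h0.2
    refine h1.trans_lt ?_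
    calc (4 * κ + 3 * ‖b‖ * η) * ‖d τ‖ ^ 2 ≤ (4 * κ + 3 * ‖b‖ * η) * (m * ‖d₀‖) ^ 2 := by
          gcongr
          exact hdm τ hτ
      _ = (4 * κ + 3 * β * η) * m ^ 2 * ‖d₀‖ ^ 2 := by ring
      _ < _ := by gcongr
  have hF0 : 0 ≤ G q (w (q, r 0)) (w (q, r 0)) := by
    have h1 := (abs_lt.1 (hest 0 ⟨le_rfl, hK0⟩)).1
    have h2 := hpos d₀
    simp only [horth] at h2
    rw [hbd] at h1
    have h3 : min c₀ 1 * ‖d₀‖ ^ 2 ≤ c₀ * ‖d₀‖ ^ 2 := by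
      gcongr
      exact min_le_left _ _
    simp at h1 h2
    linarith
  have hFK : G q (w (q, r K)) (w (q, r K)) ≤ 0 := by
    have h1 := (abs_lt.1 (hest K ⟨hK0, le_rfl⟩)).2
    rw [hbd, show K ^ 2 * ‖d₀‖ ^ 2 * n = (β + 1) * ‖d₀‖ ^ 2 by rw [← hK2]; ring] at h1
    have h3 : min c₀ 1 * ‖d₀‖ ^ 2 ≤ 1 * ‖d₀‖ ^ 2 := by
      gcongr
      exact min_le_right _ _
    have h4 : b d₀ d₀ ≤ β * ‖d₀‖ * ‖d₀‖ := (le_abs_self _).trans (b.le_opNorm₂ d₀ d₀)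
    have h5 : (β + 1) * ‖d₀‖ ^ 2 = β * ‖d₀‖ * ‖d₀‖ + 1 * ‖d₀‖ ^ 2 := by ring
    linarith
  have hFc : ContinuousOn (fun τ => G q (w (q, r τ)) (w (q, r τ))) (Icc 0 K) := by
    have h1 : ContinuousOn (fun τ => w (q, r τ)) (Icc 0 K) :=
      hwc.comp (continuousOn_const.prodMk hrc) fun τ hτ => ⟨hqδ, hrδ τ hτ⟩
    exact ((G q).continuous.comp_continuousOn h1).clm_apply h1
  obtain ⟨τ, hτ, hFτ⟩ := intermediate_value_Icc' hK0 hFc ⟨hFK, hF0⟩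
  obtain ⟨c, v, hc0, hc1, hv0, hcs, hcg, hcv⟩ := hgeo q hqδ (r τ) (hrδ τ hτ)
  have hC2C : C₂ ≤ C := by rw [hC]; linarith [mul_pos (mul_pos two_pos hm0) hC₁0]
  refine ⟨t₀ + τ * ‖d₀‖, c, v, hc0, hc1, hcs, hcg, (htb τ hτ).trans (by gcongr), fun s hs => ?_⟩
  obtain ⟨⟨⟨hcN, hcO⟩, hcκ⟩, hvs⟩ := hcv s hs
  rw [← hdt τ] at hvs
  have hnull : G (c s) (v s) (v s) = 0 := by
    rw [hcg.metric_eq hO (hG.differentiableOn (by simp)) hinv (fun y hy => (hL y hy).symm)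
      (fun x hx => (hcv x hx).1.1.2) hs (t := 0) (by constructor <;> norm_num), hc0, hv0]
    exact hFτ
  have hdpos : 0 < ‖d τ‖ := norm_pos_iff.2 (hd0 τ)
  have hv1 : ‖v s‖ ≤ 2 * ‖d τ‖ := by
    calc ‖v s‖ = ‖(v s - d τ) + d τ‖ := by simp
      _ ≤ ‖v s - d τ‖ + ‖d τ‖ := norm_add_le _ _
      _ ≤ η * ‖d τ‖ + ‖d τ‖ := by gcongr
      _ ≤ 1 / 2 * ‖d τ‖ + ‖d τ‖ := by gcongr
      _ ≤ 2 * ‖d τ‖ := by linarith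
  have hv2 : ‖d τ‖ ≤ 2 * ‖v s‖ := by
    have : ‖d τ‖ ≤ ‖v s‖ + ‖v s - d τ‖ := by
      calc ‖d τ‖ = ‖v s - (v s - d τ)‖ := by simp
        _ ≤ _ := norm_sub_le _ _
    have h2 : η * ‖d τ‖ ≤ 1 / 2 * ‖d τ‖ := by gcongr
    linarith
  have hvpos : 0 < ‖v s‖ := by linarith
  refine ⟨hcN, ?_, hnull, ?_⟩
  · calc ‖v s‖ ≤ 2 * (m * ‖d₀‖) := hv1.trans (by gcongr; exact hdm τ hτ)
      _ ≤ 2 * (m * (C₁ * ‖z‖)) := by gcongr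
      _ = 2 * m * C₁ * ‖z‖ := by ring
      _ ≤ C * ‖z‖ := by gcongr; rw [hC]; linarith
  · -- the sign of the time component
    have h1 : b e (v s) ≤ β * ‖e‖ * η * (2 * ‖v s‖) := by
      have h2 : b e (d τ) ≤ 0 := by
        simp only [d, map_add, map_smul, smul_eq_mul, horth, zero_add]
        exact mul_nonpos_of_nonneg_of_nonpos (mul_nonneg hτ.1 hd₀pos.le) he.le
      have h3 : b e (v s - d τ) ≤ β * ‖e‖ * (η * ‖d τ‖) :=
        (le_abs_self _).trans (ContinuousLinearMap.le_of_opNorm₂_le_of_le b le_rfl le_rfl hvs)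
      have h4 : b e (v s) = b e (d τ) + b e (v s - d τ) := by simp
      have h5 : β * ‖e‖ * (η * ‖d τ‖) ≤ β * ‖e‖ * (η * (2 * ‖v s‖)) := by gcongr
      linarith
    have h2 : (σ * ‖v s‖) ^ 2 ≤ (b e (v s)) ^ 2 := by
      have h3 := hpos (v s)
      have h4 : b (v s) (v s) ≤ κ * ‖v s‖ * ‖v s‖ := by
        have h5 : -((G (c s) - b) (v s) (v s)) ≤ κ * ‖v s‖ * ‖v s‖ :=
          (neg_le_abs _).trans (ContinuousLinearMap.le_of_opNorm₂_le_of_le _ hcκ le_rfl le_rfl)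
        simp only [sub_apply, hnull] at h5
        linarith
      have h6 : c₀ / 2 * ‖v s‖ ^ 2 ≤ 2 / n * (b e (v s)) ^ 2 := by
        have h7 : κ * ‖v s‖ * ‖v s‖ ≤ c₀ / 2 * ‖v s‖ * ‖v s‖ := by gcongr
        have h8 : c₀ / 2 * ‖v s‖ * ‖v s‖ + c₀ / 2 * ‖v s‖ ^ 2 = c₀ * ‖v s‖ ^ 2 := by ring
        linarith
      rw [mul_pow, hσ2]
      calc c₀ * n / 4 * ‖v s‖ ^ 2 = n / 2 * (c₀ / 2 * ‖v s‖ ^ 2) := by ring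
        _ ≤ n / 2 * (2 / n * (b e (v s)) ^ 2) := by gcongr
        _ = (b e (v s)) ^ 2 := by field_simp
    have h3 : σ * ‖v s‖ ≤ |b e (v s)| := by
      have := Real.sqrt_le_sqrt h2
      rwa [Real.sqrt_sq (by positivity), Real.sqrt_sq_eq_abs] at this
    have h4 : b e (v s) ≤ -(σ * ‖v s‖) := by
      rcases le_abs'.1 h3 with h | h
      · exact h
      · exfalso
        have : σ * ‖v s‖ > 2 * β * ‖e‖ * η * ‖v s‖ := by gcongr
        have h9 : β * ‖e‖ * η * (2 * ‖v s‖) = 2 * β * ‖e‖ * η * ‖v s‖ := by ring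
        linarith
    have h5 : (G (c s) - b) e (v s) ≤ κ * ‖e‖ * ‖v s‖ :=
      (le_abs_self _).trans (ContinuousLinearMap.le_of_opNorm₂_le_of_le _ hcκ le_rfl le_rfl)
    simp only [sub_apply] at h5
    have h6 : ‖e‖ * κ * ‖v s‖ < σ * ‖v s‖ := by gcongr
    have h7 : κ * ‖e‖ * ‖v s‖ = ‖e‖ * κ * ‖v s‖ := by ring
    linarith

end Null

end

section

/-- The model space of a spacetime. -/
abbrev E4 := EuclideanSpace ℝ (Fin 4)

namespace Spacetime

variable {M : Type*} [TopologicalSpace M] [ChartedSpace (EuclideanSpace ℝ (Fin 4)) M]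

/-! ### Coordinate frames -/

section Frame

/-- The coordinate frame of the chart `φ`. -/
def frame (φ : OpenPartialHomeomorph M E4) (y : E4) : E4 →L[ℝ] TangentSpace (𝓡 4) (φ.symm y) :=
  mfderiv (𝓡 4) (𝓡 4) φ.symm y

/-- The coordinate coframe of the chart `φ`. -/
def coframe (φ : OpenPartialHomeomorph M E4) (x : M) : TangentSpace (𝓡 4) x →L[ℝ] E4 :=
  mfderiv (𝓡 4) (𝓡 4) φ x

variable {φ φ' : OpenPartialHomeomorph M E4}

theorem mdifferentiable_of_mem_maximalAtlas (hφ : φ ∈ IsManifold.maximalAtlas (𝓡 4) ∞ M) :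
    φ.MDifferentiable (𝓡 4) (𝓡 4) :=
  ⟨(contMDiffOn_of_mem_maximalAtlas hφ).mdifferentiableOn (by simp),
    (contMDiffOn_symm_of_mem_maximalAtlas hφ).mdifferentiableOn (by simp)⟩

theorem coframe_frame (hφ : φ ∈ IsManifold.maximalAtlas (𝓡 4) ∞ M) {y : E4}
    (hy : y ∈ φ.target) (u : E4) : coframe φ (φ.symm y) (frame φ y u) = u :=
  congrArg (fun L : E4 →L[ℝ] E4 => L u)
    ((mdifferentiable_of_mem_maximalAtlas hφ).comp_symm_deriv hy)

theorem frame_coframe (hφ : φ ∈ IsManifold.maximalAtlas (𝓡 4) ∞ M) {y : E4}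
    (hy : y ∈ φ.target) (v : TangentSpace (𝓡 4) (φ.symm y)) :
    frame φ y (coframe φ (φ.symm y) v) = v := by
  have h := (mdifferentiable_of_mem_maximalAtlas hφ).symm_comp_deriv (φ.map_target hy)
  have h2 : (mfderiv (𝓡 4) (𝓡 4) φ.symm (φ (φ.symm y)) : E4 →L[ℝ] E4)
      (coframe φ (φ.symm y) v) = v :=
    congrArg (fun L : E4 →L[ℝ] E4 => L v) h
  rw [φ.right_inv hy] at h2
  exact h2

/-- The derivative of a transition map in terms of the coordinate frames. -/
theorem hasFDerivAt_transition (hφ : φ ∈ IsManifold.maximalAtlas (𝓡 4) ∞ M)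
    (hφ' : φ' ∈ IsManifold.maximalAtlas (𝓡 4) ∞ M) {y : E4} (hy : y ∈ φ'.target)
    (hy' : φ'.symm y ∈ φ.source) :
    HasFDerivAt (fun z => φ (φ'.symm z)) ((coframe φ (φ'.symm y)).comp (frame φ' y)) y := by
  have h1 := ((mdifferentiable_of_mem_maximalAtlas hφ).mdifferentiableAt hy').hasMFDerivAt
  have h2 := ((mdifferentiable_of_mem_maximalAtlas hφ').symm.mdifferentiableAt hy).hasMFDerivAt
  exact (h1.comp y h2).hasFDerivAt

theorem contDiffAt_transition (hφ : φ ∈ IsManifold.maximalAtlas (𝓡 4) ∞ M)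
    (hφ' : φ' ∈ IsManifold.maximalAtlas (𝓡 4) ∞ M) {y : E4} (hy : y ∈ φ'.target)
    (hy' : φ'.symm y ∈ φ.source) :
    ContDiffAt ℝ ∞ (fun z => φ (φ'.symm z)) y := by
  rw [← contMDiffAt_iff_contDiffAt]
  exact (contMDiffAt_of_mem_maximalAtlas hφ hy').comp y (contMDiffAt_symm_of_mem_maximalAtlas hφ' hy)

end Frame

section Metric

variable [IsManifold (𝓡 4) ∞ M]
variable (S : Spacetime M) {φ φ' : OpenPartialHomeomorph M E4}

/-- The metric in the chart `φ` as a bilinear form on the model space. -/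
def metricCLM (φ : OpenPartialHomeomorph M E4) (y : E4) : E4 →L[ℝ] E4 →L[ℝ] ℝ :=
  ContinuousLinearMap.bilinearComp (E := E4) (F := E4) (S.g (φ.symm y)) (frame φ y) (frame φ y)

theorem metricInChart_eq (y u w : E4) : S.metricInChart φ y u w = S.metricCLM φ y u w := rfl

theorem metricCLM_apply (y u w : E4) :
    S.metricCLM φ y u w = S.g (φ.symm y) (frame φ y u) (frame φ y w) := rfl

theorem g_eq_metricCLM (hφ : φ ∈ IsManifold.maximalAtlas (𝓡 4) ∞ M) {x : M} (hx : x ∈ φ.source)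
    (v w : TangentSpace (𝓡 4) x) :
    S.g x v w = S.metricCLM φ (φ x) (coframe φ x v) (coframe φ x w) := by
  obtain ⟨y, hy, rfl⟩ : ∃ y ∈ φ.target, φ.symm y = x := ⟨φ x, φ.map_source hx, φ.left_inv hx⟩
  rw [φ.right_inv hy, metricCLM_apply, frame_coframe hφ hy, frame_coframe hφ hy]

theorem metricCLM_transition (hφ : φ ∈ IsManifold.maximalAtlas (𝓡 4) ∞ M)
    (hφ' : φ' ∈ IsManifold.maximalAtlas (𝓡 4) ∞ M) {y : E4} (hy : y ∈ φ'.target)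
    (hy' : φ'.symm y ∈ φ.source) (u v : E4) :
    S.metricCLM φ' y u v = S.metricCLM φ (φ (φ'.symm y))
      (fderiv ℝ (fun z => φ (φ'.symm z)) y u) (fderiv ℝ (fun z => φ (φ'.symm z)) y v) := by
  rw [metricCLM_apply, g_eq_metricCLM S hφ hy', (hasFDerivAt_transition hφ hφ' hy hy').fderiv]
  rfl

theorem contMDiffOn_frame (hφ : φ ∈ IsManifold.maximalAtlas (𝓡 4) ∞ M) (u : E4) :
    ContMDiffOn (𝓡 4) (𝓡 4).tangent ∞
      (fun y => (⟨φ.symm y, frame φ y u⟩ : TangentBundle (𝓡 4) M)) φ.target := by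
  have h1 := (contMDiffOn_symm_of_mem_maximalAtlas hφ).contMDiffOn_tangentMapWithin
    (m := ∞) (by simp) φ.open_target.uniqueMDiffOn
  have h2 : ContMDiffOn (𝓡 4) (𝓡 4).tangent ∞
      (fun y : E4 => (⟨y, u⟩ : TangentBundle (𝓡 4) E4)) φ.target :=
    contMDiffOn_vectorSpace_iff_contDiffOn.2 contDiffOn_const
  refine (h1.comp h2 (fun y hy => hy)).congr fun y hy => ?_
  simp only [Function.comp, tangentMapWithin]
  rw [mfderivWithin_of_isOpen φ.open_target hy]
  rfl

theorem contDiffOn_metricCLM (hφ : φ ∈ IsManifold.maximalAtlas (𝓡 4) ∞ M) :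
    ContDiffOn ℝ ∞ (S.metricCLM φ) φ.target := by
  refine contDiffOn_clm_apply.2 fun u => contDiffOn_clm_apply.2 fun w => ?_
  rw [← contMDiffOn_iff_contDiffOn]
  intro y hy
  have : ContMDiffWithinAt (𝓡 4) ((𝓡 4).prod 𝓘(ℝ)) ∞
      (fun m ↦ Bundle.TotalSpace.mk' ℝ (E := Bundle.Trivial M ℝ) (φ.symm m)
        (S.g (φ.symm m) (frame φ m u) (frame φ m w))) φ.target y := by
    apply ContMDiffWithinAt.clm_bundle_apply₂ (F₁ := E4) (F₂ := E4)
    · exact ContMDiffAt.comp_contMDiffWithinAt y S.smooth_g.contMDiffAt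
        (contMDiffOn_symm_of_mem_maximalAtlas hφ y hy)
    · exact contMDiffOn_frame hφ u y hy
    · exact contMDiffOn_frame hφ w y hy
  simp only [Bundle.contMDiffWithinAt_totalSpace] at this
  exact this.2

theorem metricCLM_symm (y u w : E4) : S.metricCLM φ y u w = S.metricCLM φ y w u := S.symm _ _ _

theorem isLorentzForm_metricCLM (hφ : φ ∈ IsManifold.maximalAtlas (𝓡 4) ∞ M) {y : E4}
    (hy : y ∈ φ.target) : IsLorentzForm (S.metricCLM φ y) := by
  refine ⟨S.metricCLM_symm y, ?_⟩
  obtain ⟨v, hv, hw⟩ := S.lorentzian (φ.symm y)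
  refine ⟨coframe φ _ v, ?_, fun w hw0 hvw => ?_⟩
  · rw [metricCLM_apply, frame_coframe hφ hy]; exact hv
  · rw [metricCLM_apply, frame_coframe hφ hy] at hvw
    refine hw _ (fun h => hw0 ?_) hvw
    rw [← coframe_frame hφ hy w]
    exact (congrArg (coframe φ (φ.symm y)) h).trans (map_zero _)

omit [IsManifold (𝓡 4) ∞ M] in
theorem fieldInChart_eq (V : (x : M) → TangentSpace (𝓡 4) x) (y : E4) :
    fieldInChart V φ y = coframe φ (φ.symm y) (V (φ.symm y)) := rfl

omit [IsManifold (𝓡 4) ∞ M] in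
theorem frame_fieldInChart (hφ : φ ∈ IsManifold.maximalAtlas (𝓡 4) ∞ M) {y : E4}
    (hy : y ∈ φ.target) (V : (x : M) → TangentSpace (𝓡 4) x) :
    frame φ y (fieldInChart V φ y) = V (φ.symm y) :=
  frame_coframe hφ hy _

theorem contDiffOn_fieldInChart (hφ : φ ∈ IsManifold.maximalAtlas (𝓡 4) ∞ M)
    {V : (x : M) → TangentSpace (𝓡 4) x}
    (hV : ContMDiff (𝓡 4) (𝓡 4).tangent ∞ (fun x ↦ (⟨x, V x⟩ : TangentBundle (𝓡 4) M))) :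
    ContDiffOn ℝ ∞ (fieldInChart V φ) φ.target := by
  have h1 := (contMDiffOn_of_mem_maximalAtlas hφ).contMDiffOn_tangentMapWithin
    (m := ∞) (by simp) φ.open_source.uniqueMDiffOn
  have h2 : ContMDiffOn (𝓡 4) (𝓡 4).tangent ∞
      (fun y : E4 => (⟨φ.symm y, V (φ.symm y)⟩ : TangentBundle (𝓡 4) M)) φ.target :=
    hV.comp_contMDiffOn (contMDiffOn_symm_of_mem_maximalAtlas hφ)
  have h3 : ContMDiffOn (𝓡 4) (𝓡 4).tangent ∞
      (fun y : E4 => (⟨y, fieldInChart V φ y⟩ : TangentBundle (𝓡 4) E4)) φ.target := by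
    refine (h1.comp h2 (fun y hy => φ.map_target hy)).congr fun y hy => ?_
    simp only [Function.comp, tangentMapWithin]
    rw [mfderivWithin_of_isOpen φ.open_source (φ.map_target hy), φ.right_inv hy]
    rfl
  exact contMDiffOn_vectorSpace_iff_contDiffOn.1 h3

omit [IsManifold (𝓡 4) ∞ M] in
theorem fieldInChart_transition (hφ : φ ∈ IsManifold.maximalAtlas (𝓡 4) ∞ M)
    (hφ' : φ' ∈ IsManifold.maximalAtlas (𝓡 4) ∞ M) {y : E4} (hy : y ∈ φ'.target)
    (hy' : φ'.symm y ∈ φ.source) (V : (x : M) → TangentSpace (𝓡 4) x) :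
    fieldInChart V φ (φ (φ'.symm y)) =
      fderiv ℝ (fun z => φ (φ'.symm z)) y (fieldInChart V φ' y) := by
  rw [(hasFDerivAt_transition hφ hφ' hy hy').fderiv, fieldInChart_eq, φ.left_inv hy',
    ContinuousLinearMap.comp_apply, frame_fieldInChart hφ' hy]

theorem christoffel_eq (hφ : φ ∈ IsManifold.maximalAtlas (𝓡 4) ∞ M) {y : E4}
    (hy : y ∈ φ.target) (u v w : E4) :
    S.christoffel φ y u v w = chrForm (S.metricCLM φ) y u v w := by
  have hd : HasFDerivAt (S.metricCLM φ) (fderiv ℝ (S.metricCLM φ) y) y :=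
    (((S.contDiffOn_metricCLM hφ).contDiffAt (φ.open_target.mem_nhds hy)).differentiableAt
      (by simp)).hasFDerivAt
  have key : ∀ a b c : E4, fderiv ℝ (fun z => S.metricInChart φ z a b) y c =
      fderiv ℝ (S.metricCLM φ) y c a b := fun a b c => by
    have h := (hd.clm_apply (hasFDerivAt_const a y)).clm_apply (hasFDerivAt_const b y)
    have e : (fun z => S.metricInChart φ z a b) = fun z => S.metricCLM φ z a b := rfl
    rw [e, h.fderiv]
    simp
  simp only [christoffel, key, chrForm_apply]

theorem covDeriv_eq (hφ : φ ∈ IsManifold.maximalAtlas (𝓡 4) ∞ M) {y : E4}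
    (hy : y ∈ φ.target) (V : (x : M) → TangentSpace (𝓡 4) x) (u w : E4) :
    S.covDeriv V φ y u w = S.metricCLM φ y (fderiv ℝ (fieldInChart V φ) y u) w
      + chrForm (S.metricCLM φ) y u (fieldInChart V φ y) w := by
  rw [covDeriv, S.christoffel_eq hφ hy, metricInChart_eq]

end Metric

end Spacetime

end

section

theorem ContDiffAt.hasDerivAt_deriv {E : Type*} [NormedAddCommGroup E] [NormedSpace ℝ E]
    {x : ℝ → E} {s : ℝ} (h : ContDiffAt ℝ ∞ x s) :
    HasDerivAt (deriv x) (deriv (deriv x) s) s := by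
  have h1 : DifferentiableAt ℝ (fderiv ℝ x) s :=
    (h.fderiv_right (m := 1) (by norm_cast)).differentiableAt (by simp)
  have h2 : DifferentiableAt ℝ (deriv x) s := h1.clm_apply (differentiableAt_const (1 : ℝ))
  exact h2.hasDerivAt

/-- A future-pointing null geodesic of the metric `G` in `O`, parametrized by a neighbourhood of
`[0,1]`, where `e` points to the future. -/
structure IsNullRay {E : Type*} [NormedAddCommGroup E] [NormedSpace ℝ E]
    (G : E → E →L[ℝ] E →L[ℝ] ℝ) (e : E) (O : Set E) (J : Set ℝ) (x v : ℝ → E) : Prop where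
  isOpen : IsOpen J
  subset : Icc 0 1 ⊆ J
  mapsTo : MapsTo x J O
  contDiffOn : ContDiffOn ℝ ∞ x J
  geodesic : IsGeodesicCurve (connection G) J x v
  null : ∀ s ∈ J, G (x s) (v s) (v s) = 0
  future : ∀ s ∈ J, G (x s) e (v s) < 0

namespace Spacetime

variable {M : Type*} [TopologicalSpace M] [ChartedSpace (EuclideanSpace ℝ (Fin 4)) M]
  [IsManifold (𝓡 4) ∞ M]
variable (S : Spacetime M) {φ φ' : OpenPartialHomeomorph M E4}

/-! ### Change of charts -/

omit [ChartedSpace (EuclideanSpace ℝ (Fin 4)) M] [IsManifold (𝓡 4) ∞ M] in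
theorem eventually_transition {y : E4}
    (hy : y ∈ φ'.target) (hy' : φ'.symm y ∈ φ.source) :
    ∀ᶠ z in 𝓝 y, z ∈ φ'.target ∧ φ'.symm z ∈ φ.source :=
  (φ'.open_target.eventually_mem hy).and
    ((φ'.symm.continuousAt hy).preimage_mem_nhds (φ.open_source.mem_nhds hy'))

theorem chrForm_transition (hφ : φ ∈ IsManifold.maximalAtlas (𝓡 4) ∞ M)
    (hφ' : φ' ∈ IsManifold.maximalAtlas (𝓡 4) ∞ M) {y : E4} (hy : y ∈ φ'.target)
    (hy' : φ'.symm y ∈ φ.source) {ψ : E4 → E4} (hψ : ψ = fun z => φ (φ'.symm z)) (u v w : E4) :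
    chrForm (S.metricCLM φ') y u v w =
      chrForm (S.metricCLM φ) (ψ y) (fderiv ℝ ψ y u) (fderiv ℝ ψ y v) (fderiv ℝ ψ y w)
      + S.metricCLM φ (ψ y) (fderiv ℝ (fderiv ℝ ψ) y u v) (fderiv ℝ ψ y w) := by
  subst hψ
  refine chrForm_pullback ((contDiffAt_transition hφ hφ' hy hy').of_le (by norm_cast))
    (((S.contDiffOn_metricCLM hφ).contDiffAt
      (φ.open_target.mem_nhds (φ.map_source hy'))).differentiableAt (by simp))
    (((S.contDiffOn_metricCLM hφ').contDiffAt
      (φ'.open_target.mem_nhds hy)).differentiableAt (by simp)) (S.metricCLM_symm _) ?_ u v w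
  filter_upwards [eventually_transition hy hy'] with z hz u v
  exact S.metricCLM_transition hφ hφ' hz.1 hz.2 u v

theorem covDeriv_transition (hφ : φ ∈ IsManifold.maximalAtlas (𝓡 4) ∞ M)
    (hφ' : φ' ∈ IsManifold.maximalAtlas (𝓡 4) ∞ M) {y : E4} (hy : y ∈ φ'.target)
    (hy' : φ'.symm y ∈ φ.source) {ψ : E4 → E4} (hψ : ψ = fun z => φ (φ'.symm z))
    {V : (x : M) → TangentSpace (𝓡 4) x}
    (hV : ContMDiff (𝓡 4) (𝓡 4).tangent ∞ (fun x ↦ (⟨x, V x⟩ : TangentBundle (𝓡 4) M)))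
    (u w : E4) :
    S.covDeriv V φ' y u w = S.covDeriv V φ (ψ y) (fderiv ℝ ψ y u) (fderiv ℝ ψ y w) := by
  have hψy : ψ y = φ (φ'.symm y) := by rw [hψ]
  have hψt : ψ y ∈ φ.target := by rw [hψy]; exact φ.map_source hy'
  have hc : ContDiffAt ℝ ∞ ψ y := by rw [hψ]; exact contDiffAt_transition hφ hφ' hy hy'
  have h1 : HasFDerivAt ψ (fderiv ℝ ψ y) y := (hc.differentiableAt (by simp)).hasFDerivAt
  have h2 : HasFDerivAt (fderiv ℝ ψ) (fderiv ℝ (fderiv ℝ ψ) y) y :=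
    ((hc.fderiv_right (m := 1) (by norm_cast)).differentiableAt (by simp)).hasFDerivAt
  have hX : HasFDerivAt (fieldInChart V φ) (fderiv ℝ (fieldInChart V φ) (ψ y)) (ψ y) :=
    (((contDiffOn_fieldInChart hφ hV).contDiffAt
      (φ.open_target.mem_nhds hψt)).differentiableAt (by simp)).hasFDerivAt
  have hX' : HasFDerivAt (fieldInChart V φ') (fderiv ℝ (fieldInChart V φ') y) y :=
    (((contDiffOn_fieldInChart hφ' hV).contDiffAt
      (φ'.open_target.mem_nhds hy)).differentiableAt (by simp)).hasFDerivAt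
  have hev : (fun z => fieldInChart V φ (ψ z)) =ᶠ[𝓝 y]
      fun z => fderiv ℝ ψ z (fieldInChart V φ' z) := by
    filter_upwards [eventually_transition hy hy'] with z hz
    rw [hψ]; exact fieldInChart_transition hφ hφ' hz.1 hz.2 V
  have key := ((hX.comp y h1).unique ((h2.clm_apply hX').congr_of_eventuallyEq hev))
  have key' := congrArg (fun L => L u) key
  simp only [ContinuousLinearMap.comp_apply, add_apply, ContinuousLinearMap.flip_apply] at key'
  rw [S.covDeriv_eq hφ' hy, S.covDeriv_eq hφ hψt, key', S.chrForm_transition hφ hφ' hy hy' hψ,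
    show S.metricCLM φ' y (fderiv ℝ (fieldInChart V φ') y u) w = S.metricCLM φ (ψ y)
      (fderiv ℝ ψ y (fderiv ℝ (fieldInChart V φ') y u)) (fderiv ℝ ψ y w) by
      rw [hψ]; exact S.metricCLM_transition hφ hφ' hy hy' _ _,
    hev.eq_of_nhds, map_add, add_apply]
  ring

set_option maxHeartbeats 1000000 in
/-- The geodesic equation is independent of the chart. -/
theorem geodesic_equation_transition (hφ : φ ∈ IsManifold.maximalAtlas (𝓡 4) ∞ M)
    (hφ' : φ' ∈ IsManifold.maximalAtlas (𝓡 4) ∞ M) {c : ℝ → M} {s : ℝ}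
    (hc : ContMDiffAt 𝓘(ℝ, ℝ) (𝓡 4) ∞ c s) (hs : c s ∈ φ.source) (hs' : c s ∈ φ'.source)
    {ψ : E4 → E4} (hψ : ψ = fun z => φ (φ'.symm z)) (w : E4) :
    S.metricCLM φ' (φ' (c s)) (deriv (deriv (fun r ↦ φ' (c r))) s) w
      + chrForm (S.metricCLM φ') (φ' (c s)) (deriv (fun r ↦ φ' (c r)) s)
        (deriv (fun r ↦ φ' (c r)) s) w =
    S.metricCLM φ (φ (c s)) (deriv (deriv (fun r ↦ φ (c r))) s) (fderiv ℝ ψ (φ' (c s)) w)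
      + chrForm (S.metricCLM φ) (φ (c s)) (deriv (fun r ↦ φ (c r)) s)
        (deriv (fun r ↦ φ (c r)) s) (fderiv ℝ ψ (φ' (c s)) w) := by
  have hy := φ'.map_source hs'
  have hy' : φ'.symm (φ' (c s)) ∈ φ.source := by rwa [φ'.left_inv hs']
  have hx : ContDiffAt ℝ ∞ (fun r => φ' (c r)) s := by
    rw [← contMDiffAt_iff_contDiffAt]
    exact (contMDiffAt_of_mem_maximalAtlas hφ' hs').comp s hc
  have hcψ : ContDiffAt ℝ ∞ ψ (φ' (c s)) := by
    rw [hψ]; exact contDiffAt_transition hφ hφ' hy hy'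
  have hev : (fun r => φ (c r)) =ᶠ[𝓝 s] fun r => ψ (φ' (c r)) := by
    filter_upwards [hc.continuousAt.preimage_mem_nhds (φ'.open_source.mem_nhds hs')] with r hr
    rw [hψ]
    simp only [φ'.left_inv hr]
  have hψ1 : ∀ᶠ z in 𝓝 (φ' (c s)), DifferentiableAt ℝ ψ z := by
    filter_upwards [eventually_transition hy hy'] with z hz
    rw [hψ]; exact (contDiffAt_transition hφ hφ' hz.1 hz.2).differentiableAt (by simp)
  have hx1 : ∀ᶠ r in 𝓝 s, DifferentiableAt ℝ (fun r => φ' (c r)) r := by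
    filter_upwards [(hx.of_le (m := 1) (by norm_cast)).eventually (by simp)] with r hr
    exact hr.differentiableAt (by simp)
  have hd1 : deriv (fun r => φ (c r)) =ᶠ[𝓝 s]
      fun r => fderiv ℝ ψ (φ' (c r)) (deriv (fun r => φ' (c r)) r) := by
    filter_upwards [hev.eventually_nhds, hx1, hx.continuousAt.eventually hψ1] with r h1 h2 h3
    rw [EventuallyEq.deriv_eq h1]
    exact (h3.hasFDerivAt.comp_hasDerivAt r h2.hasDerivAt).deriv
  have h2 : HasFDerivAt (fderiv ℝ ψ) (fderiv ℝ (fderiv ℝ ψ) (φ' (c s))) (φ' (c s)) :=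
    ((hcψ.fderiv_right (m := 1) (by norm_cast)).differentiableAt
      (by simp)).hasFDerivAt
  have hx2 : HasDerivAt (deriv (fun r => φ' (c r))) (deriv (deriv (fun r => φ' (c r))) s) s :=
    hx.hasDerivAt_deriv
  have hd2 : HasDerivAt (fun r => fderiv ℝ ψ (φ' (c r)) (deriv (fun r => φ' (c r)) r)) _ s :=
    (h2.comp_hasDerivAt s hx1.self_of_nhds.hasDerivAt).clm_apply hx2
  rw [hd1.deriv_eq, hd2.deriv, hd1.eq_of_nhds, S.chrForm_transition hφ hφ' hy hy' hψ,
    show S.metricCLM φ' (φ' (c s)) (deriv (deriv (fun r ↦ φ' (c r))) s) w = S.metricCLM φ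
      (ψ (φ' (c s))) (fderiv ℝ ψ (φ' (c s)) (deriv (deriv (fun r ↦ φ' (c r))) s))
      (fderiv ℝ ψ (φ' (c s)) w) by
      rw [hψ]; exact S.metricCLM_transition hφ hφ' hy hy' _ _,
    hev.eq_of_nhds, map_add, add_apply]
  ring

/-! ### Curves in charts -/

omit [IsManifold (𝓡 4) ∞ M] in
theorem hasDerivAt_chart_comp (hφ : φ ∈ IsManifold.maximalAtlas (𝓡 4) ∞ M) {c : ℝ → M} {s : ℝ}
    (hc : ContMDiffAt 𝓘(ℝ, ℝ) (𝓡 4) ∞ c s) (hs : c s ∈ φ.source) :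
    HasDerivAt (fun r => φ (c r)) (coframe φ (c s) (velocity c s)) s := by
  have h1 := ((mdifferentiable_of_mem_maximalAtlas hφ).mdifferentiableAt hs).hasMFDerivAt
  have h2 := (hc.mdifferentiableAt (by simp)).hasMFDerivAt
  have h3 : HasFDerivAt (fun r => φ (c r))
      ((coframe φ (c s)).comp (mfderiv 𝓘(ℝ, ℝ) (𝓡 4) c s) : ℝ →L[ℝ] E4) s :=
    (h1.comp s h2).hasFDerivAt
  exact h3.hasDerivAt

omit [IsManifold (𝓡 4) ∞ M] in
theorem contDiffAt_chart_comp (hφ : φ ∈ IsManifold.maximalAtlas (𝓡 4) ∞ M) {c : ℝ → M} {s : ℝ}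
    (hc : ContMDiffAt 𝓘(ℝ, ℝ) (𝓡 4) ∞ c s) (hs : c s ∈ φ.source) :
    ContDiffAt ℝ ∞ (fun r => φ (c r)) s := by
  rw [← contMDiffAt_iff_contDiffAt]
  exact (contMDiffAt_of_mem_maximalAtlas hφ hs).comp s hc

omit [IsManifold (𝓡 4) ∞ M] in
theorem contMDiffOn_chart_symm_comp (hφ : φ ∈ IsManifold.maximalAtlas (𝓡 4) ∞ M) {x : ℝ → E4}
    {J : Set ℝ} (hx : ContDiffOn ℝ ∞ x J) (hm : MapsTo x J φ.target) :
    ContMDiffOn 𝓘(ℝ, ℝ) (𝓡 4) ∞ (fun s => φ.symm (x s)) J :=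
  (contMDiffOn_symm_of_mem_maximalAtlas hφ).comp (contMDiffOn_iff_contDiffOn.2 hx) hm

theorem future_null_iff {V : (x : M) → TangentSpace (𝓡 4) x} (hV : S.IsObserverField V)
    (hφ : φ ∈ IsManifold.maximalAtlas (𝓡 4) ∞ M) {x : M} (hx : x ∈ φ.source)
    {n : TangentSpace (𝓡 4) x} (hn : S.g x n n = 0) :
    S.FuturePointing x n ↔
      S.metricCLM φ (φ x) (fieldInChart V φ (φ x)) (coframe φ x n) < 0 := by
  have hL := S.isLorentzForm_metricCLM hφ (φ.map_source hx)
  have e1 : fieldInChart V φ (φ x) = coframe φ x (V x) := by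
    rw [fieldInChart_eq, φ.left_inv hx]
  have hT := S.timeField_timelike x
  have hVV := hV.timelike x
  have hTV : S.g x (S.timeField x) (V x) < 0 := hV.future x
  rw [e1, FuturePointing]
  simp only [S.g_eq_metricCLM hφ hx] at hn hT hVV hTV ⊢
  have h0 : ∀ m : E4, S.metricCLM φ (φ x) m (coframe φ x n) < 0 → coframe φ x n ≠ 0 := by
    intro m hm h
    rw [h, map_zero] at hm
    exact lt_irrefl _ hm
  constructor
  · exact fun h => hL.null_neg_of_neg hT hVV hTV (h0 _ h) hn h
  · exact fun h => hL.null_neg_of_neg hVV hT (by rwa [S.metricCLM_symm]) (h0 _ h) hn h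

theorem isInvertible_metricCLM (hφ : φ ∈ IsManifold.maximalAtlas (𝓡 4) ∞ M) {y : E4}
    (hy : y ∈ φ.target) : (S.metricCLM φ y).IsInvertible :=
  (S.isLorentzForm_metricCLM hφ hy).isInvertible

/-- A light ray that stays in the domain of a chart is a null geodesic of the metric in the
chart. -/
theorem IsLightRay.isNullRay {S : Spacetime M} {V : (x : M) → TangentSpace (𝓡 4) x}
    (hV : S.IsObserverField V)
    (hφ : φ ∈ IsManifold.maximalAtlas (𝓡 4) ∞ M) {e : E4}
    (he : ∀ y ∈ φ.target, fieldInChart V φ y = e) {W : Set M} (hW : W ⊆ φ.source) {p q : M}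
    {c : ℝ → M} (h : S.IsLightRay W p q c) :
    ∃ J, IsNullRay (S.metricCLM φ) e φ.target J (fun s => φ (c s))
      (deriv fun s => φ (c s)) := by
  obtain ⟨-, -, hm, J, hJ, hJs, ⟨hc, hg⟩, hn⟩ := h
  have hcont : ContinuousOn c J := hc.continuousOn
  have hat : ∀ s ∈ J, ContMDiffAt 𝓘(ℝ, ℝ) (𝓡 4) ∞ c s := fun s hs =>
    hc.contMDiffAt (hJ.mem_nhds hs)
  refine ⟨J ∩ c ⁻¹' φ.source, hcont.isOpen_inter_preimage hJ φ.open_source,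
    fun s hs => ⟨hJs hs, hW (hm hs)⟩, fun s hs => φ.map_source hs.2,
    fun s hs => (contDiffAt_chart_comp hφ (hat s hs.1) hs.2).contDiffWithinAt, ⟨?_, ?_⟩, ?_, ?_⟩
  · rintro s ⟨hs, hs'⟩
    exact (contDiffAt_chart_comp hφ (hat s hs) hs').differentiableAt (by simp) |>.hasDerivAt
  · rintro s ⟨hs, hs'⟩
    have h1 := (contDiffAt_chart_comp hφ (hat s hs) hs').hasDerivAt_deriv
    have hy := φ.map_source hs'
    convert h1 using 1
    refine ((eq_neg_connection_iff (S.isInvertible_metricCLM hφ hy) _ _ _).2 fun w => ?_).symm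
    have := hg φ hφ s hs hs' w
    rwa [S.christoffel_eq hφ hy, metricInChart_eq] at this
  · rintro s ⟨hs, hs'⟩
    rw [(hasDerivAt_chart_comp hφ (hat s hs) hs').deriv, ← S.g_eq_metricCLM hφ hs']
    exact (hn s hs).1
  · rintro s ⟨hs, hs'⟩
    rw [(hasDerivAt_chart_comp hφ (hat s hs) hs').deriv, ← he _ (φ.map_source hs')]
    exact (S.future_null_iff hV hφ hs' (hn s hs).1).1 (hn s hs).2

/-- A null geodesic of the metric in a chart gives a light ray. -/
theorem _root_.IsNullRay.isLightRay {S : Spacetime M} {V : (x : M) → TangentSpace (𝓡 4) x}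
    (hV : S.IsObserverField V)
    (hφ : φ ∈ IsManifold.maximalAtlas (𝓡 4) ∞ M) {e : E4}
    (he : ∀ y ∈ φ.target, fieldInChart V φ y = e) {W : Set M} {J : Set ℝ} {x v : ℝ → E4}
    (h : IsNullRay (S.metricCLM φ) e φ.target J x v)
    (hW : ∀ s ∈ Icc (0 : ℝ) 1, φ.symm (x s) ∈ W) :
    S.IsLightRay W (φ.symm (x 0)) (φ.symm (x 1)) (fun s => φ.symm (x s)) := by
  have hc := contMDiffOn_chart_symm_comp hφ h.contDiffOn h.mapsTo
  have hat : ∀ s ∈ J, ContMDiffAt 𝓘(ℝ, ℝ) (𝓡 4) ∞ (fun s => φ.symm (x s)) s := fun s hs =>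
    hc.contMDiffAt (h.isOpen.mem_nhds hs)
  have hsrc : ∀ s ∈ J, φ.symm (x s) ∈ φ.source := fun s hs => φ.map_target (h.mapsTo hs)
  have hev : ∀ s ∈ J, (fun r => φ (φ.symm (x r))) =ᶠ[𝓝 s] x := fun s hs => by
    filter_upwards [h.isOpen.mem_nhds hs] with r hr
    exact φ.right_inv (h.mapsTo hr)
  have hd : ∀ s ∈ J, deriv (fun r => φ (φ.symm (x r))) =ᶠ[𝓝 s] v := fun s hs => by
    filter_upwards [h.isOpen.mem_nhds hs] with r hr
    rw [(hev r hr).deriv_eq, (h.geodesic.hasDerivAt r hr).deriv]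
  have hvel : ∀ s ∈ J, coframe φ (φ.symm (x s)) (velocity (fun s => φ.symm (x s)) s) = v s :=
    fun s hs => by
      rw [← (hasDerivAt_chart_comp hφ (hat s hs) (hsrc s hs)).deriv, (hd s hs).eq_of_nhds]
  have hnull : ∀ s ∈ J, S.g (φ.symm (x s)) (velocity (fun s => φ.symm (x s)) s)
      (velocity (fun s => φ.symm (x s)) s) = 0 := fun s hs => by
    rw [S.g_eq_metricCLM hφ (hsrc s hs), hvel s hs, φ.right_inv (h.mapsTo hs)]
    exact h.null s hs
  refine ⟨rfl, rfl, hW, J, h.isOpen, h.subset, ⟨hc, ?_⟩, fun s hs => ⟨hnull s hs, ?_⟩⟩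
  · intro φ' hφ' s hs hs' w
    rw [S.christoffel_eq hφ' (φ'.map_source hs'), metricInChart_eq,
      S.geodesic_equation_transition hφ hφ' (hat s hs) (hsrc s hs) hs' rfl, (hd s hs).deriv_eq,
      (hd s hs).eq_of_nhds, φ.right_inv (h.mapsTo hs), (h.geodesic.hasDerivAt_velocity s hs).deriv]
    exact (eq_neg_connection_iff (S.isInvertible_metricCLM hφ (h.mapsTo hs)) _ _ _).1 rfl _
  · refine (S.future_null_iff hV hφ (hsrc s hs) (hnull s hs)).2 ?_
    rw [hvel s hs, φ.right_inv (h.mapsTo hs), he _ (h.mapsTo hs)]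
    exact h.future s hs

/-! ### Integral curves in charts -/

omit [IsManifold (𝓡 4) ∞ M] in
theorem hasDerivAt_chart_integralCurve (hφ : φ ∈ IsManifold.maximalAtlas (𝓡 4) ∞ M)
    {V : (x : M) → TangentSpace (𝓡 4) x} {γ : ℝ → M} {I : Set ℝ} (hI : IsOpen I)
    (hγ : IsMIntegralCurveOn (I := 𝓡 4) γ V I) {t : ℝ} (ht : t ∈ I) (hs : γ t ∈ φ.source) :
    HasDerivAt (fun r => φ (γ r)) (fieldInChart V φ (φ (γ t))) t := by
  have h1 := ((mdifferentiable_of_mem_maximalAtlas hφ).mdifferentiableAt hs).hasMFDerivAt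
  have h2 := (hγ t ht).hasMFDerivAt (hI.mem_nhds ht)
  have h3 : HasFDerivAt (fun r => φ (γ r)) ((coframe φ (γ t)).comp
      ((1 : ℝ →L[ℝ] ℝ).smulRight (V (γ t))) : ℝ →L[ℝ] E4) t := (h1.comp t h2).hasFDerivAt
  have h4 := h3.hasDerivAt
  rw [fieldInChart_eq, φ.left_inv hs]
  have h5 : ((coframe φ (γ t)).comp ((1 : ℝ →L[ℝ] ℝ).smulRight (V (γ t)))) 1 =
      coframe φ (γ t) (V (γ t)) := congrArg (coframe φ (γ t)) (one_smul ℝ (V (γ t)))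
  rwa [h5] at h4

omit [IsManifold (𝓡 4) ∞ M] in
theorem isMIntegralCurveOn_chart_symm (hφ : φ ∈ IsManifold.maximalAtlas (𝓡 4) ∞ M)
    {V : (x : M) → TangentSpace (𝓡 4) x} {x : ℝ → E4} {I : Set ℝ} (hm : MapsTo x I φ.target)
    (hx : ∀ t ∈ I, HasDerivAt x (fieldInChart V φ (x t)) t) :
    IsMIntegralCurveOn (I := 𝓡 4) (fun t => φ.symm (x t)) V I := by
  intro t ht
  have h1 :=
    ((mdifferentiable_of_mem_maximalAtlas hφ).symm.mdifferentiableAt (hm ht)).hasMFDerivAt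
  have h2 := (hx t ht).hasFDerivAt.hasMFDerivAt
  have h3 := (h1.comp t h2).hasMFDerivWithinAt (s := I)
  have h4 : (frame φ (x t)).comp (ContinuousLinearMap.toSpanSingleton ℝ (fieldInChart V φ (x t))) =
      (1 : ℝ →L[ℝ] ℝ).smulRight (V (φ.symm (x t))) := by
    rw [← frame_fieldInChart hφ (hm ht) V]
    ext
    simp
  exact h4 ▸ h3

omit [IsManifold (𝓡 4) ∞ M] in
/-- The clocks in a chart in which the observer field is constant are straight lines. -/
theorem IsClockIn.chart_eq (hφ : φ ∈ IsManifold.maximalAtlas (𝓡 4) ∞ M)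
    {V : (x : M) → TangentSpace (𝓡 4) x} {e : E4}
    (he : ∀ y ∈ φ.target, fieldInChart V φ y = e) {γ : ℝ → M} {I : Set ℝ}
    (hγ : IsClockIn V γ I) (hm : MapsTo γ I φ.source) {t t' : ℝ} (ht : t ∈ I) (ht' : t' ∈ I) :
    φ (γ t') = φ (γ t) + (t' - t) • e := by
  have hd : ∀ r ∈ I, HasDerivAt (fun r => φ (γ r) - r • e) 0 r := fun r hr => by
    have h1 := hasDerivAt_chart_integralCurve hφ hγ.isOpen hγ.integralCurve hr (hm hr)
    rw [he _ (φ.map_source (hm hr))] at h1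
    have h2 := h1.sub ((hasDerivAt_id r).smul_const e)
    rw [one_smul, sub_self] at h2
    exact h2
  have hconv : Convex ℝ I := hγ.ordConnected.convex
  have := hconv.is_const_of_fderivWithin_eq_zero (𝕜 := ℝ) (f := fun r => φ (γ r) - r • e)
    (fun r hr => (hd r hr).differentiableAt.differentiableWithinAt)
    (fun r hr => by
      rw [fderivWithin_of_isOpen hγ.isOpen hr, (hd r hr).hasFDerivAt.fderiv]; simp) ht ht'
  rw [sub_smul]
  rw [sub_eq_sub_iff_add_eq_add] at this
  rw [add_sub, this]
  abel

omit [IsManifold (𝓡 4) ∞ M] in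
/-- The straight lines in a chart in which the observer field is constant are clocks. -/
theorem isClockIn_line (hφ : φ ∈ IsManifold.maximalAtlas (𝓡 4) ∞ M)
    {V : (x : M) → TangentSpace (𝓡 4) x}
    (he : ∀ y ∈ φ.target, fieldInChart V φ y = EuclideanSpace.single 0 1) {y : E4} {I : Set ℝ}
    (hI : IsOpen I) (hI' : I.OrdConnected)
    (hm : ∀ t ∈ I, y + t • EuclideanSpace.single 0 1 ∈ φ.target) :
    IsClockIn V (fun t => φ.symm (y + t • EuclideanSpace.single 0 1)) I := by
  refine ⟨hI, hI', isMIntegralCurveOn_chart_symm hφ (fun t ht => hm t ht) fun t ht => ?_, ?_⟩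
  · rw [he _ (hm t ht)]
    simpa using ((hasDerivAt_id t).smul_const (EuclideanSpace.single (0 : Fin 4) (1 : ℝ))).const_add y
  · have h1 : IsEmbedding (fun t : ℝ => y + t • (EuclideanSpace.single 0 1 : E4)) := by
      refine Function.LeftInverse.isEmbedding (f := fun z : E4 => z 0 - y 0) (fun t => ?_)
        (by fun_prop) (by fun_prop)
      simp
    have h2 : IsEmbedding (fun t : I => (⟨y + (t : ℝ) • EuclideanSpace.single 0 1, hm t t.2⟩ :
        φ.symm.source)) := by
      refine IsEmbedding.of_comp (by fun_prop) continuous_subtype_val ?_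
      exact h1.comp IsEmbedding.subtypeVal
    exact φ.symm.isOpenEmbedding_restrict.isEmbedding.comp h2

end Spacetime

end

section

/-- The time direction of the model space. -/
def e0 : E4 := EuclideanSpace.single 0 1

@[simp] theorem e0_zero : e0 0 = 1 := by simp [e0]

theorem e0_ne_zero : e0 ≠ 0 := fun h => by
  have := congrArg (fun z : E4 => z 0) h
  simp at this

/-- The projection onto the slice of vanishing time coordinate. -/
def spaceProj : E4 →L[ℝ] E4 :=
  ContinuousLinearMap.id ℝ E4 - (EuclideanSpace.proj (0 : Fin 4) : E4 →L[ℝ] ℝ).smulRight e0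

theorem spaceProj_apply (z : E4) : spaceProj z = z - z 0 • e0 := by
  simp [spaceProj]

@[simp] theorem spaceProj_e0 : spaceProj e0 = 0 := by simp [spaceProj_apply]

@[simp] theorem spaceProj_time (z : E4) : spaceProj z 0 = 0 := by simp [spaceProj_apply]

theorem spaceProj_add (z : E4) : spaceProj z + z 0 • e0 = z := by simp [spaceProj_apply]

@[simp] theorem spaceProj_add_smul (z : E4) (t : ℝ) : spaceProj (z + t • e0) = spaceProj z := by
  simp

/-- Straightening of a nowhere vanishing vector field in a vector space. -/
theorem exists_straightening {f : E4 → E4} {s : Set E4} {a : E4} (hs : IsOpen s) (ha : a ∈ s)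
    (hf : ContDiffOn ℝ ∞ f s) (hfa : f a ≠ 0) :
    ∃ e : OpenPartialHomeomorph E4 E4, 0 ∈ e.source ∧ e 0 = a ∧ e.target ⊆ s ∧
      ContDiffOn ℝ ∞ e e.source ∧ ContDiffOn ℝ ∞ e.symm e.target ∧
      ∀ z ∈ e.source, fderiv ℝ e z e0 = f (e z) := by
  obtain ⟨ε, hε, Φ, hΦ, hΦs, hΦ0⟩ := exists_smooth_flow (hs.mem_nhds ha) hf
  obtain ⟨A, hA⟩ := SeparatingDual.exists_continuousLinearEquiv_apply_eq (R := ℝ) e0_ne_zero hfa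
  set D : Set E4 := {z | z 0 ∈ Ioo (-ε) ε ∧ a + A (spaceProj z) ∈ ball a ε} with hD
  have hDo : IsOpen D := by
    apply IsOpen.inter
    · exact isOpen_Ioo.preimage (by fun_prop)
    · exact isOpen_ball.preimage (by fun_prop)
  have h0D : (0 : E4) ∈ D := by simp [D, hε]
  set Ψ : E4 → E4 := fun z => Φ (z 0, a + A (spaceProj z)) with hΨ
  have hm : MapsTo (fun z : E4 => (z 0, a + A (spaceProj z))) D (Ioo (-ε) ε ×ˢ ball a ε) :=
    fun z hz => hz
  have hΨc : ContDiffOn ℝ ∞ Ψ D := by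
    refine hΦ.comp (ContDiff.contDiffOn ?_) hm
    have : ContDiff ℝ ∞ (fun z : E4 => z 0) :=
      (EuclideanSpace.proj (0 : Fin 4) : E4 →L[ℝ] ℝ).contDiff
    fun_prop
  have hΨd : ∀ z ∈ D, HasFDerivAt Ψ (fderiv ℝ Ψ z) z := fun z hz =>
    ((hΨc.contDiffAt (hDo.mem_nhds hz)).differentiableAt (by simp)).hasFDerivAt
  have hline : ∀ z w : E4, HasDerivAt (fun t : ℝ => z + t • w) w 0 := fun z w => by
    simpa using ((hasDerivAt_id (0 : ℝ)).smul_const w).const_add z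
  have hdir : ∀ z ∈ D, ∀ w, HasDerivAt (fun t : ℝ => Ψ (z + t • w)) (fderiv ℝ Ψ z w) 0 := by
    intro z hz w
    have h1 : HasFDerivAt Ψ (fderiv ℝ Ψ z) (z + (0 : ℝ) • w) := by simpa using hΨd z hz
    exact h1.comp_hasDerivAt (0 : ℝ) (hline z w)
  have hflow : ∀ z ∈ D, fderiv ℝ Ψ z e0 = f (Ψ z) := by
    intro z hz
    have h1 := (hΦ0 _ hz.2).2 _ hz.1
    have h2 : HasDerivAt (fun t : ℝ => Ψ (z + t • e0)) (f (Ψ z)) 0 := by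
      have h3 : HasDerivAt (fun t : ℝ => z 0 + t) 1 0 := (hasDerivAt_id (0 : ℝ)).const_add _
      have h4 : HasDerivAt (fun s => Φ (s, a + A (spaceProj z))) (f (Ψ z)) (z 0 + 0) := by
        simpa using h1
      have h5 := h4.scomp (0 : ℝ) h3
      rw [one_smul] at h5
      exact h5.congr_of_eventuallyEq (Eventually.of_forall fun t => by simp [Ψ])
    exact (hdir z hz e0).unique h2
  have hΨ0 : Ψ 0 = a := by
    have := (hΦ0 a (mem_ball_self hε)).1
    simpa [Ψ] using this
  have hfd : fderiv ℝ Ψ 0 = A := by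
    ext1 w
    have hw : w = spaceProj w + w 0 • e0 := (spaceProj_add w).symm
    have h1 : fderiv ℝ Ψ 0 (spaceProj w) = A (spaceProj w) := by
      refine (hdir 0 h0D (spaceProj w)).unique ?_
      have hev : (fun t : ℝ => Ψ (0 + t • spaceProj w)) =ᶠ[𝓝 0]
          fun t => a + t • A (spaceProj w) := by
        have hc : Tendsto (fun t : ℝ => a + t • A (spaceProj w)) (𝓝 0) (𝓝 a) := by
          have : Continuous (fun t : ℝ => a + t • A (spaceProj w)) := by fun_prop
          simpa using this.tendsto 0
        filter_upwards [hc (ball_mem_nhds a hε)] with t ht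
        have h2 := (hΦ0 _ ht).1
        have h3 : spaceProj (spaceProj w) = spaceProj w := by
          rw [spaceProj_apply (spaceProj w)]; simp
        simp only [Ψ, zero_add, map_smul, h3]
        simpa using h2
      exact (hline a _).congr_of_eventuallyEq hev
    rw [hw, map_add, map_smul, h1, hflow 0 h0D, hΨ0, ContinuousLinearEquiv.coe_coe, map_add,
      map_smul, hA]
  obtain ⟨e, he, he0, hes, hesymm⟩ := exists_smooth_openPartialHomeomorph hDo h0D hΨc A
    (by rw [← hfd]; exact hΨd 0 h0D)
  refine ⟨e, he0, by rw [he, hΨ0], ?_, by rw [he]; exact hΨc.mono hes, hesymm, fun z hz => ?_⟩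
  · intro y hy
    rw [← e.right_inv hy, he]
    exact hΦs (hm (hes (e.map_target hy)))
  · rw [he]
    exact hflow z (hes hz)

namespace Spacetime

variable {M : Type*} [TopologicalSpace M] [ChartedSpace (EuclideanSpace ℝ (Fin 4)) M]
  [IsManifold (𝓡 4) ∞ M]

/-- A smooth chart in which the vector field `V` is the constant field `e0`. -/
structure IsFlowBox (V : (x : M) → TangentSpace (𝓡 4) x) (φ : OpenPartialHomeomorph M E4) :
    Prop where
  mem : φ ∈ IsManifold.maximalAtlas (𝓡 4) ∞ M
  field : ∀ y ∈ φ.target, fieldInChart V φ y = e0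

variable {φ : OpenPartialHomeomorph M E4} {V : (x : M) → TangentSpace (𝓡 4) x}

theorem isFlowBox_trans (hφ : φ ∈ IsManifold.maximalAtlas (𝓡 4) ∞ M)
    {e : OpenPartialHomeomorph E4 E4} (het : e.target ⊆ φ.target)
    (he : ContDiffOn ℝ ∞ e e.source) (he' : ContDiffOn ℝ ∞ e.symm e.target)
    (hf : ∀ z ∈ e.source, fderiv ℝ e z e0 = fieldInChart V φ (e z)) :
    IsFlowBox V (φ.trans e.symm) ∧ (φ.trans e.symm).target = e.source := by
  have ht : (φ.trans e.symm).target = e.source := by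
    ext z
    simp only [OpenPartialHomeomorph.trans_target, OpenPartialHomeomorph.symm_target,
      OpenPartialHomeomorph.symm_symm, mem_inter_iff, mem_preimage]
    exact ⟨fun h => h.1, fun h => ⟨h, het (e.map_source h)⟩⟩
  have hmem : φ.trans e.symm ∈ IsManifold.maximalAtlas (𝓡 4) ∞ M := by
    apply OpenPartialHomeomorph.mem_maximalAtlas_of_contMDiffOn
    · refine ContMDiffOn.comp (t := e.target) (contMDiffOn_iff_contDiffOn.2 he')
        ((contMDiffOn_of_mem_maximalAtlas hφ).mono fun x hx => hx.1) fun x hx => hx.2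
    · refine ContMDiffOn.comp (f := e) (t := φ.target)
        (contMDiffOn_symm_of_mem_maximalAtlas hφ)
        ((contMDiffOn_iff_contDiffOn.2 he).mono fun x hx => hx.1) fun x hx => hx.2
  refine ⟨⟨hmem, fun y hy => ?_⟩, ht⟩
  have hye : y ∈ e.source := ht ▸ hy
  have hz : e y ∈ φ.target := het (e.map_source hye)
  have hz' : φ.symm (e y) ∈ (φ.trans e.symm).source := by
    refine ⟨φ.map_target hz, ?_⟩
    change φ (φ.symm (e y)) ∈ e.target
    rw [φ.right_inv hz]
    exact e.map_source hye
  have h1 := fieldInChart_transition hmem hφ hz hz' V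
  have hev : (fun z => (φ.trans e.symm) (φ.symm z)) =ᶠ[𝓝 (e y)] e.symm := by
    filter_upwards [φ.open_target.mem_nhds hz] with w hw
    simp [φ.right_inv hw]
  rw [hev.eq_of_nhds, hev.fderiv_eq, e.left_inv hye, ← hf y hye] at h1
  rw [h1]
  have d1 : HasFDerivAt e (fderiv ℝ e y) y :=
    ((he.contDiffAt (e.open_source.mem_nhds hye)).differentiableAt (by simp)).hasFDerivAt
  have d2 : HasFDerivAt e.symm (fderiv ℝ e.symm (e y)) (e y) :=
    ((he'.contDiffAt (e.open_target.mem_nhds (e.map_source hye))).differentiableAt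
      (by simp)).hasFDerivAt
  have hev2 : e.symm ∘ e =ᶠ[𝓝 y] id := by
    filter_upwards [e.open_source.mem_nhds hye] with w hw
    exact e.left_inv hw
  have d3 := (d2.comp y d1).unique ((hasFDerivAt_id y).congr_of_eventuallyEq hev2)
  exact congrArg (fun L => L e0) d3

/-- Around each point there is a chart in which the vector field is constant. -/
theorem exists_isFlowBox
    (hV : ContMDiff (𝓡 4) (𝓡 4).tangent ∞ (fun x ↦ (⟨x, V x⟩ : TangentBundle (𝓡 4) M)))
    (x₀ : M) (hx₀ : V x₀ ≠ 0) : ∃ φ : OpenPartialHomeomorph M E4, IsFlowBox V φ ∧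
      x₀ ∈ φ.source ∧ φ x₀ = 0 := by
  have hφ : chartAt E4 x₀ ∈ IsManifold.maximalAtlas (𝓡 4) ∞ M :=
    IsManifold.chart_mem_maximalAtlas x₀
  set φ := chartAt E4 x₀
  have hx : x₀ ∈ φ.source := mem_chart_source E4 x₀
  have hne : fieldInChart V φ (φ x₀) ≠ 0 := by
    intro h
    have h2 := frame_fieldInChart hφ (φ.map_source hx) V
    rw [h, map_zero, φ.left_inv hx] at h2
    exact hx₀ h2.symm
  obtain ⟨e, h0, h0a, het, he, he', hf⟩ := exists_straightening φ.open_target (φ.map_source hx)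
    (contDiffOn_fieldInChart hφ hV) hne
  obtain ⟨h1, h2⟩ := isFlowBox_trans hφ het he he' hf
  refine ⟨_, h1, ⟨hx, ?_⟩, ?_⟩
  · change φ x₀ ∈ e.target
    rw [← h0a]; exact e.map_source h0
  · simp only [OpenPartialHomeomorph.coe_trans, Function.comp]
    rw [← h0a, e.left_inv h0]

end Spacetime

end

section

variable {E F : Type*} [NormedAddCommGroup E] [NormedSpace ℝ E] [NormedAddCommGroup F]
  [NormedSpace ℝ F]

theorem ContDiffAt.exists_lipschitz_bound {f : E → F} {p : E} (hf : ContDiffAt ℝ 1 f p) :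
    ∃ K > 0, ∃ δ > 0, ∀ x ∈ ball p δ, ‖f x‖ ≤ K ∧ ∀ y ∈ ball p δ, ‖f x - f y‖ ≤ K * ‖x - y‖ := by
  obtain ⟨K, s, hs, hK⟩ := hf.exists_lipschitzOnWith
  have h1 : ∀ᶠ x in 𝓝 p, ‖f x‖ < ‖f p‖ + 1 :=
    hf.continuousAt.norm.eventually_lt_const (lt_add_one _)
  obtain ⟨δ, hδ, hb⟩ := Metric.mem_nhds_iff.1 (inter_mem hs h1)
  refine ⟨max K (‖f p‖ + 1), by positivity, δ, hδ, fun x hx => ⟨?_, fun y hy => ?_⟩⟩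
  · exact (le_of_lt (hb hx).2).trans (le_max_right _ _)
  · rw [← dist_eq_norm, ← dist_eq_norm]
    exact (hK.dist_le_mul x (hb hx).1 y (hb hy).1).trans
      (mul_le_mul_of_nonneg_right (le_max_left _ _) dist_nonneg)

/-- The midpoint rule. -/
theorem norm_sub_sub_deriv_midpoint_le {c c' c'' : ℝ → F} {K : ℝ}
    (h1 : ∀ s ∈ Icc (0 : ℝ) 1, HasDerivAt c (c' s) s)
    (h2 : ∀ s ∈ Icc (0 : ℝ) 1, HasDerivAt c' (c'' s) s)
    (hK : ∀ s ∈ Icc (0 : ℝ) 1, ∀ s' ∈ Icc (0 : ℝ) 1, ‖c'' s - c'' s'‖ ≤ K) :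
    ‖c 1 - c 0 - c' (1 / 2)‖ ≤ K := by
  have hK0 : 0 ≤ K := (norm_nonneg _).trans
    (hK 0 (left_mem_Icc.2 zero_le_one) 0 (left_mem_Icc.2 zero_le_one))
  have hp : ∀ s ∈ Icc (0 : ℝ) (1 / 2), 1 / 2 + s ∈ Icc (0 : ℝ) 1 := fun s hs =>
    ⟨by linarith [hs.1], by linarith [hs.2]⟩
  have hm : ∀ s ∈ Icc (0 : ℝ) (1 / 2), 1 / 2 - s ∈ Icc (0 : ℝ) 1 := fun s hs =>
    ⟨by linarith [hs.2], by linarith [hs.1]⟩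
  have dp : ∀ s : ℝ, HasDerivAt (fun s : ℝ => 1 / 2 + s) 1 s := fun s =>
    (hasDerivAt_id s).const_add _
  have dm : ∀ s : ℝ, HasDerivAt (fun s : ℝ => 1 / 2 - s) (-1) s := fun s =>
    (hasDerivAt_id s).const_sub _
  have d2 : ∀ s ∈ Icc (0 : ℝ) (1 / 2), HasDerivAt
      (fun s => c' (1 / 2 + s) + c' (1 / 2 - s)) (c'' (1 / 2 + s) - c'' (1 / 2 - s)) s := by
    intro s hs
    have := ((h2 _ (hp s hs)).scomp s (dp s)).add ((h2 _ (hm s hs)).scomp s (dm s))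
    simp only [one_smul, neg_smul, ← sub_eq_add_neg] at this
    exact this
  have d1 : ∀ s ∈ Icc (0 : ℝ) (1 / 2), HasDerivAt
      (fun s => c (1 / 2 + s) - c (1 / 2 - s) - (2 * s) • c' (1 / 2))
      (c' (1 / 2 + s) + c' (1 / 2 - s) - (2 : ℝ) • c' (1 / 2)) s := by
    intro s hs
    have h3 : HasDerivAt (fun s : ℝ => 2 * s) 2 s := by
      simpa using (hasDerivAt_id s).const_mul (2 : ℝ)
    have := (((h1 _ (hp s hs)).scomp s (dp s)).sub ((h1 _ (hm s hs)).scomp s (dm s))).sub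
      (h3.smul_const (c' (1 / 2)))
    simp only [one_smul, neg_smul, sub_neg_eq_add] at this
    exact this
  have b2 : ∀ s ∈ Icc (0 : ℝ) (1 / 2),
      ‖c' (1 / 2 + s) + c' (1 / 2 - s) - (2 : ℝ) • c' (1 / 2)‖ ≤ K := by
    intro s hs
    have := norm_image_sub_le_of_norm_deriv_le_segment' (C := K)
      (fun s hs => (d2 s hs).hasDerivWithinAt)
      (fun s hs => hK _ (hp s ⟨hs.1, hs.2.le⟩) _ (hm s ⟨hs.1, hs.2.le⟩)) s hs
    simp only [add_zero, sub_zero, ← two_smul ℝ (c' (1 / 2))] at this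
    refine this.trans ?_
    have := mul_le_mul_of_nonneg_left (hs.2.trans (by norm_num : (1 / 2 : ℝ) ≤ 1)) hK0
    linarith
  have b1 := norm_image_sub_le_of_norm_deriv_le_segment' (C := K)
      (fun s hs => (d1 s hs).hasDerivWithinAt) (fun s hs => b2 s ⟨hs.1, hs.2.le⟩)
      (1 / 2) ⟨by norm_num, le_rfl⟩
  norm_num at b1
  norm_num
  linarith

theorem norm_image_sub_le_of_norm_deriv_le_Icc {c c' : ℝ → F} {K : ℝ}
    (h1 : ∀ s ∈ Icc (0 : ℝ) 1, HasDerivAt c (c' s) s)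
    (hK : ∀ s ∈ Icc (0 : ℝ) 1, ‖c' s‖ ≤ K) {s t : ℝ} (hs : s ∈ Icc (0 : ℝ) 1)
    (ht : t ∈ Icc (0 : ℝ) 1) : ‖c s - c t‖ ≤ K * |s - t| :=
  Convex.norm_image_sub_le_of_norm_hasDerivWithin_le
    (fun r hr => (h1 r hr).hasDerivWithinAt) hK (convex_Icc 0 1) ht hs

/-- The midpoint rule for a smooth function along a short geodesic. -/
theorem exists_geodesic_midpoint_bound {B : E → E →L[ℝ] E →L[ℝ] E} {f : E → F} {O : Set E} {p : E}
    (hO : IsOpen O) (hp : p ∈ O) (hB : ContDiffOn ℝ ∞ B O) (hf : ContDiffOn ℝ ∞ f O) :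
    ∃ C > 0, ∃ δ > 0, ∀ (r : ℝ) (J : Set ℝ) (x v : ℝ → E), Icc 0 1 ⊆ J → IsGeodesicCurve B J x v →
      (∀ s ∈ Icc (0 : ℝ) 1, x s ∈ ball p δ ∧ ‖v s‖ ≤ r) →
      ‖f (x 1) - f (x 0) - fderiv ℝ f (x (1 / 2)) (v (1 / 2))‖ ≤ C * r ^ 3 ∧
      ‖x 1 + x 0 - (2 : ℝ) • x (1 / 2)‖ ≤ C * r ^ 2 := by
  set Q : E → E →L[ℝ] E →L[ℝ] F := fun y => fderiv ℝ (fderiv ℝ f) y -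
    (ContinuousLinearMap.compL ℝ E E F (fderiv ℝ f y)).comp (B y) with hQ
  have hf1 := contDiffOn_fderiv_of_isOpen_infty hO hf
  have hf2 := contDiffOn_fderiv_of_isOpen_infty hO hf1
  have hQs : ContDiffOn ℝ ∞ Q O :=
    hf2.sub (((ContinuousLinearMap.compL ℝ E E F).contDiff.comp_contDiffOn hf1).clm_comp hB)
  obtain ⟨K₁, hK₁, δ₁, hδ₁, hb₁⟩ :=
    ((hQs.contDiffAt (hO.mem_nhds hp)).of_le (m := 1) (by norm_cast)).exists_lipschitz_bound
  obtain ⟨K₂, hK₂, δ₂, hδ₂, hb₂⟩ :=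
    ((hB.contDiffAt (hO.mem_nhds hp)).of_le (m := 1) (by norm_cast)).exists_lipschitz_bound
  obtain ⟨δ₃, hδ₃, hb₃⟩ := Metric.isOpen_iff.1 hO p hp
  refine ⟨K₁ + 2 * K₁ * K₂ + K₂, by positivity, min (min δ₁ δ₂) δ₃, by positivity, ?_⟩
  intro r J x v hJ hg hx
  have hr : 0 ≤ r := (norm_nonneg _).trans (hx 0 (left_mem_Icc.2 zero_le_one)).2
  have hx₁ : ∀ s ∈ Icc (0 : ℝ) 1, x s ∈ ball p δ₁ := fun s hs =>
    ball_subset_ball ((min_le_left _ _).trans (min_le_left _ _)) (hx s hs).1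
  have hx₂ : ∀ s ∈ Icc (0 : ℝ) 1, x s ∈ ball p δ₂ := fun s hs =>
    ball_subset_ball ((min_le_left _ _).trans (min_le_right _ _)) (hx s hs).1
  have hx₃ : ∀ s ∈ Icc (0 : ℝ) 1, x s ∈ O := fun s hs =>
    hb₃ (ball_subset_ball (min_le_right _ _) (hx s hs).1)
  have hv : ∀ s ∈ Icc (0 : ℝ) 1, ‖v s‖ ≤ r := fun s hs => (hx s hs).2
  have hx' := fun s (hs : s ∈ Icc (0 : ℝ) 1) => hg.hasDerivAt s (hJ hs)
  have hv' := fun s (hs : s ∈ Icc (0 : ℝ) 1) => hg.hasDerivAt_velocity s (hJ hs)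
  have hvb : ∀ s ∈ Icc (0 : ℝ) 1, ‖-B (x s) (v s) (v s)‖ ≤ K₂ * r ^ 2 := fun s hs => by
    rw [norm_neg]
    calc ‖B (x s) (v s) (v s)‖ ≤ ‖B (x s)‖ * ‖v s‖ * ‖v s‖ := (B (x s)).le_opNorm₂ _ _
      _ ≤ K₂ * r * r := by gcongr; exacts [(hb₂ _ (hx₂ s hs)).1, hv s hs, hv s hs]
      _ = K₂ * r ^ 2 := by ring
  have habs : ∀ s ∈ Icc (0 : ℝ) 1, ∀ s' ∈ Icc (0 : ℝ) 1, |s - s'| ≤ 1 := fun s hs s' hs' => by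
    rw [abs_le]; constructor <;> linarith [hs.1, hs.2, hs'.1, hs'.2]
  have hxd : ∀ s ∈ Icc (0 : ℝ) 1, ∀ s' ∈ Icc (0 : ℝ) 1, ‖x s - x s'‖ ≤ r := fun s hs s' hs' =>
    (norm_image_sub_le_of_norm_deriv_le_Icc hx' hv hs hs').trans
      (mul_le_of_le_one_right hr (habs s hs s' hs'))
  have hvd : ∀ s ∈ Icc (0 : ℝ) 1, ∀ s' ∈ Icc (0 : ℝ) 1, ‖v s - v s'‖ ≤ K₂ * r ^ 2 :=
    fun s hs s' hs' => (norm_image_sub_le_of_norm_deriv_le_Icc hv' hvb hs hs').trans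
      (mul_le_of_le_one_right (by positivity) (habs s hs s' hs'))
  have h0 : (0 : ℝ) ∈ Icc (0 : ℝ) 1 := left_mem_Icc.2 zero_le_one
  have h1 : (1 : ℝ) ∈ Icc (0 : ℝ) 1 := right_mem_Icc.2 zero_le_one
  constructor
  · have d1 : ∀ s ∈ Icc (0 : ℝ) 1, HasDerivAt (fun s => f (x s)) (fderiv ℝ f (x s) (v s)) s := by
      intro s hs
      exact (((hf.contDiffAt (hO.mem_nhds (hx₃ s hs))).differentiableAt
        (by simp)).hasFDerivAt).comp_hasDerivAt s (hx' s hs)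
    have d2 : ∀ s ∈ Icc (0 : ℝ) 1, HasDerivAt (fun s => fderiv ℝ f (x s) (v s))
        (Q (x s) (v s) (v s)) s := by
      intro s hs
      have h3 := (((hf1.contDiffAt (hO.mem_nhds (hx₃ s hs))).differentiableAt
        (by simp)).hasFDerivAt).comp_hasDerivAt s (hx' s hs)
      have h4 := h3.clm_apply (hv' s hs)
      refine h4.congr_deriv ?_
      simp [Q, sub_eq_add_neg]
    have h5 := norm_sub_sub_deriv_midpoint_le d1 d2
      (K := K₁ * r * r * r + K₁ * r * (K₂ * r ^ 2) + K₁ * (K₂ * r ^ 2) * r) ?_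
    · refine h5.trans ?_
      have : 0 ≤ K₂ * r ^ 3 := by positivity
      nlinarith
    · intro s hs s' hs'
      have e : Q (x s) (v s) (v s) - Q (x s') (v s') (v s') =
          (Q (x s) - Q (x s')) (v s) (v s) + Q (x s') (v s) (v s - v s')
            + Q (x s') (v s - v s') (v s') := by
        simp
      rw [e]
      refine (norm_add_le _ _).trans (add_le_add ((norm_add_le _ _).trans (add_le_add ?_ ?_)) ?_)
      · refine ((Q (x s) - Q (x s')).le_opNorm₂ _ _).trans ?_
        have := (hb₁ _ (hx₁ s hs)).2 _ (hx₁ s' hs')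
        gcongr
        · exact this.trans (by gcongr; exact hxd s hs s' hs')
        · exact hv s hs
        · exact hv s hs
      · refine ((Q (x s')).le_opNorm₂ _ _).trans ?_
        gcongr
        exacts [(hb₁ _ (hx₁ s' hs')).1, hv s hs, hvd s hs s' hs']
      · refine ((Q (x s')).le_opNorm₂ _ _).trans ?_
        gcongr
        exacts [(hb₁ _ (hx₁ s' hs')).1, hvd s hs s' hs', hv s' hs']
  · have hp' : ∀ s ∈ Icc (0 : ℝ) (1 / 2), 1 / 2 + s ∈ Icc (0 : ℝ) 1 := fun s hs =>
      ⟨by linarith [hs.1], by linarith [hs.2]⟩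
    have hm' : ∀ s ∈ Icc (0 : ℝ) (1 / 2), 1 / 2 - s ∈ Icc (0 : ℝ) 1 := fun s hs =>
      ⟨by linarith [hs.2], by linarith [hs.1]⟩
    have d1 : ∀ s ∈ Icc (0 : ℝ) (1 / 2), HasDerivAt (fun s => x (1 / 2 + s) + x (1 / 2 - s))
        (v (1 / 2 + s) - v (1 / 2 - s)) s := by
      intro s hs
      have dp : HasDerivAt (fun s : ℝ => 1 / 2 + s) 1 s := (hasDerivAt_id s).const_add _
      have dm : HasDerivAt (fun s : ℝ => 1 / 2 - s) (-1) s := (hasDerivAt_id s).const_sub _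
      have := ((hx' _ (hp' s hs)).scomp s dp).add ((hx' _ (hm' s hs)).scomp s dm)
      simp only [one_smul, neg_smul, ← sub_eq_add_neg] at this
      exact this
    have b := norm_image_sub_le_of_norm_deriv_le_segment' (C := K₂ * r ^ 2)
      (fun s hs => (d1 s hs).hasDerivWithinAt)
      (fun s hs => hvd _ (hp' s ⟨hs.1, hs.2.le⟩) _ (hm' s ⟨hs.1, hs.2.le⟩)) (1 / 2)
      ⟨by norm_num, le_rfl⟩
    norm_num at b
    rw [← two_smul ℝ] at b
    norm_num
    have : 0 ≤ K₂ * r ^ 2 := by positivity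
    have : 0 ≤ (K₁ + 2 * K₁ * K₂) * r ^ 2 := by positivity
    linarith

end

section

variable {E : Type*} [NormedAddCommGroup E] [NormedSpace ℝ E]

theorem abs_form_sub_form_le {b b' : E →L[ℝ] E →L[ℝ] ℝ} {κ K a d : ℝ} (hκ : ‖b' - b‖ ≤ κ)
    (hK : ‖b‖ ≤ K) {u w : E} (hu : ‖u‖ ≤ a) (hw : ‖w‖ ≤ a) (hd : ‖u - w‖ ≤ d) :
    |b' u u - b w w| ≤ κ * a ^ 2 + 2 * K * a * d := by
  have h2 : b' u u - b w w = (b' - b) u u + b (u - w) u + b w (u - w) := by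
    simp
  rw [h2, ← Real.norm_eq_abs]
  have h3 : ‖(b' - b) u u‖ ≤ κ * a * a :=
    ContinuousLinearMap.le_of_opNorm₂_le_of_le _ hκ hu hu
  have h4 : ‖b (u - w) u‖ ≤ K * d * a :=
    ContinuousLinearMap.le_of_opNorm₂_le_of_le _ hK hd hu
  have h5 : ‖b w (u - w)‖ ≤ K * a * d :=
    ContinuousLinearMap.le_of_opNorm₂_le_of_le _ hK hw hd
  calc _ ≤ ‖(b' - b) u u‖ + ‖b (u - w) u‖ + ‖b w (u - w)‖ := norm_add₃_le
    _ ≤ κ * a * a + K * d * a + K * a * d := by gcongr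
    _ = _ := by ring

/-- A geodesic of `B` in `O`, parametrized by `[0,1]`, of speed at most `r`, which is null and
future-pointing for the conformal metric `g`. -/
structure IsShortRay (B : E → E →L[ℝ] E →L[ℝ] E) (g : E → E →L[ℝ] E →L[ℝ] ℝ) (e : E) (O : Set E)
    (r : ℝ) (x v : ℝ → E) : Prop where
  geodesic : IsGeodesicCurve B (Icc 0 1) x v
  mem : ∀ s ∈ Icc (0 : ℝ) 1, x s ∈ O
  bound : ∀ s ∈ Icc (0 : ℝ) 1, ‖v s‖ ≤ r
  null : ∀ s ∈ Icc (0 : ℝ) 1, g (x s) (v s) (v s) = 0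
  future : ∀ s ∈ Icc (0 : ℝ) 1, g (x s) e (v s) < 0

/-- The value of `τ` at `q` is the radar time with respect to the line `p + ℝ e`, measured with
short rays. -/
def IsShortRadarTime (B : E → E →L[ℝ] E →L[ℝ] E) (g : E → E →L[ℝ] E →L[ℝ] ℝ) (e : E) (O : Set E)
    (τ : E → ℝ) (p : E) (r : ℝ) (q : E) : Prop :=
  ∃ t₁ t₂ : ℝ, ∃ x₁ v₁ x₂ v₂ : ℝ → E, IsShortRay B g e O r x₁ v₁ ∧ IsShortRay B g e O r x₂ v₂ ∧
    x₁ 0 = p + t₁ • e ∧ x₁ 1 = q ∧ x₂ 0 = q ∧ x₂ 1 = p + t₂ • e ∧ τ q - τ p = (t₁ + t₂) / 2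

variable {B : E → E →L[ℝ] E →L[ℝ] E} {g : E → E →L[ℝ] E →L[ℝ] ℝ} {e : E} {O : Set E} {p : E}

theorem IsShortRay.norm_sub_le {r : ℝ} {x v : ℝ → E} (h : IsShortRay B g e O r x v) {s t : ℝ}
    (hs : s ∈ Icc (0 : ℝ) 1) (ht : t ∈ Icc (0 : ℝ) 1) : ‖x s - x t‖ ≤ r := by
  have hr : 0 ≤ r := (norm_nonneg _).trans (h.bound s hs)
  refine (norm_image_sub_le_of_norm_deriv_le_Icc h.geodesic.hasDerivAt h.bound hs ht).trans
    (mul_le_of_le_one_right hr ?_)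
  rw [abs_le]; constructor <;> linarith [hs.1, hs.2, ht.1, ht.2]

theorem exists_ray_chord_bound (hO : IsOpen O) (hp : p ∈ O) (hB : ContDiffOn ℝ ∞ B O)
    (hg : ContDiffOn ℝ ∞ g O) :
    ∃ C > 0, ∃ δ > 0, ∀ (r : ℝ) (x v : ℝ → E), r ≤ 1 → r < δ → IsShortRay B g e O r x v →
      (∀ s ∈ Icc (0 : ℝ) 1, ‖x s - p‖ ≤ r) →
      |g p (x 1 - x 0) (x 1 - x 0)| ≤ C * r ^ 3 ∧ g p e (x 1 - x 0) ≤ C * r ^ 2 := by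
  obtain ⟨C, hC, δ₁, hδ₁, hC'⟩ := exists_geodesic_midpoint_bound hO hp hB (contDiffOn_id (E := E))
  obtain ⟨K, hK, δ₂, hδ₂, hb⟩ :=
    ((hg.contDiffAt (hO.mem_nhds hp)).of_le (m := 1) (by norm_cast)).exists_lipschitz_bound
  refine ⟨K + 2 * K * C + K * ‖e‖ + K * ‖e‖ * C, by positivity, min δ₁ δ₂, by positivity, ?_⟩
  intro r x v hr1 hrδ hx hxp
  have hh : (1 / 2 : ℝ) ∈ Icc (0 : ℝ) 1 := by constructor <;> norm_num
  have h0 : (0 : ℝ) ∈ Icc (0 : ℝ) 1 := left_mem_Icc.2 zero_le_one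
  have h1 : (1 : ℝ) ∈ Icc (0 : ℝ) 1 := right_mem_Icc.2 zero_le_one
  have hr : 0 ≤ r := (norm_nonneg _).trans (hx.bound 0 h0)
  have hmem : ∀ s ∈ Icc (0 : ℝ) 1, x s ∈ ball p (min δ₁ δ₂) := fun s hs => by
    rw [mem_ball, dist_eq_norm]; exact (hxp s hs).trans_lt hrδ
  have hd := (hC' r _ x v Subset.rfl hx.geodesic fun s hs =>
    ⟨ball_subset_ball (min_le_left _ _) (hmem s hs), hx.bound s hs⟩).1
  simp only [id_eq, fderiv_id, ContinuousLinearMap.id_apply] at hd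
  have hmid := ball_subset_ball (min_le_right δ₁ δ₂) (hmem _ hh)
  have hdiff : ‖g p - g (x (1 / 2))‖ ≤ K * r := by
    refine ((hb p (mem_ball_self hδ₂)).2 _ hmid).trans ?_
    rw [norm_sub_rev]
    exact mul_le_mul_of_nonneg_left (hxp _ hh) hK.le
  have hr32 : r ^ 3 ≤ r ^ 2 := pow_le_pow_of_le_one hr hr1 (by norm_num)
  constructor
  · have := abs_form_sub_form_le hdiff (hb _ hmid).1 (hx.norm_sub_le h1 h0) (hx.bound _ hh) hd
    rw [hx.null _ hh, sub_zero] at this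
    refine this.trans ?_
    have a1 : C * r ^ 3 ≤ C * r ^ 2 := mul_le_mul_of_nonneg_left hr32 hC.le
    have a2 : 2 * K * r * (C * r ^ 3) ≤ 2 * K * r * (C * r ^ 2) :=
      mul_le_mul_of_nonneg_left a1 (by positivity)
    have a3 : 0 ≤ (K * ‖e‖ + K * ‖e‖ * C) * r ^ 3 := by positivity
    nlinarith
  · have e1 : g p e (x 1 - x 0) = (g p - g (x (1 / 2))) e (x 1 - x 0)
        + g (x (1 / 2)) e (x 1 - x 0 - v (1 / 2)) + g (x (1 / 2)) e (v (1 / 2)) := by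
      simp
    have b1 : ‖(g p - g (x (1 / 2))) e (x 1 - x 0)‖ ≤ K * r * ‖e‖ * r :=
      ContinuousLinearMap.le_of_opNorm₂_le_of_le _ hdiff le_rfl (hx.norm_sub_le h1 h0)
    have b2 : ‖g (x (1 / 2)) e (x 1 - x 0 - v (1 / 2))‖ ≤ K * ‖e‖ * (C * r ^ 3) :=
      ContinuousLinearMap.le_of_opNorm₂_le_of_le _ (hb _ hmid).1 le_rfl hd
    have b3 := hx.future _ hh
    rw [Real.norm_eq_abs] at b1 b2
    have c1 := (abs_le.1 b1).2
    have c2 := (abs_le.1 b2).2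
    have a1 : K * ‖e‖ * (C * r ^ 3) ≤ K * ‖e‖ * (C * r ^ 2) := by gcongr
    have a3 : 0 ≤ (K + 2 * K * C) * r ^ 2 := by positivity
    nlinarith

theorem abs_add_le_of_sq_sub_sq {a₁ a₂ R k η : ℝ} (h₁ : a₁ ≤ k) (h₂ : -k ≤ a₂)
    (h : |a₂ ^ 2 - a₁ ^ 2| ≤ R) (hη : 0 < η) (hk : 4 * k ≤ η) (hR : 2 * R ≤ η ^ 2) :
    |a₁ + a₂| ≤ η := by
  by_contra hlt
  rw [not_le] at hlt
  have h3 := abs_le.1 h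
  rcases abs_cases (a₁ + a₂) with ⟨h5, h6⟩ | ⟨h5, h6⟩ <;> nlinarith

/-- A function that coincides with the radar time has derivative `-g(e, ·)`. -/
theorem hasFDerivAt_of_isShortRadarTime (hO : IsOpen O) (hp : p ∈ O) (hB : ContDiffOn ℝ ∞ B O)
    (hg : ContDiffOn ℝ ∞ g O) (hs : ∀ u w, g p u w = g p w u) (hee : g p e e = -1) {τ : E → ℝ}
    (hline : ∀ᶠ t : ℝ in 𝓝 0, τ (p + t • e) = τ p + t)
    (hray : ∃ C > 0, ∀ᶠ q in 𝓝 p, (∀ t : ℝ, q ≠ p + t • e) →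
      IsShortRadarTime B g e O τ p (C * ‖q - p‖) q) :
    HasFDerivAt τ (-g p e) p := by
  obtain ⟨C, hC, hray⟩ := hray
  obtain ⟨K, hK, δ, hδ, hb⟩ := exists_ray_chord_bound (e := e) hO hp hB hg
  have he : 0 < ‖e‖ := by
    rw [norm_pos_iff]; rintro rfl; simp at hee
  rw [hasFDerivAt_iff_isLittleO, Asymptotics.isLittleO_iff]
  intro η hη
  set ρ := C + 1
  have hn : Tendsto (fun q => ‖q - p‖) (𝓝 p) (𝓝 0) := by
    have : Continuous fun q => ‖q - p‖ := by fun_prop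
    simpa using this.tendsto p
  have hsmall : ∀ k : ℝ, 0 < k → ∀ A : ℝ, ∀ᶠ q in 𝓝 p, A * ‖q - p‖ < k := fun k hk A => by
    have := hn.const_mul A
    rw [mul_zero] at this
    exact this.eventually_lt_const hk
  obtain ⟨δ', hδ', hl⟩ := Metric.eventually_nhds_iff.1 hline
  filter_upwards [hray, hsmall 1 one_pos ρ, hsmall δ hδ ρ, hsmall η hη (4 * K * ρ ^ 2),
    hsmall (η ^ 2) (by positivity) (4 * K * ρ ^ 3), hsmall (δ' * ‖e‖) (by positivity) 1]
    with q h1 h2 h3 h4 h5 h6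
  by_cases hq : ∃ t : ℝ, q = p + t • e
  · obtain ⟨t, rfl⟩ := hq
    rw [hl]
    · simp [hee]; positivity
    · rw [add_sub_cancel_left, one_mul, norm_smul] at h6
      rw [dist_zero_right]
      exact lt_of_mul_lt_mul_right h6 he.le
  push Not at hq
  obtain ⟨t₁, t₂, x₁, v₁, x₂, v₂, hx₁, hx₂, e1, e2, e3, e4, hτ⟩ := h1 hq
  have m0 : (0 : ℝ) ∈ Icc (0 : ℝ) 1 := left_mem_Icc.2 zero_le_one
  have m1 : (1 : ℝ) ∈ Icc (0 : ℝ) 1 := right_mem_Icc.2 zero_le_one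
  set z := q - p with hz
  have hmono : ∀ x v, IsShortRay B g e O (C * ‖z‖) x v → IsShortRay B g e O (ρ * ‖z‖) x v :=
    fun x v h => ⟨h.geodesic, h.mem, fun s hs => (h.bound s hs).trans
      (by simp only [ρ]; nlinarith [norm_nonneg z]),
      h.null, h.future⟩
  have hx₁p : ∀ s ∈ Icc (0 : ℝ) 1, ‖x₁ s - p‖ ≤ ρ * ‖z‖ := fun s hs => by
    calc ‖x₁ s - p‖ = ‖(x₁ s - x₁ 1) + z‖ := by rw [e2]; simp [z]
      _ ≤ ‖x₁ s - x₁ 1‖ + ‖z‖ := norm_add_le _ _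
      _ ≤ C * ‖z‖ + ‖z‖ := by gcongr; exact hx₁.norm_sub_le hs m1
      _ = ρ * ‖z‖ := by ring
  have hx₂p : ∀ s ∈ Icc (0 : ℝ) 1, ‖x₂ s - p‖ ≤ ρ * ‖z‖ := fun s hs => by
    calc ‖x₂ s - p‖ = ‖(x₂ s - x₂ 0) + z‖ := by rw [e3]; simp [z]
      _ ≤ ‖x₂ s - x₂ 0‖ + ‖z‖ := norm_add_le _ _
      _ ≤ C * ‖z‖ + ‖z‖ := by gcongr; exact hx₂.norm_sub_le hs m0
      _ = ρ * ‖z‖ := by ring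
  obtain ⟨b1, f1⟩ := hb _ _ _ h2.le h3 (hmono _ _ hx₁) hx₁p
  obtain ⟨b2, f2⟩ := hb _ _ _ h2.le h3 (hmono _ _ hx₂) hx₂p
  have d1 : x₁ 1 - x₁ 0 = z - t₁ • e := by rw [e1, e2, hz]; abel
  have d2 : x₂ 1 - x₂ 0 = t₂ • e - z := by rw [e3, e4, hz]; abel
  rw [d1] at b1 f1
  rw [d2] at b2 f2
  set θ := g p e z with hθ
  have hez : g p z e = θ := hs z e
  have g1 : g p (z - t₁ • e) (z - t₁ • e) = g p z z + θ ^ 2 - (t₁ + θ) ^ 2 := by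
    simp only [map_sub, map_smul, sub_apply, smul_apply, smul_eq_mul, hez, ← hθ, hee]; ring
  have g2 : g p (t₂ • e - z) (t₂ • e - z) = g p z z + θ ^ 2 - (t₂ + θ) ^ 2 := by
    simp only [map_sub, map_smul, sub_apply, smul_apply, smul_eq_mul, hez, ← hθ, hee]; ring
  have g3 : g p e (z - t₁ • e) = t₁ + θ := by
    simp only [map_sub, map_smul, smul_eq_mul, ← hθ, hee]; ring
  have g4 : g p e (t₂ • e - z) = -(t₂ + θ) := by
    simp only [map_sub, map_smul, smul_eq_mul, ← hθ, hee]; ring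
  rw [g1] at b1
  rw [g2] at b2
  rw [g3] at f1
  rw [g4] at f2
  have hz0 : 0 < ‖z‖ := by
    rw [norm_pos_iff]
    intro h
    exact hq 0 (by rw [zero_smul, add_zero]; exact sub_eq_zero.1 h)
  have key : |(t₁ + θ) + (t₂ + θ)| ≤ η * ‖z‖ := by
    refine abs_add_le_of_sq_sub_sq (k := K * (ρ * ‖z‖) ^ 2) (R := 2 * (K * (ρ * ‖z‖) ^ 3)) f1
      (by linarith) ?_ (by positivity) ?_ ?_
    · have a1 := abs_le.1 b1
      have a2 := abs_le.1 b2
      rw [abs_le]; constructor <;> linarith [a1.1, a1.2, a2.1, a2.2]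
    · have := mul_le_mul_of_nonneg_right h4.le hz0.le
      calc _ = 4 * K * ρ ^ 2 * ‖z‖ * ‖z‖ := by ring
        _ ≤ _ := this
    · have := mul_le_mul_of_nonneg_right h5.le (sq_nonneg ‖z‖)
      calc _ = 4 * K * ρ ^ 3 * ‖z‖ * ‖z‖ ^ 2 := by ring
        _ ≤ η ^ 2 * ‖z‖ ^ 2 := this
        _ = _ := by ring
  have : τ q - τ p - (-g p e) z = ((t₁ + θ) + (t₂ + θ)) / 2 := by
    rw [hτ, neg_apply, ← hθ]; ring
  rw [this, Real.norm_eq_abs, abs_div, abs_two]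
  have := abs_nonneg (t₁ + θ + (t₂ + θ))
  linarith

end

section

variable {E : Type*} [NormedAddCommGroup E] [NormedSpace ℝ E]
variable {B : E → E →L[ℝ] E →L[ℝ] E} {g : E → E →L[ℝ] E →L[ℝ] ℝ} {e : E} {O : Set E} {p : E}

/-- The spatial metric of the conformal metric `g`, where `g(e, e) = -1`. -/
def spaceForm (g : E → E →L[ℝ] E →L[ℝ] ℝ) (e : E) (y : E) : E →L[ℝ] E →L[ℝ] ℝ :=
  g y + (g y e).smulRight (g y e)

theorem spaceForm_apply (g : E → E →L[ℝ] E →L[ℝ] ℝ) (e y u w : E) :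
    spaceForm g e y u w = g y u w + g y e u * g y e w := by
  simp [spaceForm]

theorem contDiffOn_spaceForm (hg : ContDiffOn ℝ ∞ g O) : ContDiffOn ℝ ∞ (spaceForm g e) O := by
  have h1 : ContDiffOn ℝ ∞ (fun y => g y e) O := hg.clm_apply contDiffOn_const
  exact hg.add (h1.smulRight h1)

theorem spaceForm_add_smul {y : E} (hs : ∀ u w, g y u w = g y w u) (hee : g y e e = -1) (u : E)
    (a b : ℝ) : spaceForm g e y (a • e + b • u) (a • e + b • u) = b ^ 2 * spaceForm g e y u u := by
  simp only [spaceForm_apply, map_add, map_smul, add_apply, smul_apply, smul_eq_mul, hee, hs u e]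
  ring

theorem exists_ray_spaceForm_bound (hO : IsOpen O) (hp : p ∈ O) (hB : ContDiffOn ℝ ∞ B O)
    (hg : ContDiffOn ℝ ∞ g O) {τ : E → ℝ} (hτ : ∀ y ∈ O, HasFDerivAt τ (-g y e) y) :
    ∃ C > 0, ∃ δ > 0, ∀ (r : ℝ) (x v : ℝ → E), r ≤ 1 → r < δ → IsShortRay B g e O r x v →
      (∀ s ∈ Icc (0 : ℝ) 1, ‖x s - p‖ ≤ r) →
      |spaceForm g e ((1 / 2 : ℝ) • (x 1 + x 0)) (x 1 - x 0) (x 1 - x 0)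
        - (τ (x 1) - τ (x 0)) ^ 2| ≤ C * r ^ 4 := by
  have hge : ContDiffOn ℝ ∞ (fun y => -g y e) O := (hg.clm_apply contDiffOn_const).neg
  have hτs : ContDiffOn ℝ ∞ τ O := by
    rw [contDiffOn_infty_iff_fderiv_of_isOpen hO]
    exact ⟨fun y hy => (hτ y hy).differentiableAt.differentiableWithinAt,
      hge.congr fun y hy => (hτ y hy).fderiv⟩
  obtain ⟨C₁, hC₁, δ₁, hδ₁, hb₁⟩ := exists_geodesic_midpoint_bound hO hp hB (contDiffOn_id (E := E))
  obtain ⟨C₂, hC₂, δ₂, hδ₂, hb₂⟩ := exists_geodesic_midpoint_bound hO hp hB hτs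
  obtain ⟨K, hK, δ₃, hδ₃, hb₃⟩ := (((contDiffOn_spaceForm (e := e) hg).contDiffAt
    (hO.mem_nhds hp)).of_le (m := 1) (by norm_cast)).exists_lipschitz_bound
  obtain ⟨L, hL, δ₄, hδ₄, hb₄⟩ := ((hge.contDiffAt
    (hO.mem_nhds hp)).of_le (m := 1) (by norm_cast)).exists_lipschitz_bound
  refine ⟨K * C₁ + 2 * K * C₁ + C₂ * (2 * L + C₂), by positivity, min (min δ₁ δ₂) (min δ₃ δ₄),
    by positivity, ?_⟩
  intro r x v hr1 hrδ hx hxp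
  have hh : (1 / 2 : ℝ) ∈ Icc (0 : ℝ) 1 := by constructor <;> norm_num
  have h0 : (0 : ℝ) ∈ Icc (0 : ℝ) 1 := left_mem_Icc.2 zero_le_one
  have h1 : (1 : ℝ) ∈ Icc (0 : ℝ) 1 := right_mem_Icc.2 zero_le_one
  have hr : 0 ≤ r := (norm_nonneg _).trans (hx.bound 0 h0)
  have hmem : ∀ s ∈ Icc (0 : ℝ) 1, ∀ d, min (min δ₁ δ₂) (min δ₃ δ₄) ≤ d → x s ∈ ball p d :=
    fun s hs d hd => by
    rw [mem_ball, dist_eq_norm]; exact (hxp s hs).trans_lt (hrδ.trans_le hd)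
  obtain ⟨c1, c2⟩ := hb₁ r _ x v Subset.rfl hx.geodesic fun s hs =>
    ⟨hmem s hs δ₁ (by simp), hx.bound s hs⟩
  have c3 := (hb₂ r _ x v Subset.rfl hx.geodesic fun s hs =>
    ⟨hmem s hs δ₂ (by simp), hx.bound s hs⟩).1
  simp only [id_eq, fderiv_id, ContinuousLinearMap.id_apply] at c1
  rw [(hτ _ (hx.mem _ hh)).fderiv] at c3
  set m := (1 / 2 : ℝ) • (x 1 + x 0) with hm
  set w := v (1 / 2) with hw
  set y := x (1 / 2) with hy
  have hmball : m ∈ ball p δ₃ := by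
    have := (convex_ball p δ₃) (hmem 1 h1 δ₃ (by simp)) (hmem 0 h0 δ₃ (by simp))
      (by norm_num : (0 : ℝ) ≤ 1 / 2) (by norm_num : (0 : ℝ) ≤ 1 / 2) (by norm_num)
    rwa [← smul_add] at this
  have hyball : y ∈ ball p δ₃ := hmem _ hh δ₃ (by simp)
  have hmy : ‖m - y‖ ≤ C₁ * r ^ 2 := by
    have e1 : m - y = (1 / 2 : ℝ) • (x 1 + x 0 - (2 : ℝ) • y) := by
      rw [hm, smul_sub, smul_smul]; norm_num
    rw [e1, norm_smul]
    norm_num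
    have := norm_nonneg (x 1 + x 0 - (2 : ℝ) • y)
    linarith
  have hform := abs_form_sub_form_le (κ := K * (C₁ * r ^ 2)) (b' := spaceForm g e m)
    (b := spaceForm g e y)
    (((hb₃ m hmball).2 y hyball).trans (by gcongr)) (hb₃ y hyball).1 (hx.norm_sub_le h1 h0)
    (hx.bound _ hh) c1
  have hnull : spaceForm g e y w w = (-g y e w) ^ 2 := by
    rw [spaceForm_apply, hx.null _ hh]; ring
  have hA : |-g y e w| ≤ L * r :=
    (ContinuousLinearMap.le_of_opNorm_le_of_le _ ((hb₄ y (hmem _ hh δ₄ (by simp))).1)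
      (hx.bound _ hh))
  rw [Real.norm_eq_abs, neg_apply] at c3
  set T := τ (x 1) - τ (x 0) with hT
  set A := -g y e w with hAd
  have hsq : |A ^ 2 - T ^ 2| ≤ C₂ * r ^ 3 * (2 * L * r + C₂ * r ^ 3) := by
    have e2 : A ^ 2 - T ^ 2 = -((T - A) * (2 * A + (T - A))) := by ring
    rw [e2, abs_neg, abs_mul]
    refine mul_le_mul c3 ?_ (abs_nonneg _) (by positivity)
    refine (abs_add_le _ _).trans (add_le_add ?_ c3)
    rw [abs_mul, abs_two]
    linarith
  rw [hnull] at hform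
  have e3 : spaceForm g e m (x 1 - x 0) (x 1 - x 0) - T ^ 2 =
    (spaceForm g e m (x 1 - x 0) (x 1 - x 0) - A ^ 2) + (A ^ 2 - T ^ 2) := by ring
  rw [e3]
  refine (abs_add_le _ _).trans ((add_le_add hform hsq).trans ?_)
  have r3 : r ^ 6 ≤ r ^ 4 := pow_le_pow_of_le_one hr hr1 (by norm_num)
  have : C₂ * C₂ * r ^ 6 ≤ C₂ * C₂ * r ^ 4 := by gcongr
  nlinarith

set_option maxHeartbeats 800000 in
/-- The metric for which the radar time is consistent is invariant along `e`: vectors orthogonal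
to `e`. -/
theorem fderiv_spaceForm_eq_zero_of_orthogonal (hO : IsOpen O) (hp : p ∈ O)
    (hB : ContDiffOn ℝ ∞ B O)
    (hg : ContDiffOn ℝ ∞ g O) (hs : ∀ y ∈ O, ∀ u w, g y u w = g y w u)
    (hee : ∀ y ∈ O, g y e e = -1) {τ : E → ℝ} (hτ : ∀ y ∈ O, HasFDerivAt τ (-g y e) y)
    (hline : ∀ᶠ t : ℝ in 𝓝 0, τ (p + t • e) = τ p + t)
    (hray : ∃ C > 0, ∀ᶠ q in 𝓝 p, (∀ t : ℝ, q ≠ p + t • e) →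
      IsShortRadarTime B g e O τ p (C * ‖q - p‖) q) {w : E} (hw : g p e w = 0)
    (hww : 0 < g p w w) :
    fderiv ℝ (fun y => spaceForm g e y w w) p e = 0 := by
  obtain ⟨C, hC, hray⟩ := hray
  obtain ⟨K, hK, δ, hδ, hb⟩ := exists_ray_spaceForm_bound (e := e) hO hp hB hg hτ
  have hw0 : 0 < ‖w‖ := by
    rw [norm_pos_iff]; rintro rfl; simp at hww
  have he : 0 < ‖e‖ := by
    have := hee p hp
    rw [norm_pos_iff]; rintro rfl; simp at this
  set f : E → ℝ := fun y => spaceForm g e y w w with hf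
  have hfs : ContDiffOn ℝ ∞ f O :=
    ((contDiffOn_spaceForm hg).clm_apply contDiffOn_const).clm_apply contDiffOn_const
  have hfd : HasStrictFDerivAt f (fderiv ℝ f p) p :=
    (hfs.contDiffAt (hO.mem_nhds hp)).hasStrictFDerivAt (by simp)
  have hfp : f p = g p w w := by rw [hf]; simp [spaceForm_apply, hw]
  have hn : Tendsto (fun ε : ℝ => p + ε • w) (𝓝[>] 0) (𝓝 p) := by
    have : Continuous fun ε : ℝ => p + ε • w := by fun_prop
    have h2 := this.tendsto 0
    rw [zero_smul, add_zero] at h2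
    exact h2.mono_left nhdsWithin_le_nhds
  have hsmall : ∀ k : ℝ, 0 < k → ∀ A : ℝ, ∀ᶠ ε : ℝ in 𝓝[>] 0, A * ε < k := fun k hk A => by
    have : Continuous fun ε : ℝ => A * ε := by fun_prop
    have h2 := this.tendsto 0
    rw [mul_zero] at h2
    exact (h2.mono_left nhdsWithin_le_nhds).eventually_lt_const hk
  obtain ⟨δ', hδ', hl⟩ := Metric.eventually_nhds_iff.1 hline
  set ρ := (C + 1) * ‖w‖ with hρ
  have hρ0 : 0 < ρ := by positivity
  obtain ⟨c, hc0, hc⟩ : ∃ c : ℝ, 0 < c ∧ c ^ 2 ≤ f p / 4 := by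
    refine ⟨min 1 (f p / 4), lt_min one_pos (by rw [hfp]; positivity), ?_⟩
    have h1 : min 1 (f p / 4) ≤ 1 := min_le_left _ _
    have h2 : min 1 (f p / 4) ≤ f p / 4 := min_le_right _ _
    have h3 : 0 < min 1 (f p / 4) := lt_min one_pos (by rw [hfp]; positivity)
    nlinarith
  have main : ∀ η > 0, |fderiv ℝ f p e| ≤ η * (1 + ‖e‖) := by
    intro η hη
    have hst := hfd.isLittleO
    rw [Asymptotics.isLittleO_iff] at hst
    have hst' := hst hη
    rw [nhds_prod_eq] at hst'
    obtain ⟨s, hsn, hst2⟩ := (eventually_prod_self_iff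
      (r := fun a b => ‖f a - f b - fderiv ℝ f p (a - b)‖ ≤ η * ‖a - b‖)).1 hst'
    have hpos : ∀ᶠ y in 𝓝 p, f p / 2 < f y :=
      hfd.continuousAt.eventually_const_lt (by rw [hfp]; linarith)
    obtain ⟨δ₁, hδ₁, hball⟩ := Metric.mem_nhds_iff.1 (inter_mem (inter_mem hsn hpos) (hO.mem_nhds hp))
    have hex := (((hn.eventually hray).and (hsmall 1 one_pos ρ)).and ((hsmall δ hδ ρ).and
      (hsmall δ₁ hδ₁ ρ))).and (((hsmall (δ' * ‖e‖) (by positivity) ρ).and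
      (hsmall (c ^ 2) (by positivity) (K * ρ ^ 4))).and
        ((hsmall (η * c) (by positivity) (2 * K * ρ ^ 4)).and
      ((hsmall 1 one_pos 1).and self_mem_nhdsWithin)))
    obtain ⟨ε, ⟨⟨hr, s1⟩, s2, s3⟩, ⟨s4, s5⟩, s6, s7, hε⟩ := hex.exists
    rw [one_mul] at s7
    have hoff : ∀ t : ℝ, p + ε • w ≠ p + t • e := by
      intro t ht
      have h1 : ε • w = t • e := add_left_cancel ht
      have h2 := congrArg (g p e) h1
      rw [map_smul, map_smul, hw, hee p hp] at h2
      have h3 : t = 0 := by simpa using h2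
      rw [h3, zero_smul, smul_eq_zero] at h1
      rcases h1 with h1 | h1
      · exact hε.ne' h1
      · rw [h1, norm_zero] at hw0; exact lt_irrefl _ hw0
    obtain ⟨t₁, t₂, x₁, v₁, x₂, v₂, hx₁, hx₂, e1, e2, e3, e4, hτq⟩ := hr hoff
    have m0 : (0 : ℝ) ∈ Icc (0 : ℝ) 1 := left_mem_Icc.2 zero_le_one
    have m1 : (1 : ℝ) ∈ Icc (0 : ℝ) 1 := right_mem_Icc.2 zero_le_one
    have hz : ‖p + ε • w - p‖ = ε * ‖w‖ := by
      rw [add_sub_cancel_left, norm_smul, Real.norm_eq_abs, abs_of_pos hε]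
    rw [hz] at hx₁ hx₂
    have hCρ : C * (ε * ‖w‖) ≤ ρ * ε := by rw [hρ]; nlinarith
    have hmono : ∀ x v, IsShortRay B g e O (C * (ε * ‖w‖)) x v →
        IsShortRay B g e O (ρ * ε) x v :=
      fun x v h => ⟨h.geodesic, h.mem, fun s hs => (h.bound s hs).trans hCρ, h.null, h.future⟩
    have hx₁p : ∀ s ∈ Icc (0 : ℝ) 1, ‖x₁ s - p‖ ≤ ρ * ε := fun s hs => by
      calc ‖x₁ s - p‖ = ‖(x₁ s - x₁ 1) + (p + ε • w - p)‖ := by rw [e2]; congr 1; abel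
        _ ≤ ‖x₁ s - x₁ 1‖ + ‖p + ε • w - p‖ := norm_add_le _ _
        _ ≤ C * (ε * ‖w‖) + ε * ‖w‖ := by rw [hz]; gcongr; exact hx₁.norm_sub_le hs m1
        _ = ρ * ε := by rw [hρ]; ring
    have hx₂p : ∀ s ∈ Icc (0 : ℝ) 1, ‖x₂ s - p‖ ≤ ρ * ε := fun s hs => by
      calc ‖x₂ s - p‖ = ‖(x₂ s - x₂ 0) + (p + ε • w - p)‖ := by rw [e3]; congr 1; abel
        _ ≤ ‖x₂ s - x₂ 0‖ + ‖p + ε • w - p‖ := norm_add_le _ _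
        _ ≤ C * (ε * ‖w‖) + ε * ‖w‖ := by rw [hz]; gcongr; exact hx₂.norm_sub_le hs m0
        _ = ρ * ε := by rw [hρ]; ring
    have hlt : ∀ t : ℝ, ‖p + t • e - p‖ ≤ ρ * ε → τ (p + t • e) = τ p + t := fun t ht => by
      refine hl ?_
      rw [dist_zero_right]
      rw [add_sub_cancel_left, norm_smul] at ht
      exact lt_of_mul_lt_mul_right (ht.trans_lt s4) he.le
    have hτ₁ := hlt t₁ (by rw [← e1]; exact hx₁p 0 m0)
    have hτ₂ := hlt t₂ (by rw [← e4]; exact hx₂p 1 m1)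
    have b1 := hb _ _ _ s1.le s2 (hmono _ _ hx₁) hx₁p
    have b2 := hb _ _ _ s1.le s2 (hmono _ _ hx₂) hx₂p
    set m₁ := (1 / 2 : ℝ) • (x₁ 1 + x₁ 0) with hm₁
    set m₂ := (1 / 2 : ℝ) • (x₂ 1 + x₂ 0) with hm₂
    set T := (t₂ - t₁) / 2 with hT
    have hballs : ∀ x : ℝ → E, (∀ s ∈ Icc (0 : ℝ) 1, ‖x s - p‖ ≤ ρ * ε) →
        (1 / 2 : ℝ) • (x 1 + x 0) ∈ ball p δ₁ := fun x hx => by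
      have hh : ∀ s ∈ Icc (0 : ℝ) 1, x s ∈ ball p δ₁ := fun s hs => by
        rw [mem_ball, dist_eq_norm]; exact (hx s hs).trans_lt s3
      have := (convex_ball p δ₁) (hh 1 m1) (hh 0 m0)
        (by norm_num : (0 : ℝ) ≤ 1 / 2) (by norm_num : (0 : ℝ) ≤ 1 / 2) (by norm_num)
      rwa [← smul_add] at this
    have k1 := hball (hballs x₁ hx₁p)
    have k2 := hball (hballs x₂ hx₂p)
    rw [← hm₁] at k1
    rw [← hm₂] at k2
    have d1 : x₁ 1 - x₁ 0 = (-t₁) • e + ε • w := by rw [e1, e2, neg_smul]; abel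
    have d2 : x₂ 1 - x₂ 0 = t₂ • e + (-ε) • w := by rw [e3, e4, neg_smul]; abel
    rw [d1, spaceForm_add_smul (hs _ k1.2) (hee _ k1.2), e1, e2, hτ₁,
      show τ (p + ε • w) - (τ p + t₁) = T by rw [hT]; linarith] at b1
    rw [d2, spaceForm_add_smul (hs _ k2.2) (hee _ k2.2), e3, e4, hτ₂,
      show τ p + t₂ - τ (p + ε • w) = T by rw [hT]; linarith, neg_sq] at b2
    have b1' : |ε ^ 2 * f m₁ - T ^ 2| ≤ K * (ρ * ε) ^ 4 := b1
    have b2' : |ε ^ 2 * f m₂ - T ^ 2| ≤ K * (ρ * ε) ^ 4 := b2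
    have hεp : 0 < ε ^ 2 := by positivity
    have hTlow : c * ε ≤ |T| := by
      have h1 : f p / 2 < f m₁ := k1.1.2
      have h2 := (abs_le.1 b1').2
      have h3 : K * (ρ * ε) ^ 4 ≤ c ^ 2 * ε ^ 2 := by
        have h4 := mul_le_mul_of_nonneg_right s5.le (by positivity : (0 : ℝ) ≤ ε ^ 2 * ε)
        have h5 : c ^ 2 * (ε ^ 2 * ε) ≤ c ^ 2 * (ε ^ 2 * 1) := by gcongr
        calc K * (ρ * ε) ^ 4 = K * ρ ^ 4 * ε * (ε ^ 2 * ε) := by ring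
          _ ≤ _ := h4
          _ ≤ _ := h5
          _ = _ := by ring
      have h6 : ε ^ 2 * (f p / 2) ≤ ε ^ 2 * f m₁ := by gcongr
      have h7 : ε ^ 2 * c ^ 2 ≤ ε ^ 2 * (f p / 4) := by gcongr
      have h8 : (c * ε) ^ 2 ≤ T ^ 2 := by linarith
      exact (le_abs_self _).trans (sq_le_sq.1 h8)
    have hdf : |f m₂ - f m₁| ≤ 2 * K * ρ ^ 4 * ε ^ 2 := by
      have h1 : ε ^ 2 * |f m₂ - f m₁| ≤ ε ^ 2 * (2 * K * ρ ^ 4 * ε ^ 2) := by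
        calc ε ^ 2 * |f m₂ - f m₁| = |ε ^ 2 * f m₂ - ε ^ 2 * f m₁| := by
              rw [← mul_sub, abs_mul, abs_of_pos hεp]
          _ = |(ε ^ 2 * f m₂ - T ^ 2) - (ε ^ 2 * f m₁ - T ^ 2)| := by ring_nf
          _ ≤ |ε ^ 2 * f m₂ - T ^ 2| + |ε ^ 2 * f m₁ - T ^ 2| := abs_sub _ _
          _ ≤ K * (ρ * ε) ^ 4 + K * (ρ * ε) ^ 4 := add_le_add b2' b1'
          _ = _ := by ring
      exact le_of_mul_le_mul_left h1 hεp
    have hmm : m₂ - m₁ = T • e := by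
      rw [hm₁, hm₂, e1, e2, e3, e4, hT, ← smul_sub]
      have : p + t₂ • e + (p + ε • w) - (p + ε • w + (p + t₁ • e)) = (t₂ - t₁) • e := by
        rw [sub_smul]; abel
      rw [this, smul_smul]
      congr 1; ring
    have hS := hst2 m₂ k2.1.1 m₁ k1.1.1
    rw [hmm, map_smul, smul_eq_mul, norm_smul, Real.norm_eq_abs, Real.norm_eq_abs] at hS
    have hT0 : 0 < |T| := (by positivity : 0 < c * ε).trans_le hTlow
    have h1 : |T| * |fderiv ℝ f p e| ≤ 2 * K * ρ ^ 4 * ε ^ 2 + η * (|T| * ‖e‖) := by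
      rw [← abs_mul]
      have : T * fderiv ℝ f p e = (f m₂ - f m₁) - (f m₂ - f m₁ - T * fderiv ℝ f p e) := by ring
      rw [this]
      exact (abs_sub _ _).trans (add_le_add hdf hS)
    have h2 : 2 * K * ρ ^ 4 * ε ^ 2 ≤ η * |T| := by
      calc 2 * K * ρ ^ 4 * ε ^ 2 = 2 * K * ρ ^ 4 * ε * ε := by ring
        _ ≤ η * c * ε := by gcongr
        _ = η * (c * ε) := by ring
        _ ≤ _ := by gcongr
    have h3 : |T| * |fderiv ℝ f p e| ≤ |T| * (η * (1 + ‖e‖)) := by linarith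
    exact le_of_mul_le_mul_left h3 hT0
  have h0 : |fderiv ℝ f p e| ≤ 0 := by
    by_contra hne
    rw [not_le] at hne
    have := main (|fderiv ℝ f p e| / (2 * (1 + ‖e‖))) (by positivity)
    have h2 : |fderiv ℝ f p e| / (2 * (1 + ‖e‖)) * (1 + ‖e‖) = |fderiv ℝ f p e| / 2 := by
      field_simp
    rw [h2] at this
    linarith
  exact abs_nonpos_iff.1 h0

/-- If the radar time is consistent, the conformal metric is invariant along `e`, and the one-form
`g(e, ·)` is closed. -/
theorem invariant_and_closed_of_isShortRadarTime (hO : IsOpen O) (hB : ContDiffOn ℝ ∞ B O)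
    (hg : ContDiffOn ℝ ∞ g O) (hs : ∀ y ∈ O, ∀ u w, g y u w = g y w u)
    (hee : ∀ y ∈ O, g y e e = -1) (hpos : ∀ y ∈ O, ∀ w, w ≠ 0 → g y e w = 0 → 0 < g y w w)
    {τ : E → ℝ} (hline : ∀ p ∈ O, ∀ᶠ t : ℝ in 𝓝 0, τ (p + t • e) = τ p + t)
    (hray : ∀ p ∈ O, ∃ C > 0, ∀ᶠ q in 𝓝 p, (∀ t : ℝ, q ≠ p + t • e) →
      IsShortRadarTime B g e O τ p (C * ‖q - p‖) q) (hp : p ∈ O) :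
    fderiv ℝ g p e = 0 ∧ ∀ u w, fderiv ℝ g p u e w = fderiv ℝ g p w e u := by
  have hτ : ∀ y ∈ O, HasFDerivAt τ (-g y e) y := fun y hy =>
    hasFDerivAt_of_isShortRadarTime hO hy hB hg (hs y hy) (hee y hy) (hline y hy) (hray y hy)
  have hgd : HasFDerivAt g (fderiv ℝ g p) p :=
    ((hg.contDiffAt (hO.mem_nhds hp)).differentiableAt (by simp)).hasFDerivAt
  have hθ : HasFDerivAt (fun y => g y e) ((fderiv ℝ g p).flip e) p := by
    have := hgd.clm_apply (hasFDerivAt_const e p)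
    simpa using this
  have hclosed : ∀ u w, fderiv ℝ g p u e w = fderiv ℝ g p w e u := by
    intro u w
    have := second_derivative_symmetric_of_eventually (f := τ) (f' := fun y => -g y e)
      (f'' := -(fderiv ℝ g p).flip e) (x := p)
      (by filter_upwards [hO.mem_nhds hp] with y hy using hτ y hy) hθ.neg u w
    simpa using this
  have hdee : ∀ u, fderiv ℝ g p u e e = 0 := by
    intro u
    have h1 : HasFDerivAt (fun y => g y e e) (((fderiv ℝ g p).flip e).flip e) p := by
      have := hθ.clm_apply (hasFDerivAt_const e p)
      simpa using this
    have h2 : (fun y => g y e e) =ᶠ[𝓝 p] fun _ => (-1 : ℝ) := by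
      filter_upwards [hO.mem_nhds hp] with y hy using hee y hy
    have h3 := h1.unique ((hasFDerivAt_const (-1 : ℝ) p).congr_of_eventuallyEq h2)
    simpa using congrArg (fun L => L u) h3
  have hde : ∀ w, fderiv ℝ g p e e w = 0 := fun w => by rw [hclosed, hdee]
  have hquad : ∀ w, fderiv ℝ g p e w w = 0 := by
    intro w
    set w' := w + (g p e w) • e with hw'
    have hsf : fderiv ℝ (fun y => spaceForm g e y w' w') p e = 0 := by
      by_cases h0 : w' = 0
      · simp [h0]
      · have h1 : g p e w' = 0 := by rw [hw', map_add, map_smul, hee p hp]; simp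
        exact fderiv_spaceForm_eq_zero_of_orthogonal hO hp hB hg hs hee hτ (hline p hp)
          (hray p hp) h1 (hpos p hp w' h0 h1)
    have hev : (fun y => spaceForm g e y w' w') =ᶠ[𝓝 p]
        fun y => g y w w + g y e w * g y e w := by
      filter_upwards [hO.mem_nhds hp] with y hy
      have := spaceForm_add_smul (hs y hy) (hee y hy) w (g p e w) 1
      rw [one_smul, add_comm, one_pow, one_mul] at this
      rw [hw', this, spaceForm_apply]
    have h2 : HasFDerivAt (fun y => g y w) ((fderiv ℝ g p).flip w) p := by
      have := hgd.clm_apply (hasFDerivAt_const w p)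
      simpa using this
    have h3 : HasFDerivAt (fun y => g y w w) (((fderiv ℝ g p).flip w).flip w) p := by
      have := h2.clm_apply (hasFDerivAt_const w p)
      simpa using this
    have h4 : HasFDerivAt (fun y => g y e w) (((fderiv ℝ g p).flip e).flip w) p := by
      have := hθ.clm_apply (hasFDerivAt_const w p)
      simpa using this
    have h5 : HasFDerivAt (fun y => g y w w + g y e w * g y e w) _ p := h3.add (h4.mul h4)
    rw [hev.fderiv_eq, h5.fderiv] at hsf
    simpa [hde] using hsf
  refine ⟨?_, hclosed⟩
  have hsd : ∀ u w, fderiv ℝ g p e u w = fderiv ℝ g p e w u := by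
    intro u w
    have h : ∀ a b : E, HasFDerivAt (fun y => g y a b) (((fderiv ℝ g p).flip a).flip b) p := by
      intro a b
      have h1 := (hgd.clm_apply (hasFDerivAt_const a p)).clm_apply (hasFDerivAt_const b p)
      simpa using h1
    have hev : (fun y => g y u w) =ᶠ[𝓝 p] fun y => g y w u := by
      filter_upwards [hO.mem_nhds hp] with y hy using hs y hy u w
    have := (h u w).unique ((h w u).congr_of_eventuallyEq hev)
    simpa using congrArg (fun L => L e) this
  ext u w
  have h1 := hquad (u + w)
  simp only [map_add, add_apply, hquad, zero_add, add_zero] at h1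
  have h2 := hsd u w
  simp only [zero_apply]
  linarith

end

section

section Conformal

variable {E : Type*} [NormedAddCommGroup E] [NormedSpace ℝ E]
variable {G : E → E →L[ℝ] E →L[ℝ] ℝ} {e : E} {O : Set E} {p : E}

/-- The metric conformal to `G` for which `e` is a unit vector. -/
def unitMetric (G : E → E →L[ℝ] E →L[ℝ] ℝ) (e y : E) : E →L[ℝ] E →L[ℝ] ℝ :=
  (-G y e e)⁻¹ • G y

theorem unitMetric_apply (G : E → E →L[ℝ] E →L[ℝ] ℝ) (e y u w : E) :
    unitMetric G e y u w = (-G y e e)⁻¹ * G y u w := rfl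

theorem contDiffOn_unitMetric (hG : ContDiffOn ℝ ∞ G O) (he : ∀ y ∈ O, G y e e < 0) :
    ContDiffOn ℝ ∞ (unitMetric G e) O := by
  have h1 : ContDiffOn ℝ ∞ (fun y => -G y e e) O :=
    ((hG.clm_apply contDiffOn_const).clm_apply contDiffOn_const).neg
  exact (h1.inv fun y hy => by have := he y hy; linarith).smul hG

theorem unitMetric_self {y : E} (he : G y e e < 0) : unitMetric G e y e e = -1 := by
  rw [unitMetric_apply, inv_neg, neg_mul, inv_mul_cancel₀ he.ne]

theorem eq_smul_unitMetric {y : E} (he : G y e e < 0) : G y = (-G y e e) • unitMetric G e y := by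
  rw [unitMetric, smul_smul, mul_inv_cancel₀ (by linarith), one_smul]

theorem fderiv_eq_unitMetric (hO : IsOpen O) (hG : ContDiffOn ℝ ∞ G O)
    (he : ∀ y ∈ O, G y e e < 0) (hp : p ∈ O) (u a b : E) :
    fderiv ℝ G p u a b = -fderiv ℝ G p u e e * unitMetric G e p a b +
      (-G p e e) * fderiv ℝ (unitMetric G e) p u a b := by
  have hd : HasFDerivAt G (fderiv ℝ G p) p :=
    ((hG.contDiffAt (hO.mem_nhds hp)).differentiableAt (by simp)).hasFDerivAt
  have hu : HasFDerivAt (unitMetric G e) (fderiv ℝ (unitMetric G e) p) p :=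
    (((contDiffOn_unitMetric hG he).contDiffAt (hO.mem_nhds hp)).differentiableAt
      (by simp)).hasFDerivAt
  have hN : HasFDerivAt (fun y => -G y e e) (-((fderiv ℝ G p).flip e).flip e) p := by
    have h : HasFDerivAt (fun y => G y e e) (((fderiv ℝ G p).flip e).flip e) p := by
      simpa using (hd.clm_apply (hasFDerivAt_const e p)).clm_apply (hasFDerivAt_const e p)
    exact h.neg
  have hev : G =ᶠ[𝓝 p] fun y => (-G y e e) • unitMetric G e y := by
    filter_upwards [hO.mem_nhds hp] with y hy using eq_smul_unitMetric (he y hy)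
  have h := hd.unique ((hN.smul hu).congr_of_eventuallyEq hev)
  have := congrArg (fun L => L u a b) h
  simp only [add_apply, smul_apply, ContinuousLinearMap.smulRight_apply, neg_apply,
    ContinuousLinearMap.flip_apply, smul_eq_mul] at this
  rw [this]
  ring

end Conformal

theorem IsGeodesicCurve.reverse {E : Type*} [NormedAddCommGroup E] [NormedSpace ℝ E]
    {B : E → E →L[ℝ] E →L[ℝ] E} {J : Set ℝ} {c v : ℝ → E} (h : IsGeodesicCurve B J c v)
    {J' : Set ℝ} (hJ : ∀ s ∈ J', 1 - s ∈ J) :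
    IsGeodesicCurve B J' (fun s => c (1 - s)) (fun s => -v (1 - s)) := by
  have dm : ∀ s : ℝ, HasDerivAt (fun s : ℝ => 1 - s) (-1) s := fun s =>
    (hasDerivAt_id s).const_sub _
  refine ⟨fun s hs => ?_, fun s hs => ?_⟩
  · have := (h.hasDerivAt _ (hJ s hs)).scomp s (dm s)
    rw [neg_one_smul] at this
    exact this
  · have := ((h.hasDerivAt_velocity _ (hJ s hs)).scomp s (dm s)).neg
    rw [neg_one_smul, neg_neg] at this
    refine this.congr_deriv ?_
    simp

/-- From every point near `p` off the timelike line `p + ℝ e`, short null geodesics lead to that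
line in both directions of time. -/
theorem exists_null_rays {E : Type*} [NormedAddCommGroup E] [NormedSpace ℝ E]
    [FiniteDimensional ℝ E] {G : E → E →L[ℝ] E →L[ℝ] ℝ}
    {O : Set E} {p e : E} (hO : IsOpen O) (hp : p ∈ O) (hG : ContDiffOn ℝ ∞ G O)
    (hL : ∀ y ∈ O, IsLorentzForm (G y)) (he : G p e e < 0) :
    ∃ C > 0, ∀ᶠ q in 𝓝 p, (∀ t : ℝ, q ≠ p + t • e) →
      (∃ t : ℝ, ∃ x v, IsNullRay G e O (Ioo (-(1 / 2)) (3 / 2)) x v ∧ x 0 = q ∧ x 1 = p + t • e ∧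
        ∀ s ∈ Icc (0 : ℝ) 1, ‖v s‖ ≤ C * ‖q - p‖) ∧
      (∃ t : ℝ, ∃ x v, IsNullRay G e O (Ioo (-(1 / 2)) (3 / 2)) x v ∧ x 0 = p + t • e ∧ x 1 = q ∧
        ∀ s ∈ Icc (0 : ℝ) 1, ‖v s‖ ≤ C * ‖q - p‖) := by
  obtain ⟨C₁, hC₁, U₁, hU₁, h₁⟩ := exists_null_geodesic_to_line hO hp hG hL he (hO.mem_nhds hp)
  obtain ⟨C₂, hC₂, U₂, hU₂, h₂⟩ := exists_null_geodesic_to_line (e := -e) hO hp hG hL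
    (by simpa using he) (hO.mem_nhds hp)
  have hIcc : Icc (0 : ℝ) 1 ⊆ Ioo (-(1 / 2)) (3 / 2) := fun s hs =>
    ⟨by linarith [hs.1], by linarith [hs.2]⟩
  have hrev : ∀ s ∈ Ioo (-(1 / 2) : ℝ) (3 / 2), 1 - s ∈ Ioo (-(1 / 2) : ℝ) (3 / 2) := fun s hs =>
    ⟨by linarith [hs.2], by linarith [hs.1]⟩
  refine ⟨max C₁ C₂, lt_max_of_lt_left hC₁, ?_⟩
  filter_upwards [hU₁, hU₂] with q hq₁ hq₂ hoff
  constructor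
  · obtain ⟨t, c, v, c0, c1, hc, hg, -, hb⟩ := h₁ q hq₁ hoff
    refine ⟨t, c, v, ⟨isOpen_Ioo, hIcc, fun s hs => (hb s hs).1, hc, hg, fun s hs => (hb s hs).2.2.1,
      fun s hs => (hb s hs).2.2.2⟩, c0, c1, fun s hs => (hb s (hIcc hs)).2.1.trans ?_⟩
    exact mul_le_mul_of_nonneg_right (le_max_left _ _) (norm_nonneg _)
  · obtain ⟨t, c, v, c0, c1, hc, hg, -, hb⟩ := h₂ q hq₂ fun t ht => hoff (-t) (by rw [ht]; simp)
    refine ⟨-t, fun s => c (1 - s), fun s => -v (1 - s), ⟨isOpen_Ioo, hIcc,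
      fun s hs => (hb _ (hrev s hs)).1, hc.comp (by fun_prop) hrev, hg.reverse hrev,
      fun s hs => ?_, fun s hs => ?_⟩, ?_, ?_, fun s hs => ?_⟩
    · simpa using (hb _ (hrev s hs)).2.2.1
    · simpa using (hb _ (hrev s hs)).2.2.2
    · simpa using c1
    · simpa using c0
    · rw [norm_neg]
      exact (hb _ (hrev s (hIcc hs))).2.1.trans
        (mul_le_mul_of_nonneg_right (le_max_right _ _) (norm_nonneg _))

namespace Spacetime

variable {M : Type*} [TopologicalSpace M] [ChartedSpace (EuclideanSpace ℝ (Fin 4)) M]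
  [IsManifold (𝓡 4) ∞ M]
variable {S : Spacetime M} {V : (x : M) → TangentSpace (𝓡 4) x} {φ φ' : OpenPartialHomeomorph M E4}

theorem IsFlowBox.covDeriv_eq (h : IsFlowBox V φ) {y : E4} (hy : y ∈ φ.target) (u w : E4) :
    S.covDeriv V φ y u w = chrForm (S.metricCLM φ) y u e0 w := by
  have hev : fieldInChart V φ =ᶠ[𝓝 y] fun _ => e0 := by
    filter_upwards [φ.open_target.mem_nhds hy] with z hz using h.field z hz
  rw [S.covDeriv_eq h.mem hy, hev.fderiv_eq, h.field y hy]
  simp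

theorem IsFlowBox.metric_timelike (h : IsFlowBox V φ) (hV : S.IsObserverField V) {y : E4}
    (hy : y ∈ φ.target) : S.metricCLM φ y e0 e0 < 0 := by
  have := hV.timelike (φ.symm y)
  rwa [S.g_eq_metricCLM h.mem (φ.map_target hy), ← fieldInChart_eq, h.field y hy,
    φ.right_inv hy] at this

theorem differentiableAt_metricCLM (hφ : φ ∈ IsManifold.maximalAtlas (𝓡 4) ∞ M) {y : E4}
    (hy : y ∈ φ.target) : DifferentiableAt ℝ (S.metricCLM φ) y :=
  ((S.contDiffOn_metricCLM hφ).contDiffAt (φ.open_target.mem_nhds hy)).differentiableAt (by simp)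

theorem fderiv_metricCLM_symm (hφ : φ ∈ IsManifold.maximalAtlas (𝓡 4) ∞ M) {y : E4}
    (hy : y ∈ φ.target) (u a b : E4) :
    fderiv ℝ (S.metricCLM φ) y u a b = fderiv ℝ (S.metricCLM φ) y u b a := by
  have hd := (differentiableAt_metricCLM (S := S) hφ hy).hasFDerivAt
  have h : ∀ a b : E4, HasFDerivAt (fun y => S.metricCLM φ y a b)
      (((fderiv ℝ (S.metricCLM φ) y).flip a).flip b) y := fun a b => by
    simpa using (hd.clm_apply (hasFDerivAt_const a y)).clm_apply (hasFDerivAt_const b y)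
  have e : (fun y => S.metricCLM φ y a b) = fun y => S.metricCLM φ y b a :=
    funext fun y => S.metricCLM_symm y a b
  have := (h a b).unique (e ▸ h b a)
  simpa using congrArg (fun L => L u) this

theorem IsFlowBox.covDeriv_add (h : IsFlowBox V φ) {y : E4} (hy : y ∈ φ.target) (u w : E4) :
    S.covDeriv V φ y u w + S.covDeriv V φ y w u = fderiv ℝ (S.metricCLM φ) y e0 u w := by
  rw [h.covDeriv_eq hy, h.covDeriv_eq hy, chrForm_apply, chrForm_apply,
    fderiv_metricCLM_symm h.mem hy w u e0, fderiv_metricCLM_symm h.mem hy u w e0,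
    fderiv_metricCLM_symm h.mem hy e0 w u]
  ring

theorem IsFlowBox.covDeriv_sub (h : IsFlowBox V φ) {y : E4} (hy : y ∈ φ.target) (u w : E4) :
    S.covDeriv V φ y u w - S.covDeriv V φ y w u =
      fderiv ℝ (S.metricCLM φ) y u e0 w - fderiv ℝ (S.metricCLM φ) y w e0 u := by
  rw [h.covDeriv_eq hy, h.covDeriv_eq hy, chrForm_apply, chrForm_apply,
    fderiv_metricCLM_symm h.mem hy w u e0, fderiv_metricCLM_symm h.mem hy u w e0,
    fderiv_metricCLM_symm h.mem hy e0 w u]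
  ring

/-- The conformal Killing equation and irrotationality are independent of the chart. -/
theorem isConformalKilling_and_isIrrotational (hV : S.IsObserverField V)
    (h : ∀ x, ∃ χ : OpenPartialHomeomorph M E4, IsFlowBox V χ ∧ x ∈ χ.source ∧
      (∃ k : ℝ, ∀ u w, S.covDeriv V χ (χ x) u w + S.covDeriv V χ (χ x) w u =
        k * S.metricCLM χ (χ x) u w) ∧
      ∀ u w, S.metricCLM χ (χ x) e0 u = 0 → S.metricCLM χ (χ x) e0 w = 0 →
        S.covDeriv V χ (χ x) u w = S.covDeriv V χ (χ x) w u) :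
    S.IsConformalKilling V ∧ S.IsIrrotational V := by
  choose χ hχ hx hk hirr using h
  choose k hk using hk
  have ht : ∀ φ ∈ IsManifold.maximalAtlas (𝓡 4) ∞ M, ∀ y ∈ φ.target, ∀ u w : E4,
      S.covDeriv V φ y u w = S.covDeriv V (χ (φ.symm y)) (χ (φ.symm y) (φ.symm y))
        (fderiv ℝ (fun z => χ (φ.symm y) (φ.symm z)) y u)
        (fderiv ℝ (fun z => χ (φ.symm y) (φ.symm z)) y w) ∧
      S.metricCLM φ y u w = S.metricCLM (χ (φ.symm y)) (χ (φ.symm y) (φ.symm y))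
        (fderiv ℝ (fun z => χ (φ.symm y) (φ.symm z)) y u)
        (fderiv ℝ (fun z => χ (φ.symm y) (φ.symm z)) y w) := fun φ hφ y hy u w =>
    ⟨S.covDeriv_transition (hχ _).mem hφ hy (hx _) rfl hV.smooth u w,
      S.metricCLM_transition (hχ _).mem hφ hy (hx _) u w⟩
  have hf : ∀ φ ∈ IsManifold.maximalAtlas (𝓡 4) ∞ M, ∀ y ∈ φ.target,
      fderiv ℝ (fun z => χ (φ.symm y) (φ.symm z)) y (fieldInChart V φ y) = e0 :=
    fun φ hφ y hy => by
      rw [← fieldInChart_transition (hχ _).mem hφ hy (hx _) V]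
      exact (hχ _).field _ ((χ _).map_source (hx _))
  refine ⟨⟨k, fun φ hφ y hy u w => ?_⟩, fun φ hφ y hy u w hu hw => ?_⟩
  · rw [metricInChart_eq, (ht φ hφ y hy u w).1, (ht φ hφ y hy w u).1, (ht φ hφ y hy u w).2]
    exact hk _ _ _
  · rw [metricInChart_eq, (ht φ hφ y hy _ _).2, hf φ hφ y hy] at hu hw
    rw [(ht φ hφ y hy u w).1, (ht φ hφ y hy w u).1]
    exact hirr _ _ _ hu hw

end Spacetime

end

section

theorem ordConnected_line {y : E4} {O : Set E4} (hc : Convex ℝ O) :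
    {t : ℝ | y + t • e0 ∈ O}.OrdConnected := by
  refine Convex.ordConnected ?_
  intro a ha b hb k l hk hl hkl
  have := hc ha hb hk hl hkl
  simp only [smul_eq_mul, mem_ofPred_eq]
  convert this using 1
  rw [smul_add, smul_add, add_add_add_comm, ← add_smul, hkl, one_smul, add_smul, mul_smul,
    mul_smul]

namespace Spacetime

variable {M : Type*} [TopologicalSpace M] [ChartedSpace (EuclideanSpace ℝ (Fin 4)) M]
  [IsManifold (𝓡 4) ∞ M]
variable {S : Spacetime M} {V : (x : M) → TangentSpace (𝓡 4) x} {φ φ' : OpenPartialHomeomorph M E4}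

omit [IsManifold (𝓡 4) ∞ M] in
theorem IsFlowBox.isClockIn_line (h : IsFlowBox V φ) {y : E4} {O : Set E4} (hO : IsOpen O)
    (hc : Convex ℝ O) (hOt : O ⊆ φ.target) :
    IsClockIn V (fun t : ℝ => φ.symm (y + t • e0)) {t | y + t • e0 ∈ O} := by
  exact Spacetime.isClockIn_line h.mem h.field (hO.preimage (by fun_prop)) (ordConnected_line hc)
    fun t ht => hOt ht

/-- In a flow box, the radar times measured with short rays are the clock readings prescribed by
Property A. -/
theorem IsFlowBox.exists_isShortRadarTime (h : IsFlowBox V φ) (hV : S.IsObserverField V)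
    {W : Set M} {τ : M → ℝ}
    (hU : ∀ γ I, IsClockIn V γ I → MapsTo γ I W →
      ∀ t ∈ I, ∃ U, γ t ∈ U ∧ S.IsRadarNeighborhood U W γ I)
    (hz : IsZeroPointChoice V W τ)
    (hsync : ∀ γ I, IsSetClock V W τ γ I → ∀ γ' I', IsSetClock V W τ γ' I' →
        Disjoint (γ '' I) (γ' '' I') → (∀ t ∈ I', S.RadarAt W γ I (γ' t)) →
          S.Synchronous W γ I γ' I')
    {O : Set E4} (hO : IsOpen O) (hOc : Convex ℝ O) (hOt : O ⊆ φ.target)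
    (hOW : ∀ y ∈ O, φ.symm y ∈ W) {p : E4} (hp : p ∈ O) :
    (∀ᶠ t : ℝ in 𝓝 0, τ (φ.symm (p + t • e0)) = τ (φ.symm p) + t) ∧
    ∃ C > 0, ∀ᶠ q in 𝓝 p, (∀ t : ℝ, q ≠ p + t • e0) →
      IsShortRadarTime (connection (S.metricCLM φ)) (unitMetric (S.metricCLM φ) e0) e0 O
        (fun y => τ (φ.symm y)) p (C * ‖q - p‖) q := by
  have hread : ∀ y ∈ O, ∀ t : ℝ, y + t • e0 ∈ O → τ (φ.symm (y + t • e0)) = τ (φ.symm y) + t := by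
    intro y hy t ht
    obtain ⟨a, ha⟩ := hz _ _ (h.isClockIn_line (y := y) hO hOc hOt) fun t ht => hOW _ ht
    have h0 := ha 0 (by simpa using hy)
    have h1 := ha t ht
    simp only [zero_smul, add_zero, zero_add] at h0 h1
    rw [h1, h0, add_comm]
  have hset : ∀ y ∈ O, ∀ O' ⊆ O, IsOpen O' → Convex ℝ O' → IsSetClock V W τ
      (fun t : ℝ => φ.symm (y + (-τ (φ.symm y)) • e0 + t • e0))
      {t | y + (-τ (φ.symm y)) • e0 + t • e0 ∈ O'} := by
    intro y hy O' hO' ho hc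
    refine ⟨h.isClockIn_line ho hc (hO'.trans hOt), fun t ht => hOW _ (hO' ht), fun t ht => ?_⟩
    have e1 : y + (-τ (φ.symm y)) • e0 + t • e0 = y + (t - τ (φ.symm y)) • e0 := by
      rw [add_assoc, ← add_smul]; congr 2; ring
    have ht' := hO' ht
    rw [e1] at ht'
    change τ (φ.symm (y + (-τ (φ.symm y)) • e0 + t • e0)) = t
    rw [e1, hread y hy _ ht']
    ring
  refine ⟨?_, ?_⟩
  · have hcont : Tendsto (fun t : ℝ => p + t • e0) (𝓝 0) (𝓝 p) := by
      have : Continuous fun t : ℝ => p + t • e0 := by fun_prop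
      simpa using this.tendsto 0
    filter_upwards [hcont (hO.mem_nhds hp)] with t ht using hread p hp t ht
  have hG := (S.contDiffOn_metricCLM h.mem).mono hOt
  have hL : ∀ y ∈ O, IsLorentzForm (S.metricCLM φ y) := fun y hy =>
    S.isLorentzForm_metricCLM h.mem (hOt hy)
  obtain ⟨C, hC, hrays⟩ := exists_null_rays hO hp hG hL (h.metric_timelike hV (hOt hp))
  set a := τ (φ.symm p) with ha
  set γ : ℝ → M := fun t : ℝ => φ.symm (p + (-a) • e0 + t • e0) with hγ
  set I : Set ℝ := {t | p + (-a) • e0 + t • e0 ∈ O} with hI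
  have hclock : IsSetClock V W τ γ I := hset p hp O Subset.rfl hO hOc
  have hshift : ∀ t : ℝ, p + (-a) • e0 + (t + a) • e0 = p + t • e0 := fun t => by
    rw [add_assoc, ← add_smul]; congr 2; ring
  have haI : a ∈ I := by
    have := hshift 0
    rw [zero_add] at this
    simp only [hI, mem_ofPred_eq, this]
    simpa using hp
  obtain ⟨U, hUγ, hUo, hUW, hUr⟩ := hU γ I hclock.1 hclock.2.1 a haI
  have hγa : γ a = φ.symm p := by
    have := hshift 0
    rw [zero_add] at this
    simp only [hγ, this]
    simp
  rw [hγa] at hUγ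
  have hUn : φ.symm ⁻¹' U ∈ 𝓝 p :=
    (φ.symm.continuousAt (hOt hp)).preimage_mem_nhds (hUo.mem_nhds hUγ)
  refine ⟨C, hC, ?_⟩
  filter_upwards [hrays, (eventually_mem_nhds_iff.2 (inter_mem hUn (hO.mem_nhds hp)))]
    with q hq hqU hoff
  obtain ⟨⟨t₂, x₂, v₂, hx₂, x20, x21, b₂⟩, ⟨t₁, x₁, v₁, hx₁, x10, x11, b₁⟩⟩ := hq hoff
  obtain ⟨δ, hδ, hball⟩ := Metric.mem_nhds_iff.1 hqU
  have hqO : q ∈ O := (hball (mem_ball_self hδ)).2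
  have hIcc := hx₂.subset
  have m0 : (0 : ℝ) ∈ Icc (0 : ℝ) 1 := left_mem_Icc.2 zero_le_one
  have m1 : (1 : ℝ) ∈ Icc (0 : ℝ) 1 := right_mem_Icc.2 zero_le_one
  -- the clock through `q`
  set b := τ (φ.symm q) with hb
  have hclock' := hset q hqO (ball q δ) (fun y hy => (hball hy).2) isOpen_ball (convex_ball _ _)
  rw [← hb] at hclock'
  set γ' : ℝ → M := fun t : ℝ => φ.symm (q + (-b) • e0 + t • e0) with hγ'
  set I' : Set ℝ := {t | q + (-b) • e0 + t • e0 ∈ ball q δ} with hI'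
  have hoff' : ∀ t' ∈ I', γ' t' ∉ γ '' I := by
    rintro t' ht' ⟨t, ht, heq⟩
    have h1 := φ.symm.injOn (hOt ht) (hOt (hball ht').2) heq
    apply hoff (-a + t - (-b + t'))
    have h2 : q = q + (-b) • e0 + t' • e0 - (-b + t') • e0 := by
      rw [add_smul]; abel
    rw [h2, ← h1, sub_smul, add_smul (-a) t]
    abel
  have hdisj : Disjoint (γ '' I) (γ' '' I') := by
    rw [Set.disjoint_right]
    rintro _ ⟨t', ht', rfl⟩
    exact hoff' t' ht'
  have hradar : ∀ t ∈ I', S.RadarAt W γ I (γ' t) := fun t ht =>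
    hUr _ ⟨(hball ht).1, hoff' t ht⟩
  have hbq : q + (-b) • e0 + b • e0 = q := by rw [neg_smul]; abel
  have hbI' : b ∈ I' := by
    simp only [hI', mem_ofPred_eq, hbq]; exact mem_ball_self hδ
  have hγ'b : γ' b = φ.symm q := by simp only [hγ', hbq]
  obtain ⟨s₁, hs₁, s₂, hs₂, ⟨c₁, hc₁⟩, ⟨c₂, hc₂⟩, hT⟩ :=
    hsync γ I hclock γ' I' hclock' hdisj hradar b hbI'
  obtain ⟨⟨d₂, -, hd₂⟩, ⟨d₁, -, hd₁⟩⟩ := hradar b hbI'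
  rw [hγ'b] at hc₁ hc₂ hd₁ hd₂
  have hx₂' : IsNullRay (S.metricCLM φ) e0 φ.target (Ioo (-(1 / 2)) (3 / 2)) x₂ v₂ :=
    { hx₂ with mapsTo := fun s hs => hOt (hx₂.mapsTo hs) }
  have hx₁' : IsNullRay (S.metricCLM φ) e0 φ.target (Ioo (-(1 / 2)) (3 / 2)) x₁ v₁ :=
    { hx₁ with mapsTo := fun s hs => hOt (hx₁.mapsTo hs) }
  have r₂ := hx₂'.isLightRay hV h.mem h.field (W := W) fun s hs => hOW _ (hx₂.mapsTo (hIcc hs))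
  have r₁ := hx₁'.isLightRay hV h.mem h.field (W := W) fun s hs => hOW _ (hx₁.mapsTo (hIcc hs))
  have g₂ : γ (t₂ + a) = φ.symm (x₂ 1) := by simp only [hγ, hshift, x21]
  have g₁ : γ (t₁ + a) = φ.symm (x₁ 0) := by simp only [hγ, hshift, x10]
  have i₂ : t₂ + a ∈ I := by
    simp only [hI, mem_ofPred_eq, hshift, ← x21]; exact hx₂.mapsTo (hIcc m1)
  have i₁ : t₁ + a ∈ I := by
    simp only [hI, mem_ofPred_eq, hshift, ← x10]; exact hx₁.mapsTo (hIcc m0)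
  rw [x20, ← g₂] at r₂
  rw [x11, ← g₁] at r₁
  have hinj : ∀ s ∈ I, ∀ t ∈ I, γ s = γ t → s = t := fun s hs t ht hst => by
    rw [← hclock.2.2 s hs, ← hclock.2.2 t ht, hst]
  have es₂ : s₂ = t₂ + a := by
    apply hinj _ hs₂ _ i₂
    have k1 := hd₂ _ ⟨s₂, hs₂, hc₂⟩ m1
    have k2 := hd₂ _ ⟨_, i₂, r₂⟩ m1
    rw [← hc₂.2.1, ← r₂.2.1, k1, ← k2]
  have es₁ : s₁ = t₁ + a := by
    apply hinj _ hs₁ _ i₁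
    have k1 := hd₁ _ ⟨s₁, hs₁, hc₁⟩ m0
    have k2 := hd₁ _ ⟨_, i₁, r₁⟩ m0
    rw [← hc₁.1, ← r₁.1, k1, ← k2]
  have hshort : ∀ x v, IsNullRay (S.metricCLM φ) e0 O (Ioo (-(1 / 2)) (3 / 2)) x v →
      (∀ s ∈ Icc (0 : ℝ) 1, ‖v s‖ ≤ C * ‖q - p‖) →
      IsShortRay (connection (S.metricCLM φ)) (unitMetric (S.metricCLM φ) e0) e0 O
        (C * ‖q - p‖) x v := fun x v hx hb =>
    ⟨⟨fun s hs => hx.geodesic.hasDerivAt s (hIcc hs),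
      fun s hs => hx.geodesic.hasDerivAt_velocity s (hIcc hs)⟩,
      fun s hs => hx.mapsTo (hIcc hs), hb,
      fun s hs => by rw [unitMetric_apply, hx.null s (hIcc hs), mul_zero],
      fun s hs => by
        rw [unitMetric_apply]
        have := h.metric_timelike hV (hOt (hx.mapsTo (hIcc hs)))
        exact mul_neg_of_pos_of_neg (inv_pos.2 (by linarith)) (hx.future s (hIcc hs))⟩
  refine ⟨t₁, t₂, x₁, v₁, x₂, v₂, hshort _ _ hx₁ b₁, hshort _ _ hx₂ b₂, x10, x11, x20, x21, ?_⟩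
  change b - a = (t₁ + t₂) / 2
  rw [hT, es₁, es₂]
  ring

/-- Property A implies that the observer field is conformal Killing and irrotational. -/
theorem PropertyA.isConformalKilling (hV : S.IsObserverField V) (hA : S.PropertyA V) :
    S.IsConformalKilling V ∧ S.IsIrrotational V := by
  refine isConformalKilling_and_isIrrotational hV fun x => ?_
  have hx0 : V x ≠ 0 := fun h0 => by
    have := hV.timelike x
    rw [h0, map_zero] at this
    exact lt_irrefl _ this
  obtain ⟨χ, hχ, hx, hχx⟩ := exists_isFlowBox hV.smooth x hx0
  refine ⟨χ, hχ, hx, ?_⟩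
  have h0t : (0 : E4) ∈ χ.target := hχx ▸ χ.map_source hx
  obtain ⟨ε, hε, hball⟩ := Metric.isOpen_iff.1 χ.open_target 0 h0t
  obtain ⟨W, hW, hγW, hU, τ, hz, hsync⟩ := hA _ _
    (hχ.isClockIn_line (y := 0) isOpen_ball (convex_ball 0 ε) hball)
  have h0W : χ.symm 0 ∈ W := hγW ⟨0, by simpa using hε, by simp⟩
  obtain ⟨r, hr, hrb⟩ := Metric.mem_nhds_iff.1 (inter_mem (χ.open_target.mem_nhds h0t)
    ((χ.symm.continuousAt h0t).preimage_mem_nhds (hW.mem_nhds h0W)))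
  set O : Set E4 := ball 0 r
  have hOt : O ⊆ χ.target := fun y hy => (hrb hy).1
  have key := fun p (hp : p ∈ O) => hχ.exists_isShortRadarTime hV hU hz hsync isOpen_ball
    (convex_ball 0 r) hOt (fun y hy => (hrb hy).2) hp
  have hG := (S.contDiffOn_metricCLM hχ.mem).mono hOt
  have hneg : ∀ y ∈ O, S.metricCLM χ y e0 e0 < 0 := fun y hy => hχ.metric_timelike hV (hOt hy)
  have h0O : (0 : E4) ∈ O := mem_ball_self hr
  obtain ⟨hinv, hcl⟩ := invariant_and_closed_of_isShortRadarTime isOpen_ball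
    (contDiffOn_connection isOpen_ball hG fun y hy => S.isInvertible_metricCLM hχ.mem (hOt hy))
    (contDiffOn_unitMetric hG hneg)
    (fun y hy u w => by rw [unitMetric_apply, unitMetric_apply, S.metricCLM_symm y u w])
    (fun y hy => unitMetric_self (hneg y hy))
    (fun y hy w hw h => by
      have h1 := hneg y hy
      have h2 : 0 < (-S.metricCLM χ y e0 e0)⁻¹ := inv_pos.2 (by linarith)
      rw [unitMetric_apply] at h ⊢
      exact mul_pos h2 ((S.isLorentzForm_metricCLM hχ.mem (hOt hy)).pos_of_orthogonal h1
        ((mul_eq_zero.1 h).resolve_left h2.ne') hw))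
    (fun p hp => (key p hp).1) (fun p hp => (key p hp).2) h0O
  have hform := fun u a b => fderiv_eq_unitMetric isOpen_ball hG hneg h0O u a b
  rw [hχx]
  refine ⟨⟨fderiv ℝ (S.metricCLM χ) 0 e0 e0 e0 / S.metricCLM χ 0 e0 e0, fun u w => ?_⟩,
    fun u w hu hw => ?_⟩
  · rw [hχ.covDeriv_add h0t, hform, hinv, unitMetric_apply]
    simp only [zero_apply, mul_zero, add_zero]
    rw [inv_neg]
    ring
  · rw [← sub_eq_zero, hχ.covDeriv_sub h0t, hform, hform w, hcl u w, unitMetric_apply,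
      unitMetric_apply, hu, hw]
    ring

end Spacetime

end

section

section LocalHomeomorph

variable {E M : Type*} [NormedAddCommGroup E] [NormedSpace ℝ E] [TopologicalSpace M]
variable {f : E → M} {D A : Set E}

omit [NormedSpace ℝ E] in
theorem image_mem_nhds_of_locally_eq {y : E} {χ : OpenPartialHomeomorph M E} (hy : y ∈ χ.target)
    (hf : ∀ᶠ z in 𝓝 y, f z = χ.symm z) {s : Set E} (hs : s ∈ 𝓝 y) : f '' s ∈ 𝓝 (f y) := by
  have h1 : χ.symm '' (s ∩ {z | f z = χ.symm z}) ∈ 𝓝 (χ.symm y) :=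
    χ.symm.image_mem_nhds hy (inter_mem hs hf)
  rw [hf.self_of_nhds]
  refine mem_of_superset h1 ?_
  rintro _ ⟨z, ⟨hz, hz'⟩, rfl⟩
  exact ⟨z, hz, hz'⟩

/-- A local homeomorphism that is an embedding on a subset is injective on a neighbourhood of that
subset. -/
theorem exists_isOpen_injOn_of_locally_eq [T2Space M] [LocallyCompactSpace M]
    [SecondCountableTopology E] (hD : IsOpen D) (hA : A ⊆ D)
    (hloc : ∀ y ∈ D, ∃ χ : OpenPartialHomeomorph M E, y ∈ χ.target ∧
      ∀ᶠ z in 𝓝 y, f z = χ.symm z)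
    (hemb : ∀ a ∈ A, ∀ N ∈ 𝓝 a, ∃ Q ∈ 𝓝 (f a), ∀ a' ∈ A, f a' ∈ Q → a' ∈ N) :
    ∃ D' ⊆ D, IsOpen D' ∧ A ⊆ D' ∧ InjOn f D' := by
  have him : ∀ y ∈ D, ∀ s ∈ 𝓝 y, f '' s ∈ 𝓝 (f y) := fun y hy s hs => by
    obtain ⟨χ, h1, h2⟩ := hloc y hy
    exact image_mem_nhds_of_locally_eq h1 h2 hs
  have hcont : ∀ y ∈ D, ContinuousAt f y := fun y hy => by
    obtain ⟨χ, h1, h2⟩ := hloc y hy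
    exact (χ.symm.continuousAt h1).congr (EventuallyEq.symm h2)
  set X : Set M := f '' D
  have hX : IsOpen X := by
    rw [isOpen_iff_mem_nhds]
    rintro _ ⟨y, hy, rfl⟩
    exact him y hy D (hD.mem_nhds hy)
  set F : D → X := fun y => ⟨f y, mem_image_of_mem f y.2⟩ with hF
  have hFc : Continuous F := by
    refine Continuous.subtype_mk ?_ _
    rw [continuous_iff_continuousAt]
    exact fun y => (hcont y y.2).comp continuousAt_subtype_val
  have hFo : IsOpenMap F := by
    rw [isOpenMap_iff_nhds_le]
    intro y s hs
    have h1 : (Subtype.val '' (F ⁻¹' s)) ∈ 𝓝 (y : E) :=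
      hD.isOpenEmbedding_subtypeVal.isOpenMap.image_mem_nhds hs
    have h2 := him y y.2 _ h1
    have h3 : Subtype.val ⁻¹' (f '' (Subtype.val '' (F ⁻¹' s))) ∈ 𝓝 (F y) :=
      continuousAt_subtype_val.preimage_mem_nhds h2
    refine mem_of_superset h3 ?_
    rintro x ⟨_, ⟨z, hz, rfl⟩, hzx⟩
    have : F z = x := Subtype.ext hzx
    rw [← this]; exact hz
  have hFs : Function.Surjective F := by
    rintro ⟨_, y, hy, rfl⟩
    exact ⟨⟨y, hy⟩, rfl⟩
  have : SecondCountableTopology X :=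
    (hFo.isQuotientMap hFc hFs).secondCountableTopology hFo
  have : LocallyCompactSpace X := hX.locallyCompactSpace
  let _ : MetricSpace X := TopologicalSpace.metrizableSpaceMetric X
  have key : ∀ a : A, ∃ (χ : OpenPartialHomeomorph M E) (N : Set E) (ρ ε : ℝ), 0 < ρ ∧ 0 < ε ∧
      IsOpen N ∧ N ⊆ χ.target ∧ N ⊆ D ∧ (∀ z ∈ N, f z = χ.symm z) ∧ ball (a : E) ε ⊆ N ∧
      (∀ z : D, (z : E) ∈ ball (a : E) ε → dist (F z) (F ⟨a, hA a.2⟩) < ρ) ∧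
      (∀ x : X, dist x (F ⟨a, hA a.2⟩) < 3 * ρ → (x : M) ∈ f '' N) ∧
      (∀ a' : A, dist (F ⟨a', hA a'.2⟩) (F ⟨a, hA a.2⟩) < 3 * ρ → (a' : E) ∈ N) := by
    rintro ⟨a, ha⟩
    obtain ⟨χ, h1, h2⟩ := hloc a (hA ha)
    obtain ⟨N, hN, hNo, haN⟩ := _root_.mem_nhds_iff.1 (inter_mem (inter_mem h2 (χ.open_target.mem_nhds h1))
      (hD.mem_nhds (hA ha)))
    obtain ⟨Q, hQ, hQ'⟩ := hemb a ha N (hNo.mem_nhds haN)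
    have h3 : Subtype.val ⁻¹' (Q ∩ f '' N) ∈ 𝓝 (F ⟨a, hA ha⟩) :=
      continuousAt_subtype_val.preimage_mem_nhds
        (inter_mem hQ (him a (hA ha) N (hNo.mem_nhds haN)))
    obtain ⟨ρ, hρ, hρ'⟩ := Metric.mem_nhds_iff.1 h3
    have h4 : F ⁻¹' (ball (F ⟨a, hA ha⟩) (ρ / 3)) ∈ 𝓝 (⟨a, hA ha⟩ : D) :=
      hFc.continuousAt.preimage_mem_nhds (ball_mem_nhds _ (by positivity))
    have h5 : (Subtype.val '' (F ⁻¹' (ball (F ⟨a, hA ha⟩) (ρ / 3)))) ∈ 𝓝 a :=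
      hD.isOpenEmbedding_subtypeVal.isOpenMap.image_mem_nhds h4
    obtain ⟨ε, hε, hε'⟩ := Metric.mem_nhds_iff.1 (inter_mem h5 (hNo.mem_nhds haN))
    refine ⟨χ, N, ρ / 3, ε, by positivity, hε, hNo, fun z hz => (hN hz).1.2, fun z hz => (hN hz).2,
      fun z hz => (hN hz).1.1, fun z hz => (hε' hz).2, fun z hz => ?_, fun x hx => ?_,
      fun a' ha' => ?_⟩
    · obtain ⟨⟨z', hz', h6⟩, -⟩ := hε' hz
      have : z' = z := Subtype.ext h6
      rw [← this]
      exact hz'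
    · exact (hρ' (show x ∈ ball _ ρ by rw [mem_ball]; linarith)).2
    · have h7 := (hρ' (show F ⟨a', hA a'.2⟩ ∈ ball _ ρ by rw [mem_ball]; linarith)).1
      exact hQ' a' a'.2 h7
  choose χ N ρ ε hρ hε hNo hNχ hND hNf hεN hερ hρN hρA using key
  have main : ∀ a b : A, ρ b ≤ ρ a → ∀ y ∈ ball (a : E) (ε a), ∀ z ∈ ball (b : E) (ε b),
      f y = f z → y = z := by
    intro a b hab y hy z hz hyz
    have hyD := hND a (hεN a hy)
    have hzD := hND b (hεN b hz)
    have d1 := hερ a ⟨y, hyD⟩ hy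
    have hFyz : F ⟨y, hyD⟩ = F ⟨z, hzD⟩ := Subtype.ext hyz
    have d2 := hερ b ⟨z, hzD⟩ hz
    rw [← hFyz] at d2
    have d3 : dist (F ⟨b, hA b.2⟩) (F ⟨a, hA a.2⟩) < 2 * ρ a := by
      have := dist_triangle_left (F ⟨b, hA b.2⟩) (F ⟨a, hA a.2⟩) (F ⟨y, hyD⟩)
      linarith
    have hbN : (b : E) ∈ N a := hρA a b (by linarith [hρ a])
    have hsub : ball (b : E) (ε b) ⊆ N a := by
      have hval : ∀ u ∈ ball (b : E) (ε b), ∃ u' ∈ N a, χ a (f u) = u' ∧ f u ∈ (χ a).source ∧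
          (u ∈ N a ↔ u' = u) := by
        intro u hu
        have huD := hND b (hεN b hu)
        have d4 := hερ b ⟨u, huD⟩ hu
        have d5 : dist (F ⟨u, huD⟩) (F ⟨a, hA a.2⟩) < 3 * ρ a := by
          have := dist_triangle (F ⟨u, huD⟩) (F ⟨b, hA b.2⟩) (F ⟨a, hA a.2⟩)
          linarith
        obtain ⟨u', hu', hfu⟩ := hρN a _ d5
        have hfu' : f u' = f u := hfu
        have e1 : χ a (f u) = u' := by
          rw [← hfu', hNf a u' hu', (χ a).right_inv (hNχ a hu')]
        refine ⟨u', hu', e1, ?_, fun hu2 => ?_, fun h => h ▸ hu'⟩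
        · rw [← hfu', hNf a u' hu']; exact (χ a).map_target (hNχ a hu')
        · rw [← e1, hNf a u hu2, (χ a).right_inv (hNχ a hu2)]
      have hpre : IsPreconnected (ball (b : E) (ε b)) := (convex_ball _ _).isPreconnected
      refine hpre.subset_of_closure_inter_subset (hNo a)
        ⟨b, mem_ball_self (hε b), hbN⟩ ?_
      rintro u ⟨hu, hub⟩
      obtain ⟨u', hu', e1, hsrc, hiff⟩ := hval u hub
      rw [hiff]
      have hk : ContinuousAt (fun v => χ a (f v)) u :=
        ((χ a).continuousAt hsrc).comp (hcont u (hND b (hεN b hub)))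
      have hcl : (𝓝[N a] u).NeBot := mem_closure_iff_nhdsWithin_neBot.1 hu
      have ht1 : Tendsto (fun v => χ a (f v)) (𝓝[N a] u) (𝓝 u') := by
        rw [← e1]; exact hk.tendsto.mono_left nhdsWithin_le_nhds
      have ht2 : Tendsto (fun v => χ a (f v)) (𝓝[N a] u) (𝓝 u) := by
        refine (tendsto_id.mono_left nhdsWithin_le_nhds).congr' ?_
        filter_upwards [self_mem_nhdsWithin] with v hv
        rw [hNf a v hv, (χ a).right_inv (hNχ a hv)]
        rfl
      exact tendsto_nhds_unique ht1 ht2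
    have hyN := hεN a hy
    have hzN := hsub hz
    rw [hNf a y hyN, hNf a z hzN] at hyz
    exact (χ a).symm.injOn (hNχ a hyN) (hNχ a hzN) hyz
  refine ⟨⋃ a : A, ball (a : E) (ε a), iUnion_subset fun a => (hεN a).trans (hND a),
    isOpen_iUnion fun a => isOpen_ball, fun a ha => mem_iUnion.2 ⟨⟨a, ha⟩, mem_ball_self (hε _)⟩, ?_⟩
  intro y hy z hz hyz
  obtain ⟨a, ha⟩ := mem_iUnion.1 hy
  obtain ⟨b, hb⟩ := mem_iUnion.1 hz
  rcases le_total (ρ b) (ρ a) with h | h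
  · exact main a b h y ha z hb hyz
  · exact (main b a h z hb y ha hyz.symm).symm

end LocalHomeomorph

theorem isOpen_starShaped {D : Set E4} (hD : IsOpen D) :
    IsOpen {y : E4 | ∀ s ∈ Icc (0 : ℝ) 1, spaceProj y + (s * y 0) • e0 ∈ D} := by
  rw [isOpen_iff_mem_nhds]
  intro y hy
  have h1 : ∀ s ∈ Icc (0 : ℝ) 1, ∀ᶠ z : E4 × ℝ in 𝓝 (y, s),
      spaceProj z.1 + (z.2 * z.1 0) • e0 ∈ D := by
    intro s hs
    have hc : Continuous fun z : E4 × ℝ => spaceProj z.1 + (z.2 * z.1 0) • e0 := by fun_prop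
    exact hc.continuousAt.eventually (hD.mem_nhds (hy s hs))
  exact isCompact_Icc.eventually_forall_of_forall_eventually
    (P := fun (z : E4) (s : ℝ) => spaceProj z + (s * z 0) • e0 ∈ D) h1

end

section

namespace Spacetime

variable {M : Type*} [TopologicalSpace M] [ChartedSpace (EuclideanSpace ℝ (Fin 4)) M]
  [IsManifold (𝓡 4) ∞ M]
variable {V : (x : M) → TangentSpace (𝓡 4) x} {φ χ : OpenPartialHomeomorph M E4}

/-! ### Integral curves -/

theorem integralCurve_eqOn [T2Space M]
    (hV : ContMDiff (𝓡 4) (𝓡 4).tangent ∞ (fun x ↦ (⟨x, V x⟩ : TangentBundle (𝓡 4) M)))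
    {I : Set ℝ} (hI : IsOpen I) (hI' : I.OrdConnected) {γ γ' : ℝ → M}
    (hγ : IsMIntegralCurveOn (I := 𝓡 4) γ V I) (hγ' : IsMIntegralCurveOn (I := 𝓡 4) γ' V I)
    {t₀ : ℝ} (ht₀ : t₀ ∈ I) (h : γ t₀ = γ' t₀) : EqOn γ γ' I := by
  intro t ht
  have hm : ∀ s ∈ I, ∃ δ > 0, Ioo (s - δ) (s + δ) ⊆ I := fun s hs => by
    obtain ⟨δ, hδ, hb⟩ := Metric.isOpen_iff.1 hI s hs
    exact ⟨δ, hδ, by rwa [← Real.ball_eq_Ioo]⟩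
  obtain ⟨δ₁, hδ₁, hb₁⟩ := hm _ (hI'.out (inf_ind t₀ t ht₀ ht : min t₀ t ∈ I) (inf_ind t₀ t ht₀ ht)
    (left_mem_Icc.2 le_rfl))
  obtain ⟨δ₂, hδ₂, hb₂⟩ := hm (max t₀ t) (sup_ind t₀ t ht₀ ht)
  have hsub : Ioo (min t₀ t - δ₁) (max t₀ t + δ₂) ⊆ I := by
    intro s hs
    rcases lt_or_ge s (min t₀ t) with h1 | h1
    · exact hb₁ ⟨hs.1, by linarith⟩
    rcases lt_or_ge (max t₀ t) s with h2 | h2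
    · exact hb₂ ⟨by linarith, hs.2⟩
    exact hI'.out (inf_ind t₀ t ht₀ ht : min t₀ t ∈ I) (sup_ind t₀ t ht₀ ht : max t₀ t ∈ I) ⟨h1, h2⟩
  have a1 : min t₀ t ≤ t₀ := min_le_left _ _
  have a2 : min t₀ t ≤ t := min_le_right _ _
  have a3 : t₀ ≤ max t₀ t := le_max_left _ _
  have a4 : t ≤ max t₀ t := le_max_right _ _
  have : IsManifold (𝓡 4) 1 M := .of_le (n := ∞) (by simp)
  exact isMIntegralCurveOn_Ioo_eqOn_of_contMDiff_boundaryless (t₀ := t₀)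
    ⟨by linarith, by linarith⟩ (hV.of_le (by simp)) (hγ.mono hsub) (hγ'.mono hsub) h
    ⟨by linarith, by linarith⟩

theorem exists_integralCurve_union [T2Space M]
    (hV : ContMDiff (𝓡 4) (𝓡 4).tangent ∞ (fun x ↦ (⟨x, V x⟩ : TangentBundle (𝓡 4) M)))
    {I J : Set ℝ} (hI : IsOpen I) (hI' : I.OrdConnected) (hJ : IsOpen J) (hJ' : J.OrdConnected)
    {γ γ' : ℝ → M} (hγ : IsMIntegralCurveOn (I := 𝓡 4) γ V I)
    (hγ' : IsMIntegralCurveOn (I := 𝓡 4) γ' V J) {s : ℝ} (hsI : s ∈ I) (hsJ : s ∈ J)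
    (h : γ s = γ' s) :
    (I ∪ J).OrdConnected ∧ ∃ β : ℝ → M, IsMIntegralCurveOn (I := 𝓡 4) β V (I ∪ J) ∧
      EqOn β γ I ∧ EqOn β γ' J := by
  classical
  refine ⟨?_, fun r => if r ∈ I then γ r else γ' r, ?_⟩
  · rw [← isPreconnected_iff_ordConnected] at hI' hJ' ⊢
    exact hI'.union s hsI hsJ hJ'
  have heq : EqOn γ γ' (I ∩ J) := integralCurve_eqOn hV (hI.inter hJ) (hI'.inter hJ')
    (hγ.mono inter_subset_left) (hγ'.mono inter_subset_right) ⟨hsI, hsJ⟩ h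
  have e1 : EqOn (fun r => if r ∈ I then γ r else γ' r) γ I := fun r hr => if_pos hr
  have e2 : EqOn (fun r => if r ∈ I then γ r else γ' r) γ' J := fun r hr => by
    by_cases hrI : r ∈ I
    · simp only [hrI, if_true]; exact heq ⟨hrI, hr⟩
    · simp only [hrI, if_false]
  refine ⟨?_, e1, e2⟩
  rintro r (hr | hr)
  · have h1 := (hγ r hr).hasMFDerivAt (hI.mem_nhds hr)
    have h2 := (h1.congr_of_eventuallyEq (e1.eventuallyEq_of_mem (hI.mem_nhds hr)))
    rw [← e1 hr] at h2
    exact h2.hasMFDerivWithinAt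
  · have h1 := (hγ' r hr).hasMFDerivAt (hJ.mem_nhds hr)
    have h2 := (h1.congr_of_eventuallyEq (e2.eventuallyEq_of_mem (hJ.mem_nhds hr)))
    rw [← e2 hr] at h2
    exact h2.hasMFDerivWithinAt

/-! ### The flow of the slice of a flow box -/

/-- The point `m` is reached from the point with coordinates `spaceProj y` in the chart `φ` by
following `V` for the time `y 0`. -/
def FlowsTo (V : (x : M) → TangentSpace (𝓡 4) x) (φ : OpenPartialHomeomorph M E4) (y : E4)
    (m : M) : Prop :=
  spaceProj y ∈ φ.target ∧ ∃ (β : ℝ → M) (J : Set ℝ), IsOpen J ∧ J.OrdConnected ∧ 0 ∈ J ∧ y 0 ∈ J ∧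
    IsMIntegralCurveOn (I := 𝓡 4) β V J ∧ β 0 = φ.symm (spaceProj y) ∧ β (y 0) = m

theorem FlowsTo.unique [T2Space M]
    (hV : ContMDiff (𝓡 4) (𝓡 4).tangent ∞ (fun x ↦ (⟨x, V x⟩ : TangentBundle (𝓡 4) M)))
    {y : E4} {m m' : M} (h : FlowsTo V φ y m) (h' : FlowsTo V φ y m') : m = m' := by
  obtain ⟨-, β, J, hJ, hJo, h0, hy, hβ, hβ0, rfl⟩ := h
  obtain ⟨-, β', J', hJ', hJo', h0', hy', hβ', hβ0', rfl⟩ := h'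
  exact integralCurve_eqOn hV (hJ.inter hJ') (hJo.inter hJo') (hβ.mono inter_subset_left)
    (hβ'.mono inter_subset_right) ⟨h0, h0'⟩ (hβ0.trans hβ0'.symm) ⟨hy, hy'⟩

/-- The points near which the flow of the slice is described by a flow box. -/
def flowDomain (V : (x : M) → TangentSpace (𝓡 4) x) (φ : OpenPartialHomeomorph M E4) : Set E4 :=
  {y | ∃ χ : OpenPartialHomeomorph M E4, IsFlowBox V χ ∧ y ∈ χ.target ∧
    ∀ᶠ z in 𝓝 y, FlowsTo V φ z (χ.symm z)}

omit [IsManifold (𝓡 4) ∞ M] in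
theorem isOpen_flowDomain : IsOpen (flowDomain V φ) := by
  rw [isOpen_iff_mem_nhds]
  rintro y ⟨χ, hχ, hy, h⟩
  filter_upwards [χ.open_target.mem_nhds hy, h.eventually_nhds] with z hz hz'
  exact ⟨χ, hχ, hz, hz'⟩

omit [IsManifold (𝓡 4) ∞ M] in
theorem IsFlowBox.isMIntegralCurveOn_line (h : IsFlowBox V φ) {y : E4} {I : Set ℝ}
    (hm : ∀ t ∈ I, y + t • e0 ∈ φ.target) :
    IsMIntegralCurveOn (I := 𝓡 4) (fun t => φ.symm (y + t • e0)) V I := by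
  refine isMIntegralCurveOn_chart_symm h.mem hm fun t ht => ?_
  rw [h.field _ (hm t ht)]
  have := ((hasDerivAt_id t).smul_const e0).const_add y
  rw [one_smul] at this
  exact this

omit [IsManifold (𝓡 4) ∞ M] in
theorem IsFlowBox.zero_mem_flowDomain (h : IsFlowBox V φ) (h0 : (0 : E4) ∈ φ.target) :
    (0 : E4) ∈ flowDomain V φ := by
  refine ⟨φ, h, h0, ?_⟩
  obtain ⟨r, hr, hb⟩ := Metric.isOpen_iff.1 φ.open_target 0 h0
  have h1 : ∀ᶠ z : E4 in 𝓝 0, spaceProj z ∈ ball (0 : E4) r := by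
    have := spaceProj.continuous.tendsto (0 : E4)
    rw [map_zero] at this
    exact this (ball_mem_nhds 0 hr)
  filter_upwards [h1, ball_mem_nhds (0 : E4) hr] with z hz hz'
  refine ⟨hb hz, fun t => φ.symm (spaceProj z + t • e0), {t | spaceProj z + t • e0 ∈ ball (0 : E4) r},
    isOpen_ball.preimage (by fun_prop), ordConnected_line (convex_ball _ _), by simpa using hz, ?_,
    h.isMIntegralCurveOn_line fun t ht => hb ht, by simp, by simp [spaceProj_add]⟩
  simp only [mem_ofPred_eq, spaceProj_add]
  exact hz'

theorem spaceProj_idem (z : E4) : spaceProj (spaceProj z) = spaceProj z := by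
  rw [spaceProj_apply (spaceProj z)]; simp

omit [IsManifold (𝓡 4) ∞ M] in
theorem eq_zero_of_coframe_eq_zero (hφ : φ ∈ IsManifold.maximalAtlas (𝓡 4) ∞ M) {x : M}
    (hx : x ∈ φ.source) {v : TangentSpace (𝓡 4) x} (h : coframe φ x v = 0) : v = 0 := by
  obtain ⟨y, hy, rfl⟩ : ∃ y ∈ φ.target, φ.symm y = x := ⟨φ x, φ.map_source hx, φ.left_inv hx⟩
  rw [← frame_coframe hφ hy v, h, map_zero]

/-- The flow of the slice is described by flow boxes along the whole integral curve. -/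
theorem IsFlowBox.axis_subset_flowDomain [T2Space M]
    (hV : ContMDiff (𝓡 4) (𝓡 4).tangent ∞ (fun x ↦ (⟨x, V x⟩ : TangentBundle (𝓡 4) M)))
    (hne : ∀ x, V x ≠ 0) (h : IsFlowBox V φ) {γ : ℝ → M} {I : Set ℝ} (hI : IsOpen I)
    (hI' : I.OrdConnected) (hγ : IsMIntegralCurveOn (I := 𝓡 4) γ V I) (h0I : 0 ∈ I)
    (h0 : (0 : E4) ∈ φ.target) (hγ0 : γ 0 = φ.symm 0) :
    ∀ t ∈ I, t • e0 ∈ flowDomain V φ ∧ FlowsTo V φ (t • e0) (γ t) := by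
  have hflow : ∀ t ∈ I, FlowsTo V φ (t • e0) (γ t) := fun t ht =>
    ⟨by simpa using h0, γ, I, hI, hI', h0I, by simpa using ht, hγ, by simpa using hγ0, by simp⟩
  suffices hsub : I ⊆ {t : ℝ | t • e0 ∈ flowDomain V φ} from fun t ht => ⟨hsub ht, hflow t ht⟩
  refine (isPreconnected_iff_ordConnected.2 hI').subset_of_closure_inter_subset
    (isOpen_flowDomain.preimage (by fun_prop)) ⟨0, h0I, ?_⟩ ?_
  · simp only [mem_ofPred_eq, zero_smul]; exact h.zero_mem_flowDomain h0
  rintro t ⟨htc, ht⟩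
  obtain ⟨χ, hχ, hx, hχx⟩ := exists_isFlowBox hV (γ t) (hne _)
  have h0t : (0 : E4) ∈ χ.target := hχx ▸ χ.map_source hx
  obtain ⟨ρ, hρ, hb⟩ := Metric.isOpen_iff.1 χ.open_target 0 h0t
  have hγt : ∀ᶠ r in 𝓝 t, γ r = χ.symm ((r - t) • e0) := by
    have hopen : IsOpen {r : ℝ | (-t) • e0 + r • e0 ∈ ball (0 : E4) ρ} :=
      isOpen_ball.preimage (by fun_prop)
    have htm : t ∈ {r : ℝ | (-t) • e0 + r • e0 ∈ ball (0 : E4) ρ} := by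
      simp only [mem_ofPred_eq, neg_smul, neg_add_cancel]; exact mem_ball_self hρ
    have heq := integralCurve_eqOn hV (hI.inter hopen) (hI'.inter (ordConnected_line (convex_ball _ _)))
      (hγ.mono inter_subset_left)
      ((hχ.isMIntegralCurveOn_line fun r hr => hb hr).mono inter_subset_right) ⟨ht, htm⟩
      (by simp only [neg_smul, neg_add_cancel]; rw [← hχx, χ.left_inv hx])
    filter_upwards [(hI.inter hopen).mem_nhds ⟨ht, htm⟩] with r hr
    have hr' : (-t) • e0 + r • e0 = (r - t) • e0 := by rw [sub_smul, neg_smul]; abel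
    rw [heq hr, ← hr']
  have hnear : ∀ᶠ r in 𝓝 t, γ r = χ.symm ((r - t) • e0) ∧ (r - t) • e0 ∈ ball (0 : E4) ρ := by
    refine hγt.and ?_
    have : Continuous fun r : ℝ => (r - t) • e0 := by fun_prop
    have h2 := this.tendsto t
    rw [sub_self, zero_smul] at h2
    exact h2 (ball_mem_nhds 0 hρ)
  obtain ⟨s, ⟨⟨hsγ, hsρ⟩, hsI⟩, ⟨χs, hχs, hsχ, hsR⟩⟩ :=
    ((hnear.and (hI.eventually_mem ht)).and_frequently (mem_closure_iff_frequently.1 htc)).exists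
  have hsγ' : χs.symm (s • e0) = γ s := hsR.self_of_nhds.unique hV (hflow s hsI)
  have hsrc : χs.symm (s • e0) ∈ χ.source := by
    rw [hsγ', hsγ]; exact χ.map_target (hb hsρ)
  set k₀ : E4 → E4 := fun z => χ (χs.symm z) with hk₀
  have hk₀s : k₀ (s • e0) = (s - t) • e0 := by
    simp only [hk₀, hsγ', hsγ, χ.right_inv (hb hsρ)]
  set L : E4 →L[ℝ] E4 := (coframe χ (χs.symm (s • e0))).comp (frame χs (s • e0)) with hL
  have hd : HasFDerivAt k₀ L (s • e0) := hasFDerivAt_transition hχ.mem hχs.mem hsχ hsrc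
  have hLe : L e0 = e0 := by
    have := fieldInChart_transition hχ.mem hχs.mem hsχ hsrc V
    rw [hχs.field _ hsχ, hχ.field _ (χ.map_source hsrc), hd.fderiv] at this
    exact this.symm
  have hLinj : Function.Injective L := by
    rw [injective_iff_map_eq_zero]
    intro w hw
    have h1 : frame χs (s • e0) w = 0 := eq_zero_of_coframe_eq_zero hχ.mem hsrc hw
    rw [← coframe_frame hχs.mem hsχ w]
    exact (congrArg (coframe χs (χs.symm (s • e0))) h1).trans (map_zero _)
  set L' : E4 ≃L[ℝ] E4 :=
    (LinearEquiv.ofInjectiveEndo (L : E4 →ₗ[ℝ] E4) hLinj).toContinuousLinearEquiv with hL'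
  have hLL : (L' : E4 →L[ℝ] E4) = L := by ext1 w; rfl
  set sh : E4 → E4 := fun z => spaceProj z + s • e0 with hsh
  set k : E4 → E4 := fun z => k₀ (sh z) + (z 0 - s) • e0 with hk
  have hshd : ∀ z, HasFDerivAt sh spaceProj z := fun z => spaceProj.hasFDerivAt.add_const _
  have hsht : sh (t • e0) = s • e0 := by simp [sh]
  have hproj : ∀ z : E4, HasFDerivAt (fun z : E4 => (z 0 - s) • e0)
      ((EuclideanSpace.proj (0 : Fin 4) : E4 →L[ℝ] ℝ).smulRight e0) z := fun z =>
    (((EuclideanSpace.proj (0 : Fin 4) : E4 →L[ℝ] ℝ).hasFDerivAt).sub_const s).smul_const e0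
  have hkd : HasFDerivAt k (L' : E4 →L[ℝ] E4) (t • e0) := by
    have h1 : HasFDerivAt k₀ L (sh (t • e0)) := by rw [hsht]; exact hd
    have h2 := (h1.comp (t • e0) (hshd _)).add (hproj (t • e0))
    refine h2.congr_fderiv ?_
    rw [hLL]
    ext1 w
    simp only [add_apply, ContinuousLinearMap.comp_apply, ContinuousLinearMap.smulRight_apply]
    conv_rhs => rw [← spaceProj_add w, map_add, map_smul, hLe]
    rfl
  -- the domain on which the extended flow is defined
  have hev : ∀ᶠ z in 𝓝 (t • e0), sh z ∈ χs.target ∧ χs.symm (sh z) ∈ χ.source ∧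
      FlowsTo V φ (sh z) (χs.symm (sh z)) ∧ k₀ (sh z) ∈ ball (0 : E4) ρ ∧ k z ∈ ball (0 : E4) ρ := by
    have hc : Tendsto sh (𝓝 (t • e0)) (𝓝 (s • e0)) := by
      have := (hshd (t • e0)).continuousAt.tendsto
      rwa [hsht] at this
    have hc2 : Tendsto k (𝓝 (t • e0)) (𝓝 0) := by
      have h1 := hkd.continuousAt.tendsto
      have h2 : k (t • e0) = 0 := by
        simp only [hk, hsht, hk₀s]
        rw [show (t • e0) 0 = t by simp, ← add_smul]
        simp
      rwa [h2] at h1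
    have hc3 : Tendsto k₀ (𝓝 (s • e0)) (𝓝 ((s - t) • e0)) := by
      have := hd.continuousAt.tendsto
      rwa [hk₀s] at this
    have c1 := hc.eventually (eventually_transition (φ := χ) hsχ hsrc)
    have c2 := hc.eventually hsR
    have c3 := (hc3.comp hc).eventually (isOpen_ball.mem_nhds hsρ)
    have c4 := hc2.eventually (ball_mem_nhds 0 hρ)
    filter_upwards [c1, c2, c3, c4] with z h1 h2 h3 h4
    exact ⟨h1.1, h1.2, h2, h3, h4⟩
  obtain ⟨Y, hY, hYo, htY⟩ := _root_.mem_nhds_iff.1 hev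
  have hks : ContDiffOn ℝ ∞ k Y := by
    intro z hz
    obtain ⟨h1, h2, -⟩ := hY hz
    have d1 : ContDiffAt ℝ ∞ k₀ (sh z) := contDiffAt_transition hχ.mem hχs.mem h1 h2
    have d2 : ContDiff ℝ ∞ sh := spaceProj.contDiff.add contDiff_const
    have d3 : ContDiff ℝ ∞ (fun z : E4 => (z 0 - s) • e0) :=
      (((EuclideanSpace.proj (0 : Fin 4) : E4 →L[ℝ] ℝ).contDiff).sub contDiff_const).smul
        contDiff_const
    exact ((d1.comp z d2.contDiffAt).add d3.contDiffAt).contDiffWithinAt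
  obtain ⟨e, he, hte, hes, hesymm⟩ := exists_smooth_openPartialHomeomorph hYo htY hks L' hkd
  have het : e.target ⊆ χ.target := by
    intro y hy
    rw [← e.right_inv hy, he]
    exact hb (hY (hes (e.map_target hy))).2.2.2.2
  have hef : ∀ z ∈ e.source, fderiv ℝ e z e0 = fieldInChart V χ (e z) := by
    intro z hz
    rw [hχ.field _ (het (e.map_source hz)), he]
    obtain ⟨h1, h2, -⟩ := hY (hes hz)
    have d1 : HasFDerivAt k₀ (fderiv ℝ k₀ (sh z)) (sh z) :=
      ((contDiffAt_transition hχ.mem hχs.mem h1 h2).differentiableAt (by simp)).hasFDerivAt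
    have d2 : HasFDerivAt k _ z := (d1.comp z (hshd z)).add (hproj z)
    rw [d2.fderiv]
    simp
  obtain ⟨hbox, hboxt⟩ := isFlowBox_trans hχ.mem het (by rw [he]; exact hks.mono hes) hesymm hef
  refine ⟨χ.trans e.symm, hbox, by rw [hboxt]; exact hte, ?_⟩
  filter_upwards [e.open_source.mem_nhds hte] with z hz
  have hsymm : (χ.trans e.symm).symm z = χ.symm (k z) := by
    simp [OpenPartialHomeomorph.trans_symm_eq_symm_trans_symm, he]
  rw [hsymm]
  obtain ⟨h1, h2, ⟨hp, β, J, hJ, hJo, h0J, hsJ, hβ, hβ0, hβs⟩, h4, h5⟩ := hY (hes hz)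
  have hpz : spaceProj (sh z) = spaceProj z := by simp [sh, spaceProj_idem]
  have hsz : sh z 0 = s := by simp [sh]
  rw [hpz] at hp hβ0
  rw [hsz] at hsJ hβs
  set y' := k₀ (sh z) + (-s) • e0 with hy'
  have hline := hχ.isMIntegralCurveOn_line (y := y') (I := {r | y' + r • e0 ∈ ball (0 : E4) ρ})
    fun r hr => hb hr
  have es : y' + s • e0 = k₀ (sh z) := by rw [hy', neg_smul]; abel
  have ez : y' + z 0 • e0 = k z := by
    rw [hy', hk, neg_smul]
    simp only [sub_smul]
    abel
  have m1 : s ∈ {r : ℝ | y' + r • e0 ∈ ball (0 : E4) ρ} := by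
    simp only [mem_ofPred_eq, es]; exact h4
  have m2 : z 0 ∈ {r : ℝ | y' + r • e0 ∈ ball (0 : E4) ρ} := by
    simp only [mem_ofPred_eq, ez]; exact h5
  have hJ2 : IsOpen {r : ℝ | y' + r • e0 ∈ ball (0 : E4) ρ} := isOpen_ball.preimage (by fun_prop)
  obtain ⟨hord, β', hβ', hb1, hb2⟩ := exists_integralCurve_union hV hJ hJo hJ2
    (ordConnected_line (convex_ball _ _)) hβ hline hsJ m1
    (by rw [hβs, es]; exact (χ.left_inv h2).symm)
  refine ⟨hp, β', _, hJ.union hJ2, hord, Or.inl h0J, Or.inr m2, hβ', ?_, ?_⟩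
  · rw [hb1 h0J, hβ0]
  · rw [hb2 m2]
    simp only [ez]

end Spacetime

end

section

namespace Spacetime

variable {M : Type*} [TopologicalSpace M] [ChartedSpace (EuclideanSpace ℝ (Fin 4)) M]
  [IsManifold (𝓡 4) ∞ M]
variable {V : (x : M) → TangentSpace (𝓡 4) x}

/-- An injective map that is locally the inverse of a flow box is the inverse of a flow box. -/
theorem exists_isFlowBox_of_injOn {Ψ : E4 → M} {D : Set E4} (hD : IsOpen D) (hinj : InjOn Ψ D)
    (hloc : ∀ y ∈ D, ∃ χ : OpenPartialHomeomorph M E4, IsFlowBox V χ ∧ y ∈ χ.target ∧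
      ∀ᶠ z in 𝓝 y, Ψ z = χ.symm z) :
    ∃ φ : OpenPartialHomeomorph M E4, IsFlowBox V φ ∧ φ.target = D ∧ φ.source = Ψ '' D ∧
      ∀ y ∈ D, φ.symm y = Ψ y := by
  have hcont : ContinuousOn Ψ D := fun y hy => by
    obtain ⟨χ, -, h1, h2⟩ := hloc y hy
    exact ((χ.symm.continuousAt h1).congr (EventuallyEq.symm h2)).continuousWithinAt
  have hopen : IsOpenMap (D.domRestrict Ψ) := by
    rw [isOpenMap_iff_nhds_le]
    intro y s hs
    obtain ⟨χ, -, h1, h2⟩ := hloc y y.2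
    have h3 : (Subtype.val '' ((D.domRestrict Ψ) ⁻¹' s)) ∈ 𝓝 (y : E4) :=
      hD.isOpenEmbedding_subtypeVal.isOpenMap.image_mem_nhds hs
    refine mem_of_superset (image_mem_nhds_of_locally_eq h1 h2 h3) ?_
    rintro _ ⟨_, ⟨z, hz, rfl⟩, rfl⟩
    exact hz
  set e : OpenPartialHomeomorph E4 M := OpenPartialHomeomorph.ofContinuousOpenRestrict
    (hinj.toPartialEquiv Ψ D) hcont hopen hD with he
  have hes : e.source = D := rfl
  have het : e.target = Ψ '' D := rfl
  have hee : ∀ y, e y = Ψ y := fun y => rfl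
  have hchart : ∀ y ∈ D, ∃ χ : OpenPartialHomeomorph M E4, IsFlowBox V χ ∧ y ∈ χ.target ∧
      (∀ᶠ z in 𝓝 y, Ψ z = χ.symm z) ∧ χ.symm y = Ψ y ∧ ∀ᶠ x in 𝓝 (Ψ y), e.symm x = χ x := by
    intro y hy
    obtain ⟨χ, hχ, h1, h2⟩ := hloc y hy
    have h3 : χ.symm y = Ψ y := h2.self_of_nhds.symm
    refine ⟨χ, hχ, h1, h2, h3, ?_⟩
    have hsrc : Ψ y ∈ χ.source := h3 ▸ χ.map_target h1
    have hχy : χ (Ψ y) = y := by rw [← h3, χ.right_inv h1]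
    have hc : Tendsto χ (𝓝 (Ψ y)) (𝓝 y) := by
      have := (χ.continuousAt hsrc).tendsto
      rwa [hχy] at this
    filter_upwards [hc.eventually h2, hc.eventually (hD.mem_nhds hy), χ.open_source.mem_nhds hsrc]
      with x hx1 hx2 hx3
    rw [χ.left_inv hx3] at hx1
    rw [← hx1, ← hee, e.left_inv hx2, hee, hx1]
  have hmem : e.symm ∈ IsManifold.maximalAtlas (𝓡 4) ∞ M := by
    apply OpenPartialHomeomorph.mem_maximalAtlas_of_contMDiffOn
    · rintro _ ⟨y, hy, rfl⟩
      obtain ⟨χ, hχ, h1, h2, h3, h4⟩ := hchart y hy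
      have hsrc : Ψ y ∈ χ.source := h3 ▸ χ.map_target h1
      exact ((contMDiffAt_of_mem_maximalAtlas hχ.mem hsrc).congr_of_eventuallyEq
        h4).contMDiffWithinAt
    · intro y hy
      obtain ⟨χ, hχ, h1, h2, h3, h4⟩ := hchart y hy
      exact ((contMDiffAt_symm_of_mem_maximalAtlas hχ.mem h1).congr_of_eventuallyEq
        h2).contMDiffWithinAt
  refine ⟨e.symm, ⟨hmem, fun y hy => ?_⟩, rfl, rfl, fun y hy => rfl⟩
  obtain ⟨χ, hχ, h1, h2, h3, h4⟩ := hchart y hy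
  have hy' : χ.symm y ∈ e.symm.source := by rw [h3]; exact mem_image_of_mem Ψ hy
  have ht := fieldInChart_transition hmem hχ.mem h1 hy' V
  have hev : (fun z => e.symm (χ.symm z)) =ᶠ[𝓝 y] fun z => z := by
    have hc : Tendsto χ.symm (𝓝 y) (𝓝 (Ψ y)) := by
      have := (χ.symm.continuousAt h1).tendsto
      rwa [h3] at this
    filter_upwards [hc.eventually h4, χ.open_target.mem_nhds h1] with z hz1 hz2
    rw [hz1, χ.right_inv hz2]
  have hy2 : e.symm (χ.symm y) = y := hev.self_of_nhds
  rw [hy2, hev.fderiv_eq, hχ.field y h1] at ht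
  rw [ht]
  simp

/-- The straightening of a vector field around a whole embedded integral curve. -/
theorem exists_tubular_isFlowBox [T2Space M]
    (hV : ContMDiff (𝓡 4) (𝓡 4).tangent ∞ (fun x ↦ (⟨x, V x⟩ : TangentBundle (𝓡 4) M)))
    (hne : ∀ x, V x ≠ 0) {γ : ℝ → M} {I : Set ℝ} (hγ : IsClockIn V γ I) (h0I : 0 ∈ I) :
    ∃ φ : OpenPartialHomeomorph M E4, IsFlowBox V φ ∧
      (∀ t ∈ I, γ t ∈ φ.source ∧ φ (γ t) = t • e0) ∧
      ∀ y ∈ φ.target, ∀ s ∈ Icc (0 : ℝ) 1, spaceProj y + (s * y 0) • e0 ∈ φ.target := by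
  classical
  obtain ⟨φ₀, hφ₀, hx, hφx⟩ := exists_isFlowBox hV (γ 0) (hne _)
  have h0t : (0 : E4) ∈ φ₀.target := hφx ▸ φ₀.map_source hx
  have haxis := hφ₀.axis_subset_flowDomain hV hne hγ.isOpen hγ.ordConnected hγ.integralCurve h0I h0t
    (by rw [← hφx, φ₀.left_inv hx])
  set D := flowDomain V φ₀ with hD
  set Ψ : E4 → M := fun y => if h : ∃ m, FlowsTo V φ₀ y m then h.choose else γ 0 with hΨ
  have hΨeq : ∀ y m, FlowsTo V φ₀ y m → Ψ y = m := fun y m hm => by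
    have hex : ∃ m, FlowsTo V φ₀ y m := ⟨m, hm⟩
    simp only [hΨ, hex, dif_pos]
    exact hex.choose_spec.unique hV hm
  have hloc : ∀ y ∈ D, ∃ χ : OpenPartialHomeomorph M E4, IsFlowBox V χ ∧ y ∈ χ.target ∧
      ∀ᶠ z in 𝓝 y, Ψ z = χ.symm z := by
    rintro y ⟨χ, hχ, hy, h⟩
    exact ⟨χ, hχ, hy, h.mono fun z hz => hΨeq z _ hz⟩
  have hΨγ : ∀ t ∈ I, Ψ (t • e0) = γ t := fun t ht => hΨeq _ _ (haxis t ht).2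
  set A : Set E4 := (fun t : ℝ => t • e0) '' I with hA
  have hAD : A ⊆ D := by
    rintro _ ⟨t, ht, rfl⟩
    exact (haxis t ht).1
  have : LocallyCompactSpace M := ChartedSpace.locallyCompactSpace E4 M
  obtain ⟨D', hD'D, hD'o, hAD', hinj⟩ := exists_isOpen_injOn_of_locally_eq (f := Ψ) (A := A)
    isOpen_flowDomain hAD (fun y hy => by
      obtain ⟨χ, -, h1, h2⟩ := hloc y hy
      exact ⟨χ, h1, h2⟩) (by
    rintro _ ⟨t, ht, rfl⟩ N hN
    have h1 : (fun r : I => (r : ℝ) • e0) ⁻¹' N ∈ 𝓝 (⟨t, ht⟩ : I) := by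
      have hc : Continuous fun r : I => (r : ℝ) • e0 := by fun_prop
      exact hc.continuousAt.preimage_mem_nhds hN
    rw [hγ.embedding.nhds_eq_comap] at h1
    obtain ⟨Q, hQ, hQN⟩ := h1
    refine ⟨Q, ?_, ?_⟩
    · rw [hΨγ t ht]; exact hQ
    · rintro _ ⟨t', ht', rfl⟩ hq
      rw [hΨγ t' ht'] at hq
      exact hQN (show (⟨t', ht'⟩ : I) ∈ _ from hq))
  set D'' : Set E4 := {y : E4 | ∀ s ∈ Icc (0 : ℝ) 1, spaceProj y + (s * y 0) • e0 ∈ D'} with hD''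
  have hsub : D'' ⊆ D' := fun y hy => by
    have := hy 1 (right_mem_Icc.2 zero_le_one)
    rwa [one_mul, spaceProj_add] at this
  obtain ⟨φ, hφ, hφt, hφs, hφΨ⟩ := exists_isFlowBox_of_injOn (V := V) (isOpen_starShaped hD'o)
    (hinj.mono hsub) (fun y hy => hloc y (hD'D (hsub hy)))
  have haxD : ∀ t ∈ I, t • e0 ∈ D'' := by
    intro t ht s hs
    have h1 : s * t ∈ I := by
      rcases le_total 0 t with h | h
      · exact hγ.ordConnected.out h0I ht ⟨mul_nonneg hs.1 h, mul_le_of_le_one_left h hs.2⟩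
      · exact hγ.ordConnected.out ht h0I ⟨by nlinarith [hs.1, hs.2], mul_nonpos_of_nonneg_of_nonpos hs.1 h⟩
    have h2 : spaceProj (t • e0) + (s * (t • e0) 0) • e0 = (s * t) • e0 := by simp
    rw [h2]
    exact hAD' ⟨_, h1, rfl⟩
  refine ⟨φ, hφ, fun t ht => ⟨?_, ?_⟩, ?_⟩
  · rw [hφs, ← hΨγ t ht]; exact mem_image_of_mem _ (haxD t ht)
  · rw [← hΨγ t ht, ← hφΨ _ (haxD t ht)]
    exact φ.right_inv (hφt ▸ haxD t ht)
  · rw [hφt]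
    intro y hy s hs s' hs'
    have h1 := hy (s' * s) ⟨mul_nonneg hs'.1 hs.1, mul_le_one₀ hs'.2 hs.1 hs.2⟩
    have h2 : spaceProj (spaceProj y + (s * y 0) • e0) +
        (s' * (spaceProj y + (s * y 0) • e0) 0) • e0 = spaceProj y + (s' * s * y 0) • e0 := by
      simp [spaceProj_idem, mul_assoc]
    rw [h2]
    exact h1

end Spacetime

end

section

section Whitehead

variable {E : Type*} [NormedAddCommGroup E] [InnerProductSpace ℝ E]
variable {B : E → E →L[ℝ] E →L[ℝ] E} {p : E} {K r : ℝ}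

/-- A geodesic that stays in a small ball during the parameter interval `[0,1]` is slow at some
moment. -/
theorem IsGeodesicCurve.exists_norm_sq_le {x v : ℝ → E} (h : IsGeodesicCurve B (Icc 0 1) x v)
    (hx : ∀ s ∈ Icc (0 : ℝ) 1, x s ∈ ball p r ∧ ‖B (x s)‖ ≤ K) (hrK : 2 * (r * K) ≤ 1) :
    ∃ s ∈ Icc (0 : ℝ) 1, ‖v s‖ ^ 2 ≤ 8 * r ^ 2 := by
  by_contra hcon
  push Not at hcon
  have m0 : (0 : ℝ) ∈ Icc (0 : ℝ) 1 := left_mem_Icc.2 zero_le_one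
  have m1 : (1 : ℝ) ∈ Icc (0 : ℝ) 1 := right_mem_Icc.2 zero_le_one
  have hr : 0 < r := pos_of_mem_ball (hx 0 m0).1
  have hd : ∀ s ∈ Icc (0 : ℝ) 1, ‖x s - p‖ < r := fun s hs => by
    rw [← dist_eq_norm]; exact (hx s hs).1
  have d1 : ∀ s ∈ Icc (0 : ℝ) 1, HasDerivAt (fun s => ‖x s - p‖ ^ 2 - 4 * r ^ 2 * s ^ 2)
      (2 * inner ℝ (x s - p) (v s) - 8 * r ^ 2 * s) s := fun s hs => by
    have h1 := ((h.hasDerivAt s hs).sub_const p).norm_sq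
    have h2 := (hasDerivAt_pow 2 s).const_mul (4 * r ^ 2)
    refine (h1.sub h2).congr_deriv ?_
    simp only [Nat.cast_ofNat, Nat.add_one_sub_one, pow_one]
    ring
  have d2 : ∀ s ∈ Icc (0 : ℝ) 1, HasDerivAt (fun s => 2 * inner ℝ (x s - p) (v s) - 8 * r ^ 2 * s)
      (2 * (inner ℝ (x s - p) (-B (x s) (v s) (v s)) + inner ℝ (v s) (v s)) - 8 * r ^ 2) s :=
    fun s hs => by
    have h1 := (((h.hasDerivAt s hs).sub_const p).inner ℝ (h.hasDerivAt_velocity s hs)).const_mul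
      (2 : ℝ)
    have h2 := (hasDerivAt_id s).const_mul (8 * r ^ 2)
    rw [mul_one] at h2
    exact h1.sub h2
  have pos : ∀ s ∈ Icc (0 : ℝ) 1,
      0 ≤ 2 * (inner ℝ (x s - p) (-B (x s) (v s) (v s)) + inner ℝ (v s) (v s)) - 8 * r ^ 2 :=
    fun s hs => by
    have h1 : |inner ℝ (x s - p) (-B (x s) (v s) (v s))| ≤ r * (K * ‖v s‖ * ‖v s‖) := by
      refine (abs_real_inner_le_norm _ _).trans ?_
      rw [norm_neg]
      refine mul_le_mul (hd s hs).le ?_ (norm_nonneg _) hr.le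
      exact ContinuousLinearMap.le_of_opNorm₂_le_of_le _ (hx s hs).2 le_rfl le_rfl
    have h2 := (abs_le.1 h1).1
    have h3 := hcon s hs
    rw [real_inner_self_eq_norm_sq]
    have h4 : 2 * (r * K) * ‖v s‖ ^ 2 ≤ 1 * ‖v s‖ ^ 2 := by gcongr
    nlinarith
  have hint : interior (Icc (0 : ℝ) 1) ⊆ Icc 0 1 := interior_subset
  have hconv : ConvexOn ℝ (Icc (0 : ℝ) 1) (fun s => ‖x s - p‖ ^ 2 - 4 * r ^ 2 * s ^ 2) :=
    convexOn_of_hasDerivWithinAt2_nonneg (convex_Icc 0 1)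
      (fun s hs => (d1 s hs).continuousAt.continuousWithinAt)
      (fun s hs => (d1 s (hint hs)).hasDerivWithinAt)
      (fun s hs => (d2 s (hint hs)).hasDerivWithinAt) (fun s hs => pos s (hint hs))
  have := hconv.2 m0 m1 (by norm_num : (0 : ℝ) ≤ 1 / 2) (by norm_num : (0 : ℝ) ≤ 1 / 2)
    (by norm_num)
  norm_num at this
  have a0 := hd 0 m0
  have a1 := hd 1 m1
  have b0 : ‖x 0 - p‖ ^ 2 < r ^ 2 := by gcongr
  have b1 : ‖x 1 - p‖ ^ 2 < r ^ 2 := by gcongr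
  have b2 := sq_nonneg ‖x (1 / 2) - p‖
  nlinarith

/-- A geodesic that stays in a small ball during the parameter interval `[0,1]` is slow. -/
theorem IsGeodesicCurve.norm_velocity_le {x v : ℝ → E} (h : IsGeodesicCurve B (Icc 0 1) x v)
    (hx : ∀ s ∈ Icc (0 : ℝ) 1, x s ∈ ball p r ∧ ‖B (x s)‖ ≤ K) (hrK : 6 * (r * K) ≤ 1) {s : ℝ}
    (hs : s ∈ Icc (0 : ℝ) 1) : ‖v s‖ ≤ 6 * r := by
  have m0 : (0 : ℝ) ∈ Icc (0 : ℝ) 1 := left_mem_Icc.2 zero_le_one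
  have hr : 0 < r := pos_of_mem_ball (hx 0 m0).1
  have hK : 0 ≤ K := (norm_nonneg _).trans (hx 0 m0).2
  obtain ⟨s₀, hs₀, hv₀⟩ := h.exists_norm_sq_le hx (by nlinarith [mul_nonneg hr.le hK])
  set F : ℝ → ℝ := fun s => r ^ 2 + ‖v s‖ ^ 2 with hF
  have hFpos : ∀ s, 0 < F s := fun s => by positivity
  have dF : ∀ s ∈ Icc (0 : ℝ) 1, HasDerivAt F (2 * inner ℝ (v s) (-B (x s) (v s) (v s))) s :=
    fun s hs => ((h.hasDerivAt_velocity s hs).norm_sq).const_add _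
  have dG : ∀ s ∈ Icc (0 : ℝ) 1, HasDerivAt (fun s => (Real.sqrt (F s))⁻¹)
      (-(2 * inner ℝ (v s) (-B (x s) (v s) (v s)) / (2 * Real.sqrt (F s))) /
        Real.sqrt (F s) ^ 2) s := fun s hs =>
    ((dF s hs).sqrt (hFpos s).ne').inv (Real.sqrt_pos.2 (hFpos s)).ne'
  have bG : ∀ s ∈ Icc (0 : ℝ) 1, ‖-(2 * inner ℝ (v s) (-B (x s) (v s) (v s)) /
      (2 * Real.sqrt (F s))) / Real.sqrt (F s) ^ 2‖ ≤ K := fun s hs => by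
    have hsq : 0 < Real.sqrt (F s) := Real.sqrt_pos.2 (hFpos s)
    have hvs : ‖v s‖ ≤ Real.sqrt (F s) := by
      apply Real.le_sqrt_of_sq_le
      simp only [hF]; nlinarith
    have h1 : |inner ℝ (v s) (-B (x s) (v s) (v s))| ≤
        Real.sqrt (F s) * (K * Real.sqrt (F s) * Real.sqrt (F s)) := by
      refine (abs_real_inner_le_norm _ _).trans ?_
      rw [norm_neg]
      refine mul_le_mul hvs ?_ (norm_nonneg _) hsq.le
      exact ContinuousLinearMap.le_of_opNorm₂_le_of_le _ (hx s hs).2 hvs hvs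
    rw [Real.norm_eq_abs, abs_div, abs_neg, abs_div, abs_mul, abs_two, abs_mul, abs_two,
      abs_of_pos hsq, abs_of_pos (pow_pos hsq 2), div_le_iff₀ (by positivity),
      div_le_iff₀ (by positivity)]
    nlinarith
  have hmv := norm_image_sub_le_of_norm_deriv_le_Icc dG bG hs hs₀
  have habs : |s - s₀| ≤ 1 := by
    rw [abs_le]; constructor <;> linarith [hs.1, hs.2, hs₀.1, hs₀.2]
  have h1 : (Real.sqrt (F s₀))⁻¹ - (Real.sqrt (F s))⁻¹ ≤ K := by
    have h2 := (abs_le.1 hmv).1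
    have h3 : K * |s - s₀| ≤ K := mul_le_of_le_one_right hK habs
    linarith
  have h2 : Real.sqrt (F s₀) ≤ 3 * r := by
    rw [Real.sqrt_le_left (by positivity)]
    simp only [hF]; nlinarith
  have h3 : (3 * r)⁻¹ ≤ (Real.sqrt (F s₀))⁻¹ :=
    inv_anti₀ (Real.sqrt_pos.2 (hFpos s₀)) h2
  have h4 : K ≤ (6 * r)⁻¹ := by
    rw [← one_div, le_div_iff₀ (by positivity)]
    linarith
  have hsq : 0 < Real.sqrt (F s) := Real.sqrt_pos.2 (hFpos s)
  have h5 : (6 * r)⁻¹ ≤ (Real.sqrt (F s))⁻¹ := by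
    have h6 : (3 * r)⁻¹ = (6 * r)⁻¹ + (6 * r)⁻¹ := by
      field_simp
      norm_num
    linarith
  have h6 : Real.sqrt (F s) ≤ 6 * r := (inv_le_inv₀ (by positivity) hsq).1 h5
  refine le_trans (Real.le_sqrt_of_sq_le ?_) h6
  simp only [hF]; nlinarith

/-- Geodesics that stay in a small ball are determined by their end points. -/
theorem exists_geodesic_unique {O : Set E} (hO : IsOpen O) (hp : p ∈ O)
    (hB : ContDiffOn ℝ ∞ B O) :
    ∃ r > 0, ball p r ⊆ O ∧ ∀ x v y w : ℝ → E, IsGeodesicCurve B (Icc 0 1) x v →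
      IsGeodesicCurve B (Icc 0 1) y w → MapsTo x (Icc 0 1) (ball p r) →
      MapsTo y (Icc 0 1) (ball p r) → x 0 = y 0 → x 1 = y 1 →
      EqOn x y (Icc 0 1) ∧ EqOn v w (Icc 0 1) := by
  obtain ⟨K, hK, δ, hδ, hb⟩ :=
    ((hB.contDiffAt (hO.mem_nhds hp)).of_le (m := 1) (by norm_cast)).exists_lipschitz_bound
  obtain ⟨δ', hδ', hb'⟩ := Metric.isOpen_iff.1 hO p hp
  have hK' : 0 < (96 * K)⁻¹ := by positivity
  set r := min (min δ δ') (min 1 (96 * K)⁻¹) with hr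
  have r0 : 0 < r := by positivity
  have r1 : r ≤ 1 := (min_le_right _ _).trans (min_le_left _ _)
  have rK : 96 * (r * K) ≤ 1 := by
    have h1 : r ≤ (96 * K)⁻¹ := (min_le_right _ _).trans (min_le_right _ _)
    have h2 := mul_le_mul_of_nonneg_right h1 (by positivity : 0 ≤ 96 * K)
    rw [inv_mul_cancel₀ (by positivity)] at h2
    linarith
  have hrδ : ball p r ⊆ ball p δ := ball_subset_ball ((min_le_left _ _).trans (min_le_left _ _))
  refine ⟨r, r0, (ball_subset_ball ((min_le_left _ _).trans (min_le_right _ _))).trans hb',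
    fun x v y w hx hy hxm hym h0 h1 => ?_⟩
  have m0 : (0 : ℝ) ∈ Icc (0 : ℝ) 1 := left_mem_Icc.2 zero_le_one
  have m1 : (1 : ℝ) ∈ Icc (0 : ℝ) 1 := right_mem_Icc.2 zero_le_one
  have habs : ∀ s ∈ Icc (0 : ℝ) 1, ∀ t ∈ Icc (0 : ℝ) 1, |s - t| ≤ 1 := fun s hs t ht => by
    rw [abs_le]; constructor <;> linarith [hs.1, hs.2, ht.1, ht.2]
  have hv : ∀ s ∈ Icc (0 : ℝ) 1, ‖v s‖ ≤ 6 * r := fun s hs =>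
    hx.norm_velocity_le (fun s hs => ⟨hxm hs, (hb _ (hrδ (hxm hs))).1⟩) (by nlinarith) hs
  have hw : ∀ s ∈ Icc (0 : ℝ) 1, ‖w s‖ ≤ 6 * r := fun s hs =>
    hy.norm_velocity_le (fun s hs => ⟨hym hs, (hb _ (hrδ (hym hs))).1⟩) (by nlinarith) hs
  have dz : ∀ s ∈ Icc (0 : ℝ) 1, HasDerivAt (fun s => x s - y s) (v s - w s) s := fun s hs =>
    (hx.hasDerivAt s hs).sub (hy.hasDerivAt s hs)
  have dz' : ∀ s ∈ Icc (0 : ℝ) 1, HasDerivAt (fun s => v s - w s)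
      (-B (x s) (v s) (v s) - -B (y s) (w s) (w s)) s := fun s hs =>
    (hx.hasDerivAt_velocity s hs).sub (hy.hasDerivAt_velocity s hs)
  obtain ⟨s₀, hs₀, hmax⟩ := isCompact_Icc.exists_isMaxOn ⟨0, m0⟩
    (f := fun s => ‖v s - w s‖) (s := Icc (0 : ℝ) 1)
    (fun s hs => (dz' s hs).continuousAt.norm.continuousWithinAt)
  set m := ‖v s₀ - w s₀‖ with hm
  have hle : ∀ s ∈ Icc (0 : ℝ) 1, ‖v s - w s‖ ≤ m := fun s hs => hmax hs
  have hmn : 0 ≤ m := norm_nonneg _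
  have hz : ∀ s ∈ Icc (0 : ℝ) 1, ‖x s - y s‖ ≤ m := fun s hs => by
    have h2 := norm_image_sub_le_of_norm_deriv_le_Icc dz hle hs m0
    rw [h0, sub_self, sub_zero] at h2
    exact h2.trans (mul_le_of_le_one_right hmn (habs s hs 0 m0))
  have hacc : ∀ s ∈ Icc (0 : ℝ) 1,
      ‖-B (x s) (v s) (v s) - -B (y s) (w s) (w s)‖ ≤ m / 2 := fun s hs => by
    have e1 : -B (x s) (v s) (v s) - -B (y s) (w s) (w s) = -((B (x s) - B (y s)) (v s) (v s)
        + (B (y s) (v s - w s) (v s) + B (y s) (w s) (v s - w s))) := by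
      simp only [sub_apply, map_sub]
      abel
    have b1 : ‖(B (x s) - B (y s)) (v s) (v s)‖ ≤ K * m * (6 * r) * (6 * r) :=
      ContinuousLinearMap.le_of_opNorm₂_le_of_le _
        (((hb _ (hrδ (hxm hs))).2 _ (hrδ (hym hs))).trans (by gcongr; exact hz s hs))
        (hv s hs) (hv s hs)
    have b2 : ‖B (y s) (v s - w s) (v s)‖ ≤ K * m * (6 * r) :=
      ContinuousLinearMap.le_of_opNorm₂_le_of_le _ (hb _ (hrδ (hym hs))).1 (hle s hs) (hv s hs)
    have b3 : ‖B (y s) (w s) (v s - w s)‖ ≤ K * (6 * r) * m :=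
      ContinuousLinearMap.le_of_opNorm₂_le_of_le _ (hb _ (hrδ (hym hs))).1 (hw s hs) (hle s hs)
    rw [e1, norm_neg]
    refine (norm_add_le _ _).trans ?_
    have b4 := norm_add_le (B (y s) (v s - w s) (v s)) (B (y s) (w s) (v s - w s))
    have b5 : r * (r * K * m) ≤ 1 * (r * K * m) := by gcongr
    have b6 : 96 * (r * K) * m ≤ 1 * m := by gcongr
    linarith
  have hm0 : m = 0 := by
    have d3 : ∀ s ∈ Icc (0 : ℝ) 1, HasDerivAt (fun s => (x s - y s) - s • (v s₀ - w s₀))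
        ((v s - w s) - (v s₀ - w s₀)) s := fun s hs => by
      have h2 := (dz s hs).sub ((hasDerivAt_id s).smul_const (v s₀ - w s₀))
      rw [one_smul] at h2
      exact h2
    have h2 := norm_image_sub_le_of_norm_deriv_le_Icc d3 (K := m / 2) (fun s hs =>
      (norm_image_sub_le_of_norm_deriv_le_Icc dz' hacc hs hs₀).trans
        (mul_le_of_le_one_right (by positivity) (habs s hs s₀ hs₀))) m1 m0
    rw [h0, h1] at h2
    simp only [sub_self, one_smul, zero_smul, zero_sub, sub_zero, norm_neg, abs_one,
      mul_one] at h2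
    linarith
  constructor <;> intro s hs
  · have := hz s hs
    rw [hm0] at this
    exact sub_eq_zero.1 (norm_le_zero_iff.1 this)
  · have := hle s hs
    rw [hm0] at this
    exact sub_eq_zero.1 (norm_le_zero_iff.1 this)

end Whitehead

end

section

/-! ### Static metrics and their null geodesics -/

/-- A function with positive derivative on a neighbourhood of `[0,1]` that fixes `0` and `1` has a
differentiable inverse on `[0,1]`. -/
theorem exists_inverse_of_deriv_pos {f f' : ℝ → ℝ} {J : Set ℝ} (hJ : IsOpen J)
    (hsub : Icc 0 1 ⊆ J) (hf : ∀ s ∈ J, HasDerivAt f (f' s) s) (hpos : ∀ s ∈ J, 0 < f' s)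
    (h0 : f 0 = 0) (h1 : f 1 = 1) :
    ∃ κ : ℝ → ℝ, MapsTo κ (Icc 0 1) (Icc 0 1) ∧ (∀ s ∈ Icc (0 : ℝ) 1, f s ∈ Icc (0 : ℝ) 1 ∧
      κ (f s) = s) ∧ ∀ u ∈ Icc (0 : ℝ) 1, f (κ u) = u ∧ HasDerivAt κ (f' (κ u))⁻¹ u := by
  have m0 : (0 : ℝ) ∈ Icc (0 : ℝ) 1 := left_mem_Icc.2 zero_le_one
  have m1 : (1 : ℝ) ∈ Icc (0 : ℝ) 1 := right_mem_Icc.2 zero_le_one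
  obtain ⟨ε, hε, hεJ⟩ := isCompact_Icc.exists_thickening_subset_open hJ hsub
  set T : Set ℝ := Ioo (-ε) (1 + ε) with hT
  have hIT : Icc (0 : ℝ) 1 ⊆ T := fun s hs => ⟨by linarith [hs.1], by linarith [hs.2]⟩
  have hTJ : T ⊆ J := fun s hs => hεJ <| by
    rw [mem_thickening_iff]
    refine ⟨max 0 (min s 1), ⟨le_max_left _ _, max_le zero_le_one (min_le_right _ _)⟩, ?_⟩
    rw [Real.dist_eq, abs_lt]
    rcases le_total s 0 with h | h
    · rw [min_eq_left (h.trans zero_le_one), max_eq_left h]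
      constructor <;> linarith [hs.1]
    · rw [max_eq_right (le_min h zero_le_one)]
      rcases le_total s 1 with h' | h'
      · rw [min_eq_left h']; constructor <;> linarith
      · rw [min_eq_right h']; constructor <;> linarith [hs.2]
  have hfc : ContinuousOn f T := fun s hs => (hf s (hTJ hs)).continuousAt.continuousWithinAt
  have hmono : StrictMonoOn f T := by
    refine strictMonoOn_of_deriv_pos (convex_Ioo _ _) hfc fun s hs => ?_
    rw [interior_Ioo] at hs
    rw [(hf s (hTJ hs)).deriv]
    exact hpos s (hTJ hs)
  set κ := Function.invFunOn f T with hκ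
  have hinv : ∀ s ∈ T, κ (f s) = s := fun s hs => hmono.injOn.leftInvOn_invFunOn hs
  have hκmono : StrictMonoOn κ (f '' T) := by
    rintro _ ⟨s, hs, rfl⟩ _ ⟨t, ht, rfl⟩ hst
    rw [hinv s hs, hinv t ht]
    exact (hmono.lt_iff_lt hs ht).1 hst
  have himg : κ '' (f '' T) = T := by
    rw [image_image]
    exact (image_congr hinv).trans (image_id' T)
  have hnhds : ∀ s ∈ T, f '' T ∈ 𝓝 (f s) := fun s hs => by
    obtain ⟨a, ha, has⟩ := exists_between hs.1
    obtain ⟨b, hsb, hb⟩ := exists_between hs.2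
    have hab : Icc a b ⊆ T := fun r hr => ⟨ha.trans_le hr.1, hr.2.trans_lt hb⟩
    have haT : a ∈ T := hab ⟨le_rfl, (has.trans hsb).le⟩
    have hbT : b ∈ T := hab ⟨(has.trans hsb).le, le_rfl⟩
    refine mem_of_superset (Icc_mem_nhds (hmono haT hs has) (hmono hs hbT hsb)) ?_
    exact (intermediate_value_Icc (has.trans hsb).le (hfc.mono hab)).trans (image_mono hab)
  have hsurj : ∀ u ∈ Icc (0 : ℝ) 1, ∃ s ∈ Icc (0 : ℝ) 1, f s = u := fun u hu => by
    have := intermediate_value_Icc zero_le_one (hfc.mono hIT)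
    rw [h0, h1] at this
    exact this hu
  refine ⟨κ, fun u hu => ?_, fun s hs => ⟨⟨?_, ?_⟩, hinv s (hIT hs)⟩, fun u hu => ?_⟩
  · obtain ⟨s, hs, rfl⟩ := hsurj u hu
    rwa [hinv s (hIT hs)]
  · rw [← h0]
    exact hmono.monotoneOn (hIT m0) (hIT hs) hs.1
  · rw [← h1]
    exact hmono.monotoneOn (hIT hs) (hIT m1) hs.2
  · obtain ⟨s, hs, rfl⟩ := hsurj u hu
    have hsT := hIT hs
    rw [hinv s hsT]
    refine ⟨rfl, ?_⟩
    have hc : ContinuousAt κ (f s) := hκmono.continuousAt_of_image_mem_nhds (hnhds s hsT) <| by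
      rw [himg, hinv s hsT]
      exact isOpen_Ioo.mem_nhds hsT
    refine HasDerivAt.of_local_left_inverse (f := f) hc ?_ (hpos s (hTJ hsT)).ne' ?_
    · rw [hinv s hsT]
      exact hf s (hTJ hsT)
    · filter_upwards [hnhds s hsT] with y hy
      obtain ⟨r, hr, rfl⟩ := hy
      rw [hinv r hr]

section Static

variable {E : Type*} [NormedAddCommGroup E] [NormedSpace ℝ E]

theorem fderiv_form_symm {G : E → E →L[ℝ] E →L[ℝ] ℝ} {y : E} (hG : DifferentiableAt ℝ G y)
    (hsymm : ∀ᶠ z in 𝓝 y, ∀ a b, G z a b = G z b a) (u a b : E) :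
    fderiv ℝ G y u a b = fderiv ℝ G y u b a := by
  have h1 : ∀ a b, HasFDerivAt (fun z => G z a b) (((fderiv ℝ G y).flip a).flip b) y :=
    fun a b => by
    have := ((hG.hasFDerivAt.clm_apply (hasFDerivAt_const a y)).clm_apply (hasFDerivAt_const b y))
    refine this.congr_fderiv ?_
    ext; simp
  have h2 := (h1 a b).unique ((h1 b a).congr_of_eventuallyEq
    (hsymm.mono fun z hz => hz a b))
  simpa using congrArg (fun L => L u) h2

/-- A metric `H`, invariant under translations by the unit timelike vector `e`, for which the
one-form `-H(e,·)` is the differential of a time function `τ`. -/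
structure IsStaticMetric (H : E → E →L[ℝ] E →L[ℝ] ℝ) (e : E) (τ : E → ℝ) (Z : Set E) : Prop where
  isOpen : IsOpen Z
  add_smul_mem : ∀ y ∈ Z, ∀ t : ℝ, y + t • e ∈ Z
  contDiffOn : ContDiffOn ℝ ∞ H Z
  lorentz : ∀ y ∈ Z, IsLorentzForm (H y)
  self : ∀ y ∈ Z, H y e e = -1
  invariant : ∀ y ∈ Z, ∀ t : ℝ, H (y + t • e) = H y
  hasFDerivAt : ∀ y ∈ Z, HasFDerivAt τ (-(H y e)) y

namespace IsStaticMetric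

variable {H G : E → E →L[ℝ] E →L[ℝ] ℝ} {e y : E} {τ : E → ℝ} {Z O : Set E}

theorem differentiableAt (h : IsStaticMetric H e τ Z) (hy : y ∈ Z) : DifferentiableAt ℝ H y :=
  (h.contDiffOn.contDiffAt (h.isOpen.mem_nhds hy)).differentiableAt (by simp)

theorem hasDerivAt_line (t : ℝ) : HasDerivAt (fun t : ℝ => y + t • e) e t := by
  simpa using ((hasDerivAt_id t).smul_const e).const_add y

theorem time_add_smul (h : IsStaticMetric H e τ Z) (hy : y ∈ Z) (t : ℝ) :
    τ (y + t • e) = τ y + t := by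
  have hd : ∀ t : ℝ, HasDerivAt (fun t : ℝ => τ (y + t • e) - t) 0 t := fun t => by
    have h1 := ((h.hasFDerivAt _ (h.add_smul_mem y hy t)).comp_hasDerivAt t
      (hasDerivAt_line t)).sub (hasDerivAt_id t)
    refine h1.congr_deriv ?_
    rw [neg_apply, h.self _ (h.add_smul_mem y hy t)]
    norm_num
  have := is_const_of_deriv_eq_zero (fun t => (hd t).differentiableAt) (fun t => (hd t).deriv) t 0
  simp only [zero_smul, add_zero, sub_zero] at this
  linarith

theorem fderiv_self (h : IsStaticMetric H e τ Z) (hy : y ∈ Z) : fderiv ℝ H y e = 0 := by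
  have h1 : HasFDerivAt H (fderiv ℝ H y) (y + (0 : ℝ) • e) := by
    simpa using (h.differentiableAt hy).hasFDerivAt
  have h2 : HasDerivAt (fun t : ℝ => H (y + t • e)) (fderiv ℝ H y e) 0 :=
    h1.comp_hasDerivAt (0 : ℝ) (hasDerivAt_line (y := y) (e := e) 0)
  refine h2.unique ?_
  simp only [h.invariant y hy]
  exact hasDerivAt_const _ _

theorem fderiv_closed (h : IsStaticMetric H e τ Z) (hy : y ∈ Z) (u w : E) :
    fderiv ℝ H y u e w = fderiv ℝ H y w e u := by
  have h1 : HasFDerivAt (fun z => -(H z e)) (-((fderiv ℝ H y).flip e)) y := by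
    have := ((h.differentiableAt hy).hasFDerivAt.clm_apply (hasFDerivAt_const e y)).neg
    refine this.congr_fderiv ?_
    ext; simp
  have := second_derivative_symmetric_of_eventually (f := τ)
    ((h.isOpen.eventually_mem hy).mono fun z hz => h.hasFDerivAt z hz) h1 u w
  simpa using this

theorem fderiv_symm (h : IsStaticMetric H e τ Z) (hy : y ∈ Z) (u a b : E) :
    fderiv ℝ H y u a b = fderiv ℝ H y u b a :=
  fderiv_form_symm (h.differentiableAt hy)
    ((h.isOpen.eventually_mem hy).mono fun z hz => (h.lorentz z hz).symm) u a b

theorem connection_left (h : IsStaticMetric H e τ Z) (hy : y ∈ Z) (u : E) :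
    connection H y e u = 0 := by
  have : chrForm H y e u = 0 := by
    ext w
    rw [chrForm_apply, h.fderiv_self hy, h.fderiv_closed hy u w]
    simp
  rw [connection_apply, this, map_zero]

theorem connection_right (h : IsStaticMetric H e τ Z) (hy : y ∈ Z) (u : E) :
    connection H y u e = 0 := by
  have : chrForm H y u e = 0 := by
    ext w
    rw [chrForm_apply, h.fderiv_self hy, h.fderiv_closed hy u w, h.fderiv_symm hy w u e]
    simp
  rw [connection_apply, this, map_zero]

theorem connection_add_smul (h : IsStaticMetric H e τ Z) (hy : y ∈ Z) (t : ℝ) :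
    connection H (y + t • e) = connection H y := by
  have h1 : fderiv ℝ H (y + t • e) = fderiv ℝ H y := by
    rw [← fderiv_comp_add_right]
    exact EventuallyEq.fderiv_eq ((h.isOpen.eventually_mem hy).mono fun z hz =>
      h.invariant z hz t)
  ext u v
  rw [connection_apply, connection_apply, h.invariant y hy, chrForm, chrForm, h1]

variable [FiniteDimensional ℝ E]

/-- The connection of a conformally rescaled metric on null vectors. -/
theorem connection_conformal (h : IsStaticMetric H e τ Z) (hO : IsOpen O) (hOZ : O ⊆ Z)
    (hG : ContDiffOn ℝ ∞ G O) (hL : ∀ y ∈ O, IsLorentzForm (G y)) (hN : ∀ y ∈ O, G y e e < 0)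
    (hGH : EqOn H (unitMetric G e) O) (hy : y ∈ O) {v : E} (hv : H y v v = 0) :
    connection G y v v = connection H y v v + (-fderiv ℝ G y v e e / -G y e e) • v := by
  have hH : fderiv ℝ H y = fderiv ℝ (unitMetric G e) y :=
    EventuallyEq.fderiv_eq ((hO.eventually_mem hy).mono fun z hz => hGH hz)
  have hNy : G y e e ≠ 0 := (hN y hy).ne
  have key : -(connection H y v v + (-fderiv ℝ G y v e e / -G y e e) • v) =
      -connection G y v v := by
    rw [eq_neg_connection_iff (hL y hy).isInvertible]
    intro w
    have h1 : G y = (-G y e e) • H y := by rw [hGH hy]; exact eq_smul_unitMetric (hN y hy)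
    have h2 : ∀ a b, G y a b = (-G y e e) * H y a b := fun a b => by
      conv_lhs => rw [h1]
      simp
    have h3 := metric_connection (h.lorentz y (hOZ hy)).isInvertible v v w
    rw [chrForm_apply] at h3
    have h4 := fderiv_eq_unitMetric hO hG hN hy v v w
    have h5 := fderiv_eq_unitMetric hO hG hN hy w v v
    rw [← hGH hy, ← hH] at h4 h5
    rw [hv] at h5
    rw [chrForm_apply, h2, h4, h5]
    simp only [map_neg, map_add, map_smul, neg_apply, add_apply, smul_apply, smul_eq_mul, h3]
    field_simp
    ring
  exact (neg_injective key).symm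

set_option maxHeartbeats 1000000 in
/-- The projection of a null geodesic along the static flow to a hypersurface `τ = const`, properly
parametrized, is a geodesic. -/
theorem exists_projection (h : IsStaticMetric H e τ Z) (hO : IsOpen O) (hOZ : O ⊆ Z)
    (hG : ContDiffOn ℝ ∞ G O) (hL : ∀ y ∈ O, IsLorentzForm (G y)) (hN : ∀ y ∈ O, G y e e < 0)
    (hGH : EqOn H (unitMetric G e) O) {J : Set ℝ} {x v : ℝ → E} (hx : IsNullRay G e O J x v) :
    ∃ A > 0, ∃ (κ : ℝ → ℝ) (w : ℝ → E), τ (x 0) < τ (x 1) ∧ MapsTo κ (Icc 0 1) (Icc 0 1) ∧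
      κ 0 = 0 ∧ κ 1 = 1 ∧ (∀ s ∈ Icc (0 : ℝ) 1, ∃ u ∈ Icc (0 : ℝ) 1, κ u = s) ∧
      (∀ u ∈ Icc (0 : ℝ) 1, HasDerivAt κ (A * -G (x (κ u)) e e) u ∧
        τ (x (κ u)) = τ (x 0) + (τ (x 1) - τ (x 0)) * u ∧
        H (x (κ u) - τ (x (κ u)) • e) (w u) (w u) = (τ (x 1) - τ (x 0)) ^ 2) ∧
      IsGeodesicCurve (connection H) (Icc 0 1) (fun u => x (κ u) - τ (x (κ u)) • e) w := by
  have m0 : (0 : ℝ) ∈ Icc (0 : ℝ) 1 := left_mem_Icc.2 zero_le_one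
  have m1 : (1 : ℝ) ∈ Icc (0 : ℝ) 1 := right_mem_Icc.2 zero_le_one
  have hNp : ∀ y ∈ O, 0 < -G y e e := fun y hy => neg_pos.2 (hN y hy)
  have hGH' : ∀ y ∈ O, ∀ a b, G y a b = (-G y e e) * H y a b := fun y hy a b => by
    have h1 : G y = (-G y e e) • H y := by rw [hGH hy]; exact eq_smul_unitMetric (hN y hy)
    conv_lhs => rw [h1]
    simp
  have hdG : ∀ y ∈ O, HasFDerivAt G (fderiv ℝ G y) y := fun y hy =>
    ((hG.contDiffAt (hO.mem_nhds hy)).differentiableAt (by simp)).hasFDerivAt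
  have hxO : ∀ s ∈ J, x s ∈ O := hx.mapsTo
  have hxZ : ∀ s ∈ J, x s ∈ Z := fun s hs => hOZ (hx.mapsTo hs)
  have hnull : ∀ s ∈ J, H (x s) (v s) (v s) = 0 := fun s hs => by
    have h1 := hx.null s hs
    rw [hGH' _ (hxO s hs)] at h1
    exact (mul_eq_zero.1 h1).resolve_left (hNp _ (hxO s hs)).ne'
  have dN : ∀ s ∈ J, HasDerivAt (fun s => G (x s) e e) (fderiv ℝ G (x s) (v s) e e) s :=
    fun s hs => by
    have h1 : HasDerivAt (fun t => G (x t)) (fderiv ℝ G (x s) (v s)) s :=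
      (hdG _ (hxO s hs)).comp_hasDerivAt s (hx.geodesic.hasDerivAt s hs)
    refine ((h1.clm_apply (hasDerivAt_const s e)).clm_apply
      (hasDerivAt_const s e)).congr_deriv ?_
    simp
  -- the energy is conserved
  have hE : ∀ s ∈ Icc (0 : ℝ) 1, G (x s) e (v s) = G (x 0) e (v 0) := fun s hs => by
    have hd : ∀ s ∈ Icc (0 : ℝ) 1, HasDerivAt (fun s => G (x s) e (v s)) 0 s := fun s hs => by
      have hsJ := hx.subset hs
      have hO' := hxO s hsJ
      have h1 : HasDerivAt (fun t => G (x t)) (fderiv ℝ G (x s) (v s)) s :=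
        (hdG _ hO').comp_hasDerivAt s (hx.geodesic.hasDerivAt s hsJ)
      have h2 := (h1.clm_apply (hasDerivAt_const s e)).clm_apply
        (hx.geodesic.hasDerivAt_velocity s hsJ)
      refine h2.congr_deriv ?_
      have h3 := metric_connection (hL _ hO').isInvertible (v s) (v s) e
      have hH : fderiv ℝ H (x s) = fderiv ℝ (unitMetric G e) (x s) :=
        EventuallyEq.fderiv_eq ((hO.eventually_mem hO').mono fun z hz => hGH hz)
      have h4 := fderiv_eq_unitMetric hO hG hN hO' e (v s) (v s)
      rw [← hGH hO', ← hH, hnull s hsJ, h.fderiv_self (hOZ hO')] at h4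
      rw [chrForm_apply, h4, fderiv_form_symm (hdG _ hO').differentiableAt
        ((hO.eventually_mem hO').mono fun z hz => (hL z hz).symm) (v s) (v s) e] at h3
      simp only [add_apply, map_neg, neg_apply, (hL _ hO').symm e, h3, map_zero, zero_apply]
      ring
    have := norm_image_sub_le_of_norm_deriv_le_Icc hd (K := 0) (fun s _ => by simp) hs m0
    rw [zero_mul, norm_le_zero_iff, sub_eq_zero] at this
    exact this
  set P := -G (x 0) e (v 0) with hP
  have hPpos : 0 < P := neg_pos.2 (hx.future 0 (hx.subset m0))
  have dτ : ∀ s ∈ J, HasDerivAt (fun s => τ (x s)) (-(H (x s) e (v s))) s := fun s hs =>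
    (h.hasFDerivAt _ (hxZ s hs)).comp_hasDerivAt s (hx.geodesic.hasDerivAt s hs)
  have dpos : ∀ s ∈ J, 0 < -(H (x s) e (v s)) := fun s hs => by
    have h1 := hx.future s hs
    rw [hGH' _ (hxO s hs)] at h1
    have := hNp _ (hxO s hs)
    by_contra hcon
    nlinarith
  have hlt : τ (x 0) < τ (x 1) := by
    have : StrictMonoOn (fun s => τ (x s)) (Icc 0 1) := by
      refine strictMonoOn_of_deriv_pos (convex_Icc _ _)
        (fun s hs => (dτ s (hx.subset hs)).continuousAt.continuousWithinAt) fun s hs => ?_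
      have hs' := hx.subset (interior_subset hs)
      rw [(dτ s hs').deriv]
      exact dpos s hs'
    exact this m0 m1 zero_lt_one
  set L := τ (x 1) - τ (x 0) with hLdef
  have hLpos : 0 < L := sub_pos.2 hlt
  obtain ⟨κ, hκm, hκs, hκ⟩ := exists_inverse_of_deriv_pos
    (f := fun s => (τ (x s) - τ (x 0)) / L) (f' := fun s => -(H (x s) e (v s)) / L)
    hx.isOpen hx.subset (fun s hs => ((dτ s hs).sub_const _).div_const L)
    (fun s hs => div_pos (dpos s hs) hLpos) (by simp) (div_self hLpos.ne')
  have hfac : ∀ u ∈ Icc (0 : ℝ) 1,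
      L / P * -G (x (κ u)) e e * -(H (x (κ u)) e (v (κ u))) = L := fun u hu => by
    have h1 := hE _ (hκm hu)
    rw [hGH' _ (hxO _ (hx.subset (hκm hu)))] at h1
    have h2 : -G (x (κ u)) e e * -(H (x (κ u)) e (v (κ u))) = P := by rw [hP, ← h1]; ring
    rw [mul_assoc, h2, div_mul_cancel₀ _ hPpos.ne']
  have dκ : ∀ u ∈ Icc (0 : ℝ) 1, HasDerivAt κ (L / P * -G (x (κ u)) e e) u := fun u hu => by
    refine (hκ u hu).2.congr_deriv ?_
    have h1 := hfac u hu
    have h2 := dpos _ (hx.subset (hκm hu))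
    rw [inv_div, div_eq_iff h2.ne']
    exact h1.symm
  have hu0 : κ 0 = 0 := by simpa using (hκs 0 m0).2
  have hu1 : κ 1 = 1 := by simpa [hLpos.ne', ← hLdef] using (hκs 1 m1).2
  refine ⟨L / P, div_pos hLpos hPpos, κ,
    fun u => (L / P * -G (x (κ u)) e e) • v (κ u) - L • e, hlt, hκm, hu0, hu1,
    fun s hs => ⟨_, hκs s hs⟩, fun u hu => ⟨dκ u hu, ?_, ?_⟩, fun u hu => ?_, fun u hu => ?_⟩
  · have h1 := (hκ u hu).1
    rw [div_eq_iff hLpos.ne'] at h1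
    linarith
  · have hJ := hx.subset (hκm hu)
    have h1 : H (x (κ u) - τ (x (κ u)) • e) = H (x (κ u)) := by
      rw [sub_eq_add_neg, ← neg_smul]
      exact h.invariant _ (hxZ _ hJ) _
    have h2 := hfac u hu
    rw [h1]
    simp only [map_sub, map_smul, sub_apply, smul_apply, smul_eq_mul, hnull _ hJ,
      h.self _ (hxZ _ hJ), (h.lorentz _ (hxZ _ hJ)).symm (v (κ u)) e]
    linear_combination 2 * L * h2
  · have hJ := hx.subset (hκm hu)
    have h1 := (hx.geodesic.hasDerivAt _ hJ).scomp u (dκ u hu)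
    have h2 := ((dτ _ hJ).comp u (dκ u hu)).smul_const e
    rw [mul_comm, hfac u hu] at h2
    exact h1.sub h2
  · have hJ := hx.subset (hκm hu)
    have h1 := (hx.geodesic.hasDerivAt_velocity _ hJ).scomp u (dκ u hu)
    have h3 := ((dN _ hJ).comp u (dκ u hu)).neg.const_mul (L / P)
    refine ((h3.smul h1).sub_const (L • e)).congr_deriv ?_
    have h4 : connection H (x (κ u) - τ (x (κ u)) • e) = connection H (x (κ u)) := by
      rw [sub_eq_add_neg, ← neg_smul]
      exact h.connection_add_smul (hxZ _ hJ) _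
    rw [h4, h.connection_conformal hO hOZ hG hL hN hGH (hxO _ hJ) (hnull _ hJ)]
    simp only [map_sub, map_smul, sub_apply, smul_apply, h.connection_left (hxZ _ hJ),
      h.connection_right (hxZ _ hJ)]
    have hne : G (x (κ u)) e e ≠ 0 := (hN _ (hxO _ hJ)).ne
    have hPne := hPpos.ne'
    simp only [Function.comp_apply, Pi.neg_apply, smul_zero, sub_zero]
    generalize connection H (x (κ u)) (v (κ u)) (v (κ u)) = b
    generalize fderiv ℝ G (x (κ u)) (v (κ u)) e e = d
    generalize G (x (κ u)) e e = a at hne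
    match_scalars <;> field_simp
    ring

end IsStaticMetric

end Static

end

section

namespace IsStaticMetric

variable {E : Type*} [NormedAddCommGroup E] [NormedSpace ℝ E] [FiniteDimensional ℝ E]
variable {H G : E → E →L[ℝ] E →L[ℝ] ℝ} {e y : E} {τ : E → ℝ} {Z O : Set E} {J J' : Set ℝ}
  {x v x' v' : ℝ → E}

omit [FiniteDimensional ℝ E] in
theorem sub_smul_mem (h : IsStaticMetric H e τ Z) (hy : y ∈ Z) : y - τ y • e ∈ Z ∩ τ ⁻¹' {0} := by
  rw [sub_eq_add_neg, ← neg_smul]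
  refine ⟨h.add_smul_mem y hy _, ?_⟩
  rw [mem_preimage, h.time_add_smul hy, mem_singleton_iff, add_neg_cancel]

/-- Light rays between the same two static lines, travelling in the same direction. -/
theorem nullRay_eqOn (h : IsStaticMetric H e τ Z) (hO : IsOpen O) (hOZ : O ⊆ Z)
    (hG : ContDiffOn ℝ ∞ G O) (hL : ∀ y ∈ O, IsLorentzForm (G y)) (hN : ∀ y ∈ O, G y e e < 0)
    (hGH : EqOn H (unitMetric G e) O)
    (hU : ∀ x v y w : ℝ → E, IsGeodesicCurve (connection H) (Icc 0 1) x v →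
      IsGeodesicCurve (connection H) (Icc 0 1) y w → MapsTo x (Icc 0 1) (Z ∩ τ ⁻¹' {0}) →
      MapsTo y (Icc 0 1) (Z ∩ τ ⁻¹' {0}) → x 0 = y 0 → x 1 = y 1 →
      EqOn x y (Icc 0 1) ∧ EqOn v w (Icc 0 1))
    (hx : IsNullRay G e O J x v) (hx' : IsNullRay G e O J' x' v')
    (h0 : x 0 - τ (x 0) • e = x' 0 - τ (x' 0) • e)
    (h1 : x 1 - τ (x 1) • e = x' 1 - τ (x' 1) • e) (h01 : x 0 = x' 0 ∨ x 1 = x' 1) :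
    EqOn x x' (Icc 0 1) := by
  have m0 : (0 : ℝ) ∈ Icc (0 : ℝ) 1 := left_mem_Icc.2 zero_le_one
  have m1 : (1 : ℝ) ∈ Icc (0 : ℝ) 1 := right_mem_Icc.2 zero_le_one
  obtain ⟨A, hA, κ, w, hlt, hm, k0, k1, hs, hu, hg⟩ :=
    h.exists_projection hO hOZ hG hL hN hGH hx
  obtain ⟨A', hA', κ', w', hlt', hm', k0', k1', hs', hu', hg'⟩ :=
    h.exists_projection hO hOZ hG hL hN hGH hx'
  obtain ⟨e1, e2⟩ := hU _ _ _ _ hg hg'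
    (fun u hu => h.sub_smul_mem (hOZ (hx.mapsTo (hx.subset (hm hu)))))
    (fun u hu => h.sub_smul_mem (hOZ (hx'.mapsTo (hx'.subset (hm' hu)))))
    (by simpa only [k0, k0'] using h0) (by simpa only [k1, k1'] using h1)
  have hLL : τ (x 1) - τ (x 0) = τ (x' 1) - τ (x' 0) := by
    have a1 := (hu 0 m0).2.2
    have a2 := (hu' 0 m0).2.2
    have a3 := e1 m0
    simp only at a3
    rw [a3, e2 m0, a2] at a1
    exact ((pow_left_inj₀ (sub_pos.2 hlt').le (sub_pos.2 hlt).le two_ne_zero).1 a1).symm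
  have hτ : τ (x 0) = τ (x' 0) := by
    rcases h01 with h01 | h01
    · rw [h01]
    · rw [h01] at hLL
      linarith
  have hy : ∀ u ∈ Icc (0 : ℝ) 1, x (κ u) = x' (κ' u) := fun u hI => by
    have a1 := e1 hI
    have a2 : τ (x (κ u)) = τ (x' (κ' u)) := by
      rw [(hu u hI).2.1, (hu' u hI).2.1, hLL, hτ]
    simp only [a2] at a1
    exact sub_left_injective a1
  have hκ : ∀ u ∈ Icc (0 : ℝ) 1, A' * κ u = A * κ' u := fun u hI => by
    have hd : ∀ u ∈ Icc (0 : ℝ) 1, HasDerivAt (fun u => A' * κ u - A * κ' u) 0 u :=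
      fun u hI => by
      refine (((hu u hI).1.const_mul A').sub ((hu' u hI).1.const_mul A)).congr_deriv ?_
      rw [hy u hI]
      ring
    have := norm_image_sub_le_of_norm_deriv_le_Icc hd (K := 0) (fun s _ => by simp) hI m0
    rw [zero_mul, norm_le_zero_iff, sub_eq_zero, k0, k0'] at this
    linarith
  have hAA : A' = A := by simpa [k1, k1'] using hκ 1 m1
  intro s hI
  obtain ⟨u, hI', rfl⟩ := hs s hI
  have a1 := hκ u hI'
  rw [hAA] at a1
  rw [hy u hI', mul_left_cancel₀ hA.ne' a1]

/-- Light rays between the same two static lines, travelling in opposite directions, take the same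
time. -/
theorem nullRay_time_eq (h : IsStaticMetric H e τ Z) (hO : IsOpen O) (hOZ : O ⊆ Z)
    (hG : ContDiffOn ℝ ∞ G O) (hL : ∀ y ∈ O, IsLorentzForm (G y)) (hN : ∀ y ∈ O, G y e e < 0)
    (hGH : EqOn H (unitMetric G e) O)
    (hU : ∀ x v y w : ℝ → E, IsGeodesicCurve (connection H) (Icc 0 1) x v →
      IsGeodesicCurve (connection H) (Icc 0 1) y w → MapsTo x (Icc 0 1) (Z ∩ τ ⁻¹' {0}) →
      MapsTo y (Icc 0 1) (Z ∩ τ ⁻¹' {0}) → x 0 = y 0 → x 1 = y 1 →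
      EqOn x y (Icc 0 1) ∧ EqOn v w (Icc 0 1))
    (hx : IsNullRay G e O J x v) (hx' : IsNullRay G e O J' x' v')
    (h0 : x 0 - τ (x 0) • e = x' 1 - τ (x' 1) • e)
    (h1 : x 1 - τ (x 1) • e = x' 0 - τ (x' 0) • e) :
    τ (x 1) - τ (x 0) = τ (x' 1) - τ (x' 0) := by
  have m0 : (0 : ℝ) ∈ Icc (0 : ℝ) 1 := left_mem_Icc.2 zero_le_one
  have m1 : (1 : ℝ) ∈ Icc (0 : ℝ) 1 := right_mem_Icc.2 zero_le_one
  have hrev : ∀ s ∈ Icc (0 : ℝ) 1, 1 - s ∈ Icc (0 : ℝ) 1 := fun s hs =>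
    ⟨by linarith [hs.2], by linarith [hs.1]⟩
  obtain ⟨A, hA, κ, w, hlt, hm, k0, k1, hs, hu, hg⟩ :=
    h.exists_projection hO hOZ hG hL hN hGH hx
  obtain ⟨A', hA', κ', w', hlt', hm', k0', k1', hs', hu', hg'⟩ :=
    h.exists_projection hO hOZ hG hL hN hGH hx'
  obtain ⟨e1, e2⟩ := hU _ _ _ _ hg (hg'.reverse hrev)
    (fun u hu => h.sub_smul_mem (hOZ (hx.mapsTo (hx.subset (hm hu)))))
    (fun u hu => h.sub_smul_mem (hOZ (hx'.mapsTo (hx'.subset (hm' (hrev u hu))))))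
    (by simpa only [k0, k1', sub_zero] using h0) (by simpa only [k1, k0', sub_self] using h1)
  have a1 := (hu 0 m0).2.2
  have a2 := (hu' 1 m1).2.2
  have a3 := e1 m0
  simp only [sub_zero] at a3
  rw [a3, e2 m0] at a1
  simp only [sub_zero, map_neg, neg_apply, neg_neg] at a1
  rw [a2] at a1
  exact ((pow_left_inj₀ (sub_pos.2 hlt').le (sub_pos.2 hlt).le two_ne_zero).1 a1).symm

end IsStaticMetric

end

section

theorem IsStaticMetric.mono {E : Type*} [NormedAddCommGroup E] [NormedSpace ℝ E]
    {H : E → E →L[ℝ] E →L[ℝ] ℝ} {e : E} {τ : E → ℝ} {Z Z' : Set E} (h : IsStaticMetric H e τ Z)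
    (hZ : Z' ⊆ Z) (hZ' : IsOpen Z') (hadd : ∀ y ∈ Z', ∀ t : ℝ, y + t • e ∈ Z') :
    IsStaticMetric H e τ Z' :=
  ⟨hZ', hadd, h.contDiffOn.mono hZ, fun y hy => h.lorentz y (hZ hy), fun y hy => h.self y (hZ hy),
    fun y hy => h.invariant y (hZ hy), fun y hy => h.hasFDerivAt y (hZ hy)⟩

theorem IsLorentzForm.smul {E : Type*} [NormedAddCommGroup E] [NormedSpace ℝ E]
    {b : E →L[ℝ] E →L[ℝ] ℝ} (hb : IsLorentzForm b) {c : ℝ} (hc : 0 < c) :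
    IsLorentzForm (c • b) := by
  obtain ⟨v, hv, hp⟩ := hb.exists_timelike
  refine ⟨fun v w => by simp [hb.symm v w], v, by simpa using mul_neg_of_pos_of_neg hc hv,
    fun w hw h => ?_⟩
  have : b v w = 0 := by simpa [hc.ne'] using h
  simpa using mul_pos hc (hp w hw this)

namespace Spacetime

section StaticCoordinates

variable {G : E4 → E4 →L[ℝ] E4 →L[ℝ] ℝ} {D : Set E4}

theorem fderiv_unitMetric_time (hD : IsOpen D) (hG : ContDiffOn ℝ ∞ G D)
    (hN : ∀ y ∈ D, G y e0 e0 < 0) (hK : ∀ y ∈ D, ∃ c : ℝ, fderiv ℝ G y e0 = c • G y) {y : E4}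
    (hy : y ∈ D) : fderiv ℝ (unitMetric G e0) y e0 = 0 := by
  obtain ⟨c, hc⟩ := hK y hy
  have hne := (hN y hy).ne
  ext1 a
  ext1 b
  have h1 := fderiv_eq_unitMetric hD hG hN hy e0 a b
  rw [hc] at h1
  simp only [smul_apply, smul_eq_mul, unitMetric_apply] at h1
  have h2 : -(c * G y e0 e0) * ((-G y e0 e0)⁻¹ * G y a b) = c * G y a b := by
    field_simp
  rw [h2] at h1
  have h3 : -G y e0 e0 * fderiv ℝ (unitMetric G e0) y e0 a b = 0 := by linarith
  simpa [hne] using h3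

theorem fderiv_unitMetric_closed (hD : IsOpen D) (hG : ContDiffOn ℝ ∞ G D)
    (hN : ∀ y ∈ D, G y e0 e0 < 0) (hK : ∀ y ∈ D, ∃ c : ℝ, fderiv ℝ G y e0 = c • G y)
    (hI : ∀ y ∈ D, ∀ u w, G y e0 u = 0 → G y e0 w = 0 →
      fderiv ℝ G y u e0 w = fderiv ℝ G y w e0 u) {y : E4} (hy : y ∈ D) (u w : E4) :
    fderiv ℝ (unitMetric G e0) y u e0 w = fderiv ℝ (unitMetric G e0) y w e0 u := by
  have hne : -G y e0 e0 ≠ 0 := by have := hN y hy; linarith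
  have hself := unitMetric_self (hN y hy)
  have h1 : ∀ u w, unitMetric G e0 y e0 u = 0 → unitMetric G e0 y e0 w = 0 →
      fderiv ℝ (unitMetric G e0) y u e0 w = fderiv ℝ (unitMetric G e0) y w e0 u := by
    intro u w hu hw
    have a1 := fderiv_eq_unitMetric hD hG hN hy u e0 w
    have a2 := fderiv_eq_unitMetric hD hG hN hy w e0 u
    have hu' : G y e0 u = 0 := by
      rw [unitMetric_apply] at hu
      exact (mul_eq_zero.1 hu).resolve_left (inv_ne_zero hne)
    have hw' : G y e0 w = 0 := by
      rw [unitMetric_apply] at hw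
      exact (mul_eq_zero.1 hw).resolve_left (inv_ne_zero hne)
    rw [hI y hy u w hu' hw', a2, hu, hw] at a1
    have : -G y e0 e0 * fderiv ℝ (unitMetric G e0) y u e0 w =
        -G y e0 e0 * fderiv ℝ (unitMetric G e0) y w e0 u := by linarith
    exact mul_left_cancel₀ hne this
  have h2 := fderiv_unitMetric_time hD hG hN hK hy
  have h3 : ∀ u, fderiv ℝ (unitMetric G e0) y u e0 e0 = 0 := fun u => by
    have hd : HasFDerivAt (unitMetric G e0) (fderiv ℝ (unitMetric G e0) y) y :=
      (((contDiffOn_unitMetric hG hN).contDiffAt (hD.mem_nhds hy)).differentiableAt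
        (by simp)).hasFDerivAt
    have a1 := (hd.clm_apply (hasFDerivAt_const e0 y)).clm_apply (hasFDerivAt_const e0 y)
    have a2 := a1.unique ((hasFDerivAt_const (-1 : ℝ) y).congr_of_eventuallyEq
      ((hD.eventually_mem hy).mono fun z hz => unitMetric_self (hN z hz)))
    simpa using congrArg (fun L => L u) a2
  have h4 := h1 (u + unitMetric G e0 y e0 u • e0) (w + unitMetric G e0 y e0 w • e0)
    (by simp [hself]) (by simp [hself])
  simpa [h2, h3] using h4

theorem unitMetric_spaceProj (hD : IsOpen D) (hG : ContDiffOn ℝ ∞ G D)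
    (hN : ∀ y ∈ D, G y e0 e0 < 0) (hK : ∀ y ∈ D, ∃ c : ℝ, fderiv ℝ G y e0 = c • G y)
    (hs : ∀ y ∈ D, ∀ s ∈ Icc (0 : ℝ) 1, spaceProj y + (s * y 0) • e0 ∈ D) {y : E4} (hy : y ∈ D) :
    unitMetric G e0 (spaceProj y) = unitMetric G e0 y := by
  have hd : ∀ s ∈ Icc (0 : ℝ) 1,
      HasDerivAt (fun s => unitMetric G e0 (spaceProj y + (s * y 0) • e0)) 0 s := fun s hs' => by
    have hm := hs y hy s hs'
    have h1 : HasFDerivAt (unitMetric G e0) _ (spaceProj y + (s * y 0) • e0) :=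
      (((contDiffOn_unitMetric hG hN).contDiffAt (hD.mem_nhds hm)).differentiableAt
        (by simp)).hasFDerivAt
    have h2 : HasDerivAt (fun s : ℝ => spaceProj y + (s * y 0) • e0) (y 0 • e0) s := by
      simpa using (((hasDerivAt_id s).mul_const (y 0)).smul_const e0).const_add (spaceProj y)
    refine (h1.comp_hasDerivAt s h2).congr_deriv ?_
    rw [map_smul, fderiv_unitMetric_time hD hG hN hK hm, smul_zero]
  have := norm_image_sub_le_of_norm_deriv_le_Icc hd (K := 0) (fun s _ => by simp)
    (left_mem_Icc.2 zero_le_one) (right_mem_Icc.2 zero_le_one)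
  rw [zero_mul (|(0 : ℝ) - 1|), norm_le_zero_iff, sub_eq_zero, one_mul, zero_mul, zero_smul,
    add_zero, spaceProj_add] at this
  exact this

/-- Around the time axis, a metric for which the time direction is conformally Killing and
irrotational is conformal to a static metric, whose spacelike hypersurfaces contain at most one
geodesic between any two points. -/
theorem exists_isStaticMetric (hD : IsOpen D) (h0 : (0 : E4) ∈ D) (hG : ContDiffOn ℝ ∞ G D)
    (hL : ∀ y ∈ D, IsLorentzForm (G y))
    (hN : ∀ y ∈ D, G y e0 e0 < 0) (hK : ∀ y ∈ D, ∃ c : ℝ, fderiv ℝ G y e0 = c • G y)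
    (hI : ∀ y ∈ D, ∀ u w, G y e0 u = 0 → G y e0 w = 0 →
      fderiv ℝ G y u e0 w = fderiv ℝ G y w e0 u)
    (hs : ∀ y ∈ D, ∀ s ∈ Icc (0 : ℝ) 1, spaceProj y + (s * y 0) • e0 ∈ D) :
    ∃ (H : E4 → E4 →L[ℝ] E4 →L[ℝ] ℝ) (τ : E4 → ℝ) (Z : Set E4), IsStaticMetric H e0 τ Z ∧
      (∀ t : ℝ, t • e0 ∈ Z) ∧ EqOn H (unitMetric G e0) (D ∩ Z) ∧
      ∀ x v y w : ℝ → E4, IsGeodesicCurve (connection H) (Icc 0 1) x v →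
        IsGeodesicCurve (connection H) (Icc 0 1) y w → MapsTo x (Icc 0 1) (Z ∩ τ ⁻¹' {0}) →
        MapsTo y (Icc 0 1) (Z ∩ τ ⁻¹' {0}) → x 0 = y 0 → x 1 = y 1 →
        EqOn x y (Icc 0 1) ∧ EqOn v w (Icc 0 1) := by
  obtain ⟨r₀, hr₀, hb⟩ := Metric.isOpen_iff.1 hD 0 h0
  have hopen : ∀ r : ℝ, IsOpen (spaceProj ⁻¹' ball (0 : E4) r) := fun r =>
    isOpen_ball.preimage spaceProj.continuous
  have hadd : ∀ r : ℝ, ∀ y ∈ spaceProj ⁻¹' ball (0 : E4) r, ∀ t : ℝ,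
      y + t • e0 ∈ spaceProj ⁻¹' ball (0 : E4) r := fun r y hy t => by
    rw [mem_preimage, spaceProj_add_smul]
    exact hy
  set H : E4 → E4 →L[ℝ] E4 →L[ℝ] ℝ := fun y => unitMetric G e0 (spaceProj y) with hH
  set Z := spaceProj ⁻¹' ball (0 : E4) r₀ with hZ
  have hZD : ∀ y ∈ Z, spaceProj y ∈ D := fun y hy => hb hy
  have hU := contDiffOn_unitMetric hG hN
  have hHs : ContDiffOn ℝ ∞ H Z := hU.comp spaceProj.contDiff.contDiffOn hZD
  have hHd : ∀ y ∈ Z, HasFDerivAt H (fderiv ℝ (unitMetric G e0) (spaceProj y)) y :=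
    fun y hy => by
    have h1 : HasFDerivAt (unitMetric G e0) _ (spaceProj y) :=
      ((hU.contDiffAt (hD.mem_nhds (hZD y hy))).differentiableAt (by simp)).hasFDerivAt
    refine (h1.comp y spaceProj.hasFDerivAt).congr_fderiv ?_
    ext1 u
    rw [ContinuousLinearMap.comp_apply, spaceProj_apply u, map_sub, map_smul,
      fderiv_unitMetric_time hD hG hN hK (hZD y hy), smul_zero, sub_zero]
  have hform : ∀ y ∈ Z, HasFDerivAt (fun y => -(H y e0))
      (-((fderiv ℝ (unitMetric G e0) (spaceProj y)).flip e0)) y := fun y hy => by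
    refine ((hHd y hy).clm_apply (hasFDerivAt_const e0 y)).neg.congr_fderiv ?_
    ext; simp
  have hdiff : DifferentiableOn ℝ (fun y => -(H y e0)) Z := fun y hy =>
    (hform y hy).differentiableAt.differentiableWithinAt
  have hconv : Convex ℝ Z := (convex_ball (0 : E4) r₀).linear_preimage spaceProj.toLinearMap
  obtain ⟨f, hf⟩ := hconv.exists_forall_hasFDerivAt_of_fderiv_symmetric (hopen r₀) hdiff
    fun y hy u w => by
      rw [(hform y hy).fderiv]
      simpa using fderiv_unitMetric_closed hD hG hN hK hI (hZD y hy) u w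
  have hst : IsStaticMetric H e0 (fun y => f y - f 0) Z := by
    refine ⟨hopen r₀, hadd r₀, hHs, fun y hy => ?_, fun y hy => unitMetric_self (hN _ (hZD y hy)),
      fun y hy t => ?_, fun y hy => (hf y hy).sub_const _⟩
    · exact (hL _ (hZD y hy)).smul (inv_pos.2 (neg_pos.2 (hN _ (hZD y hy))))
    · simp only [hH, spaceProj_add_smul]
  have h0Z : (0 : E4) ∈ Z := by simp [hZ, hr₀]
  obtain ⟨R, hR, -, huniq⟩ := exists_geodesic_unique (hopen r₀) h0Z
    (contDiffOn_connection (hopen r₀) hHs fun y hy => (hst.lorentz y hy).isInvertible)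
  obtain ⟨r₁, hr₁, hτ⟩ := Metric.continuousAt_iff.1 (hf 0 h0Z).continuousAt (R / 2) (by positivity)
  set r := min r₀ (min r₁ (R / 2)) with hr
  have hrpos : 0 < r := by positivity
  have hsub : spaceProj ⁻¹' ball (0 : E4) r ⊆ Z :=
    preimage_mono (ball_subset_ball (min_le_left _ _))
  have hsmall : (spaceProj ⁻¹' ball (0 : E4) r) ∩ (fun y => f y - f 0) ⁻¹' {0} ⊆ ball 0 R := by
    rintro y ⟨hy, hy0⟩
    have hyr : ‖spaceProj y‖ < r := by simpa using hy
    have hyZ : spaceProj y ∈ Z := by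
      rw [hZ, mem_preimage, spaceProj_idem]
      exact hsub hy
    have h1 := hst.time_add_smul hyZ (y 0)
    rw [spaceProj_add, show f y - f 0 = 0 from hy0] at h1
    have h2 : |f (spaceProj y) - f 0| < R / 2 := by
      have := hτ (x := spaceProj y) (by
        rw [dist_zero_right]; exact hyr.trans_le ((min_le_right _ _).trans (min_le_left _ _)))
      rwa [Real.dist_eq] at this
    have h3 : |y 0| < R / 2 := by
      rw [show y 0 = -(f (spaceProj y) - f 0) by linarith, abs_neg]
      exact h2
    have h4 : ‖spaceProj y‖ < R / 2 := hyr.trans_le ((min_le_right _ _).trans (min_le_right _ _))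
    rw [mem_ball_zero_iff]
    calc ‖y‖ = ‖spaceProj y + y 0 • e0‖ := by rw [spaceProj_add]
      _ ≤ ‖spaceProj y‖ + ‖y 0 • e0‖ := norm_add_le _ _
      _ = ‖spaceProj y‖ + |y 0| := by rw [norm_smul, Real.norm_eq_abs]; simp [e0]
      _ < R := by linarith
  refine ⟨H, fun y => f y - f 0, spaceProj ⁻¹' ball 0 r, hst.mono hsub (hopen r) (hadd r),
    fun t => by simp [hrpos], fun y hy => unitMetric_spaceProj hD hG hN hK hs hy.1,
    fun x v y w hx hy hxm hym => huniq x v y w hx hy (fun s hs => hsmall (hxm hs))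
      (fun s hs => hsmall (hym hs))⟩

end StaticCoordinates

end Spacetime

end

section

theorem IsNullRay.inter {E : Type*} [NormedAddCommGroup E] [NormedSpace ℝ E]
    {G : E → E →L[ℝ] E →L[ℝ] ℝ} {e : E} {O Z : Set E} {J : Set ℝ} {x v : ℝ → E}
    (h : IsNullRay G e O J x v) (hZ : IsOpen Z) (hx : MapsTo x (Icc 0 1) Z) :
    IsNullRay G e (O ∩ Z) (J ∩ x ⁻¹' Z) x v where
  isOpen := h.contDiffOn.continuousOn.isOpen_inter_preimage h.isOpen hZ
  subset := fun _ hs => ⟨h.subset hs, hx hs⟩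
  mapsTo := fun _ hs => ⟨h.mapsTo hs.1, hs.2⟩
  contDiffOn := h.contDiffOn.mono inter_subset_left
  geodesic := ⟨fun s hs => h.geodesic.hasDerivAt s hs.1,
    fun s hs => h.geodesic.hasDerivAt_velocity s hs.1⟩
  null := fun s hs => h.null s hs.1
  future := fun s hs => h.future s hs.1

theorem IsNullRay.mono {E : Type*} [NormedAddCommGroup E] [NormedSpace ℝ E]
    {G : E → E →L[ℝ] E →L[ℝ] ℝ} {e : E} {O O' : Set E} {J : Set ℝ} {x v : ℝ → E}
    (h : IsNullRay G e O J x v) (hO : O ⊆ O') : IsNullRay G e O' J x v :=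
  { h with mapsTo := h.mapsTo.mono_right hO }

namespace Spacetime

variable {M : Type*} [TopologicalSpace M] [ChartedSpace (EuclideanSpace ℝ (Fin 4)) M]
variable {V : (x : M) → TangentSpace (𝓡 4) x} {φ : OpenPartialHomeomorph M E4}

theorem IsClockIn.comp_add {γ : ℝ → M} {I : Set ℝ} (h : IsClockIn V γ I) (a : ℝ) :
    IsClockIn V (fun t => γ (t + a)) {t | t + a ∈ I} where
  isOpen := h.isOpen.preimage (continuous_add_const a)
  ordConnected := ⟨fun _ hx _ hy _ hz =>
    h.ordConnected.out hx hy ⟨by linarith [hz.1], by linarith [hz.2]⟩⟩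
  integralCurve := h.integralCurve.comp_add a
  embedding := by
    have h1 : IsEmbedding (fun t : {t | t + a ∈ I} => (⟨(t : ℝ) + a, t.2⟩ : I)) := by
      refine IsEmbedding.of_comp (by fun_prop) continuous_subtype_val ?_
      exact (Homeomorph.addRight a).isEmbedding.comp IsEmbedding.subtypeVal
    exact h.embedding.comp h1

variable [IsManifold (𝓡 4) ∞ M] {S : Spacetime M}

/-- The coordinate data of a static neighbourhood of a clock. -/
structure IsStaticBox (S : Spacetime M) (V : (x : M) → TangentSpace (𝓡 4) x)
    (φ : OpenPartialHomeomorph M E4) (H : E4 → E4 →L[ℝ] E4 →L[ℝ] ℝ) (τ : E4 → ℝ) (Z : Set E4) :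
    Prop where
  flowBox : IsFlowBox V φ
  static : IsStaticMetric H e0 τ Z
  eqOn : EqOn H (unitMetric (S.metricCLM φ) e0) (φ.target ∩ Z)
  unique : ∀ x v y w : ℝ → E4, IsGeodesicCurve (connection H) (Icc 0 1) x v →
    IsGeodesicCurve (connection H) (Icc 0 1) y w → MapsTo x (Icc 0 1) (Z ∩ τ ⁻¹' {0}) →
    MapsTo y (Icc 0 1) (Z ∩ τ ⁻¹' {0}) → x 0 = y 0 → x 1 = y 1 →
    EqOn x y (Icc 0 1) ∧ EqOn v w (Icc 0 1)

namespace IsStaticBox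

variable {H : E4 → E4 →L[ℝ] E4 →L[ℝ] ℝ} {τ : E4 → ℝ} {Z : Set E4}

theorem isOpen_inter (h : IsStaticBox S V φ H τ Z) : IsOpen (φ.target ∩ Z) :=
  φ.open_target.inter h.static.isOpen

theorem contDiffOn (h : IsStaticBox S V φ H τ Z) :
    ContDiffOn ℝ ∞ (S.metricCLM φ) (φ.target ∩ Z) :=
  (S.contDiffOn_metricCLM h.flowBox.mem).mono inter_subset_left

theorem lorentz (h : IsStaticBox S V φ H τ Z) :
    ∀ y ∈ φ.target ∩ Z, IsLorentzForm (S.metricCLM φ y) := fun _ hy =>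
  S.isLorentzForm_metricCLM h.flowBox.mem hy.1

theorem exists_isNullRay (h : IsStaticBox S V φ H τ Z) (hV : S.IsObserverField V) {p q : M}
    {c : ℝ → M} (hc : S.IsLightRay (φ.source ∩ φ ⁻¹' Z) p q c) :
    ∃ J v, IsNullRay (S.metricCLM φ) e0 (φ.target ∩ Z) J (fun s => φ (c s)) v := by
  obtain ⟨J, hJ⟩ := IsLightRay.isNullRay hV h.flowBox.mem h.flowBox.field inter_subset_left hc
  exact ⟨_, _, hJ.inter h.static.isOpen fun s hs => (hc.2.2.1 hs).2⟩

theorem clock_eq (h : IsStaticBox S V φ H τ Z) {γ : ℝ → M} {I : Set ℝ} (hγ : IsClockIn V γ I)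
    (hm : MapsTo γ I (φ.source ∩ φ ⁻¹' Z)) {t t' : ℝ} (ht : t ∈ I) (ht' : t' ∈ I) :
    φ (γ t') = φ (γ t) + (t' - t) • e0 :=
  hγ.chart_eq h.flowBox.mem h.flowBox.field (fun _ hs => (hm hs).1) ht ht'

theorem clock_time (h : IsStaticBox S V φ H τ Z) {γ : ℝ → M} {I : Set ℝ} (hγ : IsClockIn V γ I)
    (hm : MapsTo γ I (φ.source ∩ φ ⁻¹' Z)) {t t' : ℝ} (ht : t ∈ I) (ht' : t' ∈ I) :
    τ (φ (γ t')) = τ (φ (γ t)) + (t' - t) := by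
  rw [h.clock_eq hγ hm ht ht', h.static.time_add_smul (hm ht).2]

theorem clock_proj (h : IsStaticBox S V φ H τ Z) {γ : ℝ → M} {I : Set ℝ} (hγ : IsClockIn V γ I)
    (hm : MapsTo γ I (φ.source ∩ φ ⁻¹' Z)) {t t' : ℝ} (ht : t ∈ I) (ht' : t' ∈ I) :
    φ (γ t') - τ (φ (γ t')) • e0 = φ (γ t) - τ (φ (γ t)) • e0 := by
  rw [h.clock_time hγ hm ht ht', h.clock_eq hγ hm ht ht']
  module

/-- Two light rays from an event to a clock, or from a clock to an event, agree. -/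
theorem lightRay_eqOn (h : IsStaticBox S V φ H τ Z) (hV : S.IsObserverField V) {p q p' q' : M}
    {c c' : ℝ → M} (hc : S.IsLightRay (φ.source ∩ φ ⁻¹' Z) p q c)
    (hc' : S.IsLightRay (φ.source ∩ φ ⁻¹' Z) p' q' c')
    (hp : φ p - τ (φ p) • e0 = φ p' - τ (φ p') • e0)
    (hq : φ q - τ (φ q) • e0 = φ q' - τ (φ q') • e0) (hpq : p = p' ∨ q = q') :
    EqOn c c' (Icc 0 1) := by
  obtain ⟨J, v, hx⟩ := h.exists_isNullRay hV hc
  obtain ⟨J', v', hx'⟩ := h.exists_isNullRay hV hc'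
  have := h.static.nullRay_eqOn h.isOpen_inter inter_subset_right h.contDiffOn h.lorentz
    (fun y hy => h.flowBox.metric_timelike hV hy.1) h.eqOn h.unique hx hx'
    (by simpa only [hc.1, hc'.1] using hp) (by simpa only [hc.2.1, hc'.2.1] using hq)
    (by
      simp only [hc.1, hc'.1, hc.2.1, hc'.2.1]
      exact hpq.imp (congrArg φ) (congrArg φ))
  intro s hs
  exact φ.injOn (hc.2.2.1 hs).1 (hc'.2.2.1 hs).1 (this hs)

theorem isRadarNeighborhood (h : IsStaticBox S V φ H τ Z) (hV : S.IsObserverField V) {γ : ℝ → M}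
    {I : Set ℝ} (hγ : IsClockIn V γ I) (hm : MapsTo γ I (φ.source ∩ φ ⁻¹' Z)) {t : ℝ}
    (ht : t ∈ I) :
    ∃ U, γ t ∈ U ∧ S.IsRadarNeighborhood U (φ.source ∩ φ ⁻¹' Z) γ I := by
  set p := φ (γ t) with hp
  have hpO : p ∈ φ.target ∩ Z := ⟨φ.map_source (hm ht).1, (hm ht).2⟩
  obtain ⟨C, hC, hev⟩ := exists_null_rays h.isOpen_inter hpO h.contDiffOn h.lorentz
    (h.flowBox.metric_timelike hV hpO.1)
  obtain ⟨δ, hδ, hδI⟩ := Metric.isOpen_iff.1 hγ.isOpen t ht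
  have hI : ∀ s : ℝ, |s| < δ → t + s ∈ I := fun s hs => hδI (by simpa [Real.dist_eq] using hs)
  have hline : ∀ s : ℝ, |s| < δ → φ (γ (t + s)) = p + s • e0 := fun s hs => by
    rw [h.clock_eq hγ hm ht (hI s hs), add_sub_cancel_left]
  have hne : ‖e0‖ = 1 := by simp [e0]
  obtain ⟨ε, hε, hεs⟩ := Metric.mem_nhds_iff.1 (hev.and (h.isOpen_inter.eventually_mem hpO))
  set ρ := min ε (δ / (C + 1)) with hρ
  have hρpos : 0 < ρ := by positivity
  have hρδ : ∀ z ∈ ball p ρ, (C + 1) * ‖z - p‖ < δ := fun z hz => by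
    rw [mem_ball_iff_norm] at hz
    have := hz.trans_le (min_le_right _ _)
    rwa [lt_div_iff₀ (by positivity), mul_comm] at this
  have hsmall : ∀ z ∈ ball p ρ, ∀ s : ℝ, ∀ x v : ℝ → E4, (∀ r ∈ Icc (0 : ℝ) 1,
      HasDerivAt x (v r) r) → (∀ r ∈ Icc (0 : ℝ) 1, ‖v r‖ ≤ C * ‖z - p‖) →
      (x 0 = z ∧ x 1 = p + s • e0 ∨ x 0 = p + s • e0 ∧ x 1 = z) → |s| < δ := by
    intro z hz s x v hx hv hxs
    have h1 := norm_image_sub_le_of_norm_deriv_le_Icc hx hv (left_mem_Icc.2 zero_le_one)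
      (right_mem_Icc.2 zero_le_one)
    rw [zero_sub, abs_neg, abs_one, mul_one] at h1
    have h2 : ‖z - (p + s • e0)‖ ≤ C * ‖z - p‖ := by
      rcases hxs with ⟨a, b⟩ | ⟨a, b⟩
      · rwa [a, b] at h1
      · rwa [a, b, norm_sub_rev] at h1
    calc |s| = ‖s • e0‖ := by rw [norm_smul, hne, mul_one, Real.norm_eq_abs]
      _ = ‖(z - p) - (z - (p + s • e0))‖ := by congr 1; abel
      _ ≤ ‖z - p‖ + ‖z - (p + s • e0)‖ := norm_sub_le _ _
      _ ≤ ‖z - p‖ + C * ‖z - p‖ := by gcongr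
      _ = (C + 1) * ‖z - p‖ := by ring
      _ < δ := hρδ z hz
  refine ⟨φ.source ∩ φ ⁻¹' ball p ρ, ⟨(hm ht).1, mem_ball_self hρpos⟩,
    φ.isOpen_inter_preimage isOpen_ball, fun q hq => ⟨hq.1, ?_⟩, ?_⟩
  · exact (hεs (ball_subset_ball (min_le_left _ _) hq.2)).2.2
  rintro q ⟨⟨hqs, hqb⟩, hqγ⟩
  have hoff : ∀ s : ℝ, φ q ≠ p + s • e0 := fun s hs => by
    have h1 : |s| < δ := by
      have h2 := hρδ _ hqb
      rw [hs, add_sub_cancel_left, norm_smul, hne, mul_one, Real.norm_eq_abs] at h2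
      have := mul_nonneg hC.le (abs_nonneg s)
      linarith
    refine hqγ ⟨t + s, hI s h1, φ.injOn (hm (hI s h1)).1 hqs ?_⟩
    rw [hline s h1, hs]
  obtain ⟨⟨s, x, v, hx, x0, x1, hb⟩, ⟨s', x', v', hx', x0', x1', hb'⟩⟩ :=
    (hεs (ball_subset_ball (min_le_left _ _) hqb)).1 hoff
  have hsδ : |s| < δ := hsmall _ hqb s x v
    (fun r hr => hx.geodesic.hasDerivAt r (hx.subset hr)) hb (Or.inl ⟨x0, x1⟩)
  have hsδ' : |s'| < δ := hsmall _ hqb s' x' v'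
    (fun r hr => hx'.geodesic.hasDerivAt r (hx'.subset hr)) hb' (Or.inr ⟨x0', x1'⟩)
  have hend : ∀ s : ℝ, |s| < δ → φ.symm (p + s • e0) = γ (t + s) := fun s hs => by
    rw [← hline s hs, φ.left_inv (hm (hI s hs)).1]
  have hW : ∀ {J : Set ℝ} {x v : ℝ → E4},
      IsNullRay (S.metricCLM φ) e0 (φ.target ∩ Z) J x v →
      ∀ r ∈ Icc (0 : ℝ) 1, φ.symm (x r) ∈ φ.source ∩ φ ⁻¹' Z := fun hx r hr => by
    have h1 := hx.mapsTo (hx.subset hr)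
    refine ⟨φ.map_target h1.1, ?_⟩
    rw [mem_preimage, φ.right_inv h1.1]
    exact h1.2
  have r1 := (hx.mono inter_subset_left).isLightRay hV h.flowBox.mem h.flowBox.field (hW hx)
  have r2 := (hx'.mono inter_subset_left).isLightRay hV h.flowBox.mem h.flowBox.field (hW hx')
  rw [x0, x1, φ.left_inv hqs, hend s hsδ] at r1
  rw [x0', x1', φ.left_inv hqs, hend s' hsδ'] at r2
  refine ⟨⟨_, ⟨_, hI s hsδ, r1⟩, ?_⟩, ⟨_, ⟨_, hI s' hsδ', r2⟩, ?_⟩⟩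
  · rintro c ⟨a, ha, hc⟩
    exact h.lightRay_eqOn hV hc r1 rfl (h.clock_proj hγ hm (hI s hsδ) ha) (Or.inl rfl)
  · rintro c ⟨a, ha, hc⟩
    exact h.lightRay_eqOn hV hc r2 (h.clock_proj hγ hm (hI s' hsδ') ha) rfl (Or.inr rfl)

theorem synchronous (h : IsStaticBox S V φ H τ Z) (hV : S.IsObserverField V) {γ γ' : ℝ → M}
    {I I' : Set ℝ} (hγ : IsSetClock V (φ.source ∩ φ ⁻¹' Z) (fun m => τ (φ m)) γ I)
    (hγ' : IsSetClock V (φ.source ∩ φ ⁻¹' Z) (fun m => τ (φ m)) γ' I')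
    (hr : ∀ t ∈ I', S.RadarAt (φ.source ∩ φ ⁻¹' Z) γ I (γ' t)) :
    S.Synchronous (φ.source ∩ φ ⁻¹' Z) γ I γ' I' := by
  intro t ht
  obtain ⟨⟨c₂, ⟨t₂, ht₂, hc₂⟩, -⟩, ⟨c₁, ⟨t₁, ht₁, hc₁⟩, -⟩⟩ := hr t ht
  refine ⟨t₁, ht₁, t₂, ht₂, ⟨c₁, hc₁⟩, ⟨c₂, hc₂⟩, ?_⟩
  obtain ⟨J, v, hx⟩ := h.exists_isNullRay hV hc₁
  obtain ⟨J', v', hx'⟩ := h.exists_isNullRay hV hc₂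
  have := h.static.nullRay_time_eq h.isOpen_inter inter_subset_right h.contDiffOn h.lorentz
    (fun y hy => h.flowBox.metric_timelike hV hy.1) h.eqOn h.unique hx hx'
    (by simpa only [hc₁.1, hc₂.2.1] using h.clock_proj hγ.1 hγ.2.1 ht₂ ht₁)
    (by simp only [hc₁.2.1, hc₂.1])
  simp only [hc₁.1, hc₁.2.1, hc₂.1, hc₂.2.1] at this
  have a1 : τ (φ (γ t₁)) = t₁ := hγ.2.2 t₁ ht₁
  have a2 : τ (φ (γ t₂)) = t₂ := hγ.2.2 t₂ ht₂
  have a3 : τ (φ (γ' t)) = t := hγ'.2.2 t ht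
  rw [a1, a2, a3] at this
  linarith

end IsStaticBox

/-- An irrotational conformal Killing observer field has Property A. -/
theorem IsConformalKilling.propertyA [T2Space M] (hV : S.IsObserverField V)
    (hK : S.IsConformalKilling V) (hI : S.IsIrrotational V) : S.PropertyA V := by
  intro γ₀ I₀ hγ₀
  rcases I₀.eq_empty_or_nonempty with rfl | ⟨t₀, ht₀⟩
  · exact ⟨∅, isOpen_empty, by simp, fun γ I _ hm t ht => (hm ht).elim, fun _ => 0,
      fun γ I _ hm => ⟨0, fun t ht => (hm ht).elim⟩,
      fun γ I _ γ' I' h' _ _ t ht => (h'.2.1 ht).elim⟩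
  have hne : ∀ x, V x ≠ 0 := fun x hx => by
    have := hV.timelike x
    rw [hx] at this
    simp at this
  obtain ⟨φ, hφ, hγφ, hs⟩ := exists_tubular_isFlowBox hV.smooth hne (hγ₀.comp_add t₀)
    (by simpa using ht₀)
  have h0 : (0 : E4) ∈ φ.target := by
    obtain ⟨a, b⟩ := hγφ 0 (by simpa using ht₀)
    rw [zero_smul] at b
    rw [← b]
    exact φ.map_source a
  obtain ⟨f, hf⟩ := hK
  obtain ⟨H, τ, Z, hst, hZ, heq, huniq⟩ := exists_isStaticMetric φ.open_target h0
    (S.contDiffOn_metricCLM hφ.mem) (fun y hy => S.isLorentzForm_metricCLM hφ.mem hy)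
    (fun y hy => hφ.metric_timelike hV hy)
    (fun y hy => ⟨f (φ.symm y), by
      ext u w
      rw [← hφ.covDeriv_add hy, hf φ hφ.mem y hy u w, metricInChart_eq]
      rfl⟩)
    (fun y hy u w hu hw => by
      have h1 := hI φ hφ.mem y hy u w (by rwa [metricInChart_eq, hφ.field y hy])
        (by rwa [metricInChart_eq, hφ.field y hy])
      have h2 := hφ.covDeriv_sub (S := S) hy u w
      linarith) hs
  have hbox : IsStaticBox S V φ H τ Z := ⟨hφ, hst, heq, huniq⟩
  refine ⟨φ.source ∩ φ ⁻¹' Z, φ.isOpen_inter_preimage hst.isOpen, ?_,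
    fun γ I hγ hm t ht => hbox.isRadarNeighborhood hV hγ hm ht, fun m => τ (φ m), ?_,
    fun γ I hγ γ' I' hγ' _ hr => hbox.synchronous hV hγ hγ' hr⟩
  · rintro _ ⟨t, ht, rfl⟩
    obtain ⟨a, b⟩ := hγφ (t - t₀) (by simpa using ht)
    rw [sub_add_cancel] at a b
    refine ⟨a, ?_⟩
    rw [mem_preimage, b]
    exact hZ _
  · intro γ I hγ hm
    rcases I.eq_empty_or_nonempty with rfl | ⟨t, ht⟩
    · exact ⟨0, fun t ht => ht.elim⟩
    · exact ⟨τ (φ (γ t)) - t, fun t' ht' => by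
        have := hbox.clock_time hγ hm ht ht'
        linarith⟩

/-- A standard conformal Killing observer field is Killing. -/
theorem IsConformalKilling.isKilling (hV : S.IsObserverField V) (hst : S.IsStandard V)
    (hK : S.IsConformalKilling V) : S.IsKilling V := by
  obtain ⟨f, hf⟩ := hK
  have hf0 : ∀ x, f x = 0 := fun x => by
    obtain ⟨φ, hφ, hx, -⟩ := exists_isFlowBox hV.smooth x fun h0 => by
      have := hV.timelike x
      rw [h0] at this
      simp at this
    have hy := φ.map_source hx
    have h1 : ∀ y ∈ φ.target, S.metricCLM φ y e0 e0 = -1 := fun y hy => by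
      have := hst (φ.symm y)
      rwa [S.g_eq_metricCLM hφ.mem (φ.map_target hy), ← fieldInChart_eq, hφ.field y hy,
        φ.right_inv hy] at this
    have h2 := hf φ hφ.mem (φ x) hy e0 e0
    have hd := (differentiableAt_metricCLM (S := S) hφ.mem hy).hasFDerivAt
    have h3 := ((hd.clm_apply (hasFDerivAt_const e0 _)).clm_apply (hasFDerivAt_const e0 _)).unique
      ((hasFDerivAt_const (-1 : ℝ) (φ x)).congr_of_eventuallyEq
        ((φ.open_target.eventually_mem hy).mono h1))
    have h4 : fderiv ℝ (S.metricCLM φ) (φ x) e0 e0 e0 = 0 := by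
      simpa using congrArg (fun L => L e0) h3
    rw [hφ.covDeriv_add hy, metricInChart_eq, h1 _ hy, h4, φ.left_inv hx] at h2
    linarith
  intro φ hφ y hy u w
  rw [hf φ hφ y hy u w, hf0, zero_mul]

end Spacetime

end

theorem proposition4 {M : Type*} [TopologicalSpace M] [T2Space M]
    [ChartedSpace (EuclideanSpace ℝ (Fin 4)) M] [IsManifold (𝓡 4) ∞ M]
    (S : Spacetime M) (V : (x : M) → TangentSpace (𝓡 4) x) (hV : S.IsObserverField V) :
    (S.IsStandard V → (S.PropertyA V ↔ S.IsKilling V ∧ S.IsIrrotational V)) ∧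
    (S.PropertyA V ↔ S.IsConformalKilling V ∧ S.IsIrrotational V) := by
  have h2 : S.PropertyA V ↔ S.IsConformalKilling V ∧ S.IsIrrotational V :=
    ⟨fun h => h.isConformalKilling hV, fun h => h.1.propertyA hV h.2⟩
  refine ⟨fun hst => h2.trans ⟨fun h => ⟨h.1.isKilling hV hst, h.2⟩, fun h => ⟨⟨fun _ => 0, ?_⟩, h.2⟩⟩,
    h2⟩
  intro φ hφ y hy u w
  rw [h.1 φ hφ y hy u w, zero_mul]
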